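/- \textbf{Setting.} A measured geodesic lamination $L=(\lambda,\mu)$ on $\mathbb H^2$ is a closed set $\lambda\subset\mathbb H^2$ that is a union of pairwise disjoint complete geodesics (leaves), together with a locally finite transverse measure $\mu$ carried by $\lambda$. For a geodesic $l$ of $\mathbb H^2$ let $\angle(l,L)\in[0,\pi/2]$ be the supremum, over all points $p\in l\cap\lambda$, of the angle at $p$ between $l$ and the leaf through $p$ (and $0$ if $l\cap\lambda=\emptyset$). The bending map $\beta_L\colon\mathbb H^2\to\mathbb H^3$ is obtained by bending a totally geodesic copy of $\mathbb H^2$ in $\mathbb H^3$ along $\lambda$ by the angle $\mu$, and is defined up to postcomposition with isometries of $\mathbb H^3$: for a base point $x\in\mathbb H^2$ not on a leaf of positive weight, and up to an isometry, $\beta_L(y)$ is the limit, as the geodesic segment $[x,y]$ is divided into ever shorter pieces $I_1,\dots,I_N$ (ordered from $x$ to $y$), of $R_1R_2\cdots R_N\,y$, where $R_k$ is the rotation of $\mathbb H^3$ by the angle $\mu(I_k)$ about a leaf that crosses $I_k$ (all rotations bending towards the same side of $\mathbb H^2$; $R_k=\mathrm{id}$ if $\mu(I_k)=0$). \textbf{Statement.}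 For every $\delta>0$ there is $\epsilon>0$ with the following property. Let $L=(\lambda,\mu)$ be a measured geodesic lamination on $\mathbb H^2$ with $\mathrm{Area}_{\mathbb H^2}(\lambda)=0$ and let $l$ be a complete geodesic of $\mathbb H^2$ with $\angle(l,L)<\epsilon$. Then the bending map $\beta=\beta_L$ exists, and: (i) $\beta|_l\colon l\to\mathbb H^3$ is a $(1+\delta)$-bilipschitz embedding, that is, $\frac1{1+\delta}\,d(x,y)\le d(\beta(x),\beta(y))\le(1+\delta)\,d(x,y)$ for all $x,y\in l$. Moreover, the curve $\beta|_l$ has an ideal endpoint in $\partial_\infty\mathbb H^3$ at each of its two ends, and there is a geodesic $m$ of $\mathbb H^3$ joining these two endpoints; for this $m$: (ii) for each $x\in l$ the point $\beta(x)$ is at distance less than $\delta$ from $m$, and if $\beta|_l$ is differentiable at $x$, then its tangent vector at $x$ is $\delta$-parallel to $m$: the angle between this tangent vector and the totally geodesic hyperplane that is orthogonal to $m$ and contains $\beta(x)$ differs from $\pi/2$ by less than $\delta$; (iii) if $\Phi_m\colon\mathbb H^3\to m$ is the nearest point projection, then $\Phi_m\circ\beta|_l\colon l\to m$ is $(1+\delta)$-bilipschitz.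 -/

import Mathlib

open Filter Topology MeasureTheory

/-! ### Hyperbolic space of dimension `n`: the hyperboloid in Minkowski space -/

/-- The Minkowski form `-x₀ y₀ + x₁ y₁ + ⋯ + xₙ yₙ` on `ℝⁿ⁺¹`. -/
def mink {n : ℕ} (x y : Fin (n + 1) → ℝ) : ℝ :=
  (∑ i : Fin n, x i.succ * y i.succ) - x 0 * y 0

/-- Hyperbolic `n`-space: the upper sheet of the hyperboloid `⟨x, x⟩ = -1`. -/
abbrev Hyp (n : ℕ) : Type :=
  {x : Fin (n + 1) → ℝ // mink x x = -1 ∧ 0 < x 0}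

/-- The hyperbolic distance, `cosh d(x, y) = -⟨x, y⟩`. -/
noncomputable def hdist {n : ℕ} (x y : Hyp n) : ℝ :=
  Real.arcosh (-(mink x.1 y.1))

/-- A complete geodesic of hyperbolic `n`-space with a unit speed parametrization, given by its
point at time `0` and its unit tangent vector there. -/
structure GeodesicLine (n : ℕ) where
  base : Hyp n
  dir : Fin (n + 1) → ℝ
  dir_unit : mink dir dir = 1
  dir_tangent : mink base.1 dir = 0

theorem mink_comm {n : ℕ} (x y : Fin (n + 1) → ℝ) : mink x y = mink y x := by
  simp [mink, mul_comm]

theorem mink_comb {n : ℕ} (x y z : Fin (n + 1) → ℝ) (a b : ℝ) :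
    mink z (a • x + b • y) = a * mink z x + b * mink z y := by
  simp only [mink, Pi.add_apply, Pi.smul_apply, smul_eq_mul, mul_add, Finset.sum_add_distrib,
    mul_sub, Finset.mul_sum]
  have h1 : ∀ u : Fin (n + 1) → ℝ, ∀ c : ℝ,
      ∑ i : Fin n, z i.succ * (c * u i.succ) = ∑ i : Fin n, c * (z i.succ * u i.succ) :=
    fun u c => Finset.sum_congr rfl fun i _ => by ring
  rw [h1, h1]
  ring

theorem mink_comb_left {n : ℕ} (x y z : Fin (n + 1) → ℝ) (a b : ℝ) :
    mink (a • x + b • y) z = a * mink x z + b * mink y z := by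
  rw [mink_comm, mink_comb, mink_comm z x, mink_comm z y]

/-- The Minkowski form is nonnegative on the tangent space of the hyperboloid at `p`, and it
controls the coordinate `v₀` of a tangent vector. -/
theorem tangent_bound {n : ℕ} (p : Hyp n) (v : Fin (n + 1) → ℝ) (h : mink p.1 v = 0) :
    0 ≤ mink v v ∧ v 0 ^ 2 ≤ (p.1 0 ^ 2 - 1) * mink v v := by
  have hp := p.2.1
  have cs := Finset.sum_mul_sq_le_sq_mul_sq Finset.univ
    (fun i : Fin n => p.1 i.succ) (fun i : Fin n => v i.succ)
  simp only [mink, ← sq] at hp h ⊢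
  have hP : ∑ i : Fin n, p.1 i.succ ^ 2 = p.1 0 ^ 2 - 1 := by linarith
  have hPV : ∑ i : Fin n, p.1 i.succ * v i.succ = p.1 0 * v 0 := by linarith
  rw [hP, hPV] at cs
  have hP0 : 0 ≤ p.1 0 ^ 2 - 1 := by rw [← hP]; positivity
  have hV0 : 0 ≤ ∑ i : Fin n, v i.succ ^ 2 := by positivity
  have key : v 0 ^ 2 ≤ (p.1 0 ^ 2 - 1) * (∑ i : Fin n, v i.succ ^ 2 - v 0 ^ 2) := by
    nlinarith
  refine ⟨?_, key⟩
  by_contra hneg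
  push Not at hneg
  have : (p.1 0 ^ 2 - 1) * (∑ i : Fin n, v i.succ ^ 2 - v 0 ^ 2) ≤ 0 :=
    mul_nonpos_of_nonneg_of_nonpos hP0 hneg.le
  have hv : v 0 ^ 2 = 0 := le_antisymm (by linarith) (sq_nonneg _)
  linarith

namespace GeodesicLine

variable {n : ℕ}

/-- The velocity vector at time `t`. -/
noncomputable def vel (c : GeodesicLine n) (t : ℝ) : Fin (n + 1) → ℝ :=
  Real.sinh t • c.base.1 + Real.cosh t • c.dir

theorem pt_mem (c : GeodesicLine n) (t : ℝ) :
    mink (Real.cosh t • c.base.1 + Real.sinh t • c.dir)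
        (Real.cosh t • c.base.1 + Real.sinh t • c.dir) = -1 ∧
      0 < (Real.cosh t • c.base.1 + Real.sinh t • c.dir) 0 := by
  constructor
  · rw [mink_comb, mink_comb_left, mink_comb_left, mink_comm c.dir c.base.1, c.dir_unit, c.dir_tangent, c.base.2.1]
    nlinarith [Real.cosh_sq t]
  · have h := (tangent_bound c.base c.dir c.dir_tangent).2
    rw [c.dir_unit] at h
    have hp := c.base.2.2
    have habs : |c.dir 0| < c.base.1 0 := abs_lt_of_sq_lt_sq (by linarith) hp.le
    have h1 : |Real.sinh t| < Real.cosh t :=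
      abs_lt_of_sq_lt_sq (by linarith [Real.cosh_sq t]) (Real.cosh_pos t).le
    have h2 : |Real.sinh t * c.dir 0| < Real.cosh t * c.base.1 0 := by
      rw [abs_mul]
      exact mul_lt_mul'' h1 habs (abs_nonneg _) (abs_nonneg _)
    have h3 := (abs_lt.mp h2).1
    simp only [Pi.add_apply, Pi.smul_apply, smul_eq_mul]
    linarith

/-- The point at time `t`. -/
noncomputable def pt (c : GeodesicLine n) (t : ℝ) : Hyp n :=
  ⟨Real.cosh t • c.base.1 + Real.sinh t • c.dir, c.pt_mem t⟩

/-- The parametrization is by arc length: it is an isometric embedding of the real line. -/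
theorem hdist_pt (c : GeodesicLine n) (s t : ℝ) : hdist (c.pt s) (c.pt t) = |s - t| := by
  have h : -(mink (c.pt s).1 (c.pt t).1) = Real.cosh |s - t| := by
    simp only [pt]
    rw [mink_comb, mink_comb_left, mink_comb_left, mink_comm c.dir c.base.1, c.dir_unit, c.dir_tangent, c.base.2.1, Real.cosh_abs,
      Real.cosh_sub]
    ring
  rw [hdist, h, Real.arcosh_cosh (abs_nonneg _)]

/-- Every point has a nearest point on a given geodesic. -/
theorem exists_foot (c : GeodesicLine n) (p : Hyp n) :
    ∃ s : ℝ, ∀ t : ℝ, hdist p (c.pt s) ≤ hdist p (c.pt t) := by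
  obtain ⟨A, hA⟩ : ∃ A, A = -(mink p.1 c.base.1) := ⟨_, rfl⟩
  obtain ⟨B, hB⟩ : ∃ B, B = mink p.1 c.dir := ⟨_, rfl⟩
  have hval : ∀ t, -(mink p.1 (c.pt t).1) = A * Real.cosh t - B * Real.sinh t := by
    intro t
    simp only [pt]
    rw [mink_comb, ← hB, hA]
    ring
  -- the component of `p` orthogonal to the geodesic
  have hw0 : mink c.base.1 ((1 : ℝ) • p.1 + (1 : ℝ) • ((-A) • c.base.1 + (-B) • c.dir)) = 0 := by
    rw [mink_comb, mink_comb, c.dir_tangent, c.base.2.1, mink_comm, hA]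
    ring
  have hw := (tangent_bound c.base _ hw0).1
  have hAB : 1 ≤ A ^ 2 - B ^ 2 := by
    simp only [mink_comb, mink_comb_left] at hw
    rw [mink_comm c.base.1 p.1, mink_comm c.dir p.1, mink_comm c.dir c.base.1, c.dir_unit,
      c.dir_tangent, c.base.2.1, p.2.1, ← hB] at hw
    have hA' : mink p.1 c.base.1 = -A := by linarith
    rw [hA'] at hw
    nlinarith
  have hApos : 0 < A := by
    have cs := Finset.sum_mul_sq_le_sq_mul_sq Finset.univ
      (fun i : Fin n => p.1 i.succ) (fun i : Fin n => c.base.1 i.succ)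
    have h1 := p.2.1
    have h2 := c.base.2.1
    have h3 := p.2.2
    have h4 := c.base.2.2
    simp only [mink, ← sq] at h1 h2 hA
    have e1 : ∑ i : Fin n, p.1 i.succ ^ 2 = p.1 0 ^ 2 - 1 := by linarith
    have e2 : ∑ i : Fin n, c.base.1 i.succ ^ 2 = c.base.1 0 ^ 2 - 1 := by linarith
    rw [e1, e2] at cs
    have f1 : 0 ≤ p.1 0 ^ 2 - 1 := by rw [← e1]; positivity
    have f2 : 0 ≤ c.base.1 0 ^ 2 - 1 := by rw [← e2]; positivity
    have h5 : 0 < p.1 0 * c.base.1 0 := mul_pos h3 h4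
    have h6 : |∑ i : Fin n, p.1 i.succ * c.base.1 i.succ| < p.1 0 * c.base.1 0 :=
      abs_lt_of_sq_lt_sq (by nlinarith) h5.le
    linarith [(abs_lt.mp h6).2]
  obtain ⟨C, hC⟩ : ∃ C, C = Real.sqrt (A ^ 2 - B ^ 2) := ⟨_, rfl⟩
  have hCpos : 0 < C := by rw [hC]; exact Real.sqrt_pos.mpr (by linarith)
  have hCsq : C ^ 2 = A ^ 2 - B ^ 2 := by rw [hC]; exact Real.sq_sqrt (by linarith)
  obtain ⟨s, hs⟩ : ∃ s, Real.sinh s = B / C := ⟨_, Real.sinh_arsinh _⟩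
  have hcs : Real.cosh s = A / C := by
    have h1 : Real.cosh s ^ 2 = (A / C) ^ 2 := by
      rw [Real.cosh_sq, hs]
      field_simp
      linarith
    exact (sq_eq_sq₀ (Real.cosh_pos s).le (by positivity)).mp h1
  have hform : ∀ t, A * Real.cosh t - B * Real.sinh t = C * Real.cosh (t - s) := by
    intro t
    rw [Real.cosh_sub, hs, hcs]
    field_simp
  refine ⟨s, fun t => ?_⟩
  unfold hdist
  rw [hval, hval, hform, hform, sub_self, Real.cosh_zero, mul_one]
  exact (Real.arcosh_le_arcosh hCpos (mul_pos hCpos (Real.cosh_pos _))).mpr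
    (le_mul_of_one_le_right hCpos.le (Real.one_le_cosh _))

/-- The nearest point projection of hyperbolic space onto a geodesic. -/
noncomputable def proj (c : GeodesicLine n) (p : Hyp n) : Hyp n :=
  c.pt (Classical.choose (c.exists_foot p))

end GeodesicLine

/-- `f` is `K`-bilipschitz on `S` for the hyperbolic distances. -/
def BilipschitzOn {n k : ℕ} (K : ℝ) (f : Hyp n → Hyp k) (S : Set (Hyp n)) : Prop :=
  ∀ x ∈ S, ∀ y ∈ S,
    K⁻¹ * hdist x y ≤ hdist (f x) (f y) ∧ hdist (f x) (f y) ≤ K * hdist x y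

/-- The curve `c` converges along `F` to the ideal point `ξ`, a point of the unit sphere bounding
the projective ball model `x ↦ (x₁ / x₀, …, xₙ / x₀)`. -/
def HasIdealLimit {n : ℕ} (c : ℝ → Hyp n) (F : Filter ℝ) (ξ : Fin n → ℝ) : Prop :=
  ∑ i, ξ i ^ 2 = 1 ∧ Tendsto (fun t => fun i : Fin n => (c t).1 i.succ / (c t).1 0) F (𝓝 ξ)

/-- The curve `c` has an ideal endpoint at each of its two ends, and `m` is the geodesic that
joins these endpoints, with the same orientation as `c`. -/
def GeodesicLine.JoinsEndpointsOf {n : ℕ} (m : GeodesicLine n) (c : ℝ → Hyp n) : Prop :=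
  (∃ ξ : Fin n → ℝ, HasIdealLimit c atBot ξ ∧ HasIdealLimit m.pt atBot ξ) ∧
    ∃ ξ : Fin n → ℝ, HasIdealLimit c atTop ξ ∧ HasIdealLimit m.pt atTop ξ

/-- The angle, in `[0, π/2]`, between a nonzero tangent vector `v` and a totally geodesic
hyperplane `{x | ⟨x, N⟩ = 0}` with unit normal `N`, at a point of the hyperplane: the tangent
space of hyperbolic space there contains `N`, and `N` is the unit normal of the hyperplane. -/
noncomputable def angleWithHyperplane {n : ℕ} (v N : Fin (n + 1) → ℝ) : ℝ :=
  Real.arcsin (|mink v N| / Real.sqrt (mink v v))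

/-- The tangent vector `v` at the point `p` is `δ`-parallel to the geodesic `m`: it is
`δ`-orthogonal to the totally geodesic hyperplane that is orthogonal to `m` and contains `p`.
The hyperplane orthogonal to `m` at the point `m.pt s` is `{x | ⟨x, m.vel s⟩ = 0}`. -/
def AlmostParallel {n : ℕ} (δ : ℝ) (m : GeodesicLine n) (p : Hyp n)
    (v : Fin (n + 1) → ℝ) : Prop :=
  ∃ s : ℝ, mink p.1 (m.vel s) = 0 ∧ |angleWithHyperplane v (m.vel s) - Real.pi / 2| < δ

/-! ### Measured geodesic laminations on the hyperbolic plane -/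

/-- The hyperbolic area of a subset of the plane. The projection of the hyperboloid to its last
two coordinates `u` is a global chart, in which the area element is `du / √(1 + |u|²)`. -/
noncomputable def hypArea (A : Set (Hyp 2)) : ENNReal :=
  ∫⁻ u in (fun x : Hyp 2 => fun i : Fin 2 => x.1 i.succ) '' A,
    ENNReal.ofReal (1 / Real.sqrt (1 + ∑ i, u i ^ 2))

/-- The space of oriented (equivalently, co-oriented) complete geodesics of the hyperbolic plane.
A vector `e` with `⟨e, e⟩ = 1` stands for the geodesic `{x | ⟨x, e⟩ = 0}`, of which it is the unit
normal at each point; the same geodesic with the other orientation is `-e`. -/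
abbrev OrientedGeodesic : Type := {e : Fin 3 → ℝ // mink e e = 1}

/-- Reversal of the orientation. -/
def OrientedGeodesic.flip (e : OrientedGeodesic) : OrientedGeodesic :=
  ⟨-e.1, by simpa [mink] using e.2⟩

/-- The underlying set of points of a geodesic. -/
def OrientedGeodesic.carrier (e : OrientedGeodesic) : Set (Hyp 2) := {x | mink x.1 e.1 = 0}

/-- A measured geodesic lamination on the hyperbolic plane: a family of pairwise disjoint complete
geodesics (the leaves) whose union is closed, with a transverse measure. The latter is given as a
locally finite Borel measure on the space of geodesics which is carried by the leaves; the measure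
that it induces on a transverse arc gives to a subset of the arc the measure of the set of leaves
that cross the arc there. Leaves are listed with both orientations, and the measure is invariant
under reversal of the orientation; the leaves crossing an arc are always counted with one
orientation only, the one for which the normal points from the beginning of the arc to its end. -/
structure MeasuredLamination where
  leaves : Set OrientedGeodesic
  flip_mem : ∀ e ∈ leaves, e.flip ∈ leaves
  pairwise_disjoint : ∀ e ∈ leaves, ∀ f ∈ leaves,
    (e.carrier ∩ f.carrier).Nonempty → f = e ∨ f = e.flip
  isClosed_union : IsClosed (⋃ e ∈ leaves, e.carrier)
  measure : Measure OrientedGeodesic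
  locallyFinite : IsLocallyFiniteMeasure measure
  map_flip : measure.map OrientedGeodesic.flip = measure
  measure_compl : measure leavesᶜ = 0

/-- The lamination as a closed subset of the plane: the union of the leaves. -/
def MeasuredLamination.support (L : MeasuredLamination) : Set (Hyp 2) :=
  ⋃ e ∈ L.leaves, e.carrier

/-- The angle between a geodesic `l` and a lamination: the supremum, over the points of `l` on the
lamination, of the angle in `[0, π/2]` between `l` and the leaf through that point. It is `0` if
there is no such point. The velocity of `l` and the normal `e` of the leaf are unit vectors. -/
noncomputable def MeasuredLamination.angle (L : MeasuredLamination) (l : GeodesicLine 2) : ℝ :=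
  sSup {θ : ℝ | ∃ e ∈ L.leaves, ∃ t : ℝ, l.pt t ∈ e.carrier ∧
    θ = Real.arcsin |mink (l.vel t) e.1|}

/-! ### Bending maps -/

/-- The totally geodesic inclusion of the plane into hyperbolic 3-space (on vectors). -/
def planeIncl (x : Fin 3 → ℝ) : Fin 4 → ℝ := ![x 0, x 1, x 2, 0]

/-- The unit normal of the plane in hyperbolic 3-space. -/
def planeNormal : Fin 4 → ℝ := ![0, 0, 0, 1]

/-- The rotation of hyperbolic 3-space by the angle `θ` about the geodesic `e` of the plane: the
linear map that fixes the vectors orthogonal to `e` and to `planeNormal` and rotates the Euclidean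
plane spanned by the orthonormal vectors `e` and `planeNormal` by `θ`, from `e` to
`planeNormal`. -/
noncomputable def bendRotation (e : OrientedGeodesic) (θ : ℝ) (x : Fin 4 → ℝ) : Fin 4 → ℝ :=
  x + (mink x (planeIncl e.1) * (Real.cos θ - 1) - mink x planeNormal * Real.sin θ) •
      planeIncl e.1
    + (mink x (planeIncl e.1) * Real.sin θ + mink x planeNormal * (Real.cos θ - 1)) •
      planeNormal

/-- The `k`-th point of the division into `N` parts of the chord from `x` to `y`. Seen from the
origin, these points divide the geodesic segment `[x, y]` into `N` parts, whose lengths tend to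
zero as `N` tends to infinity. -/
noncomputable def divisionPoint (x y : Hyp 2) (N k : ℕ) : Fin 3 → ℝ :=
  (1 - (k : ℝ) / N) • x.1 + ((k : ℝ) / N) • y.1

/-- The geodesics that cross the `k`-th part of the segment `[x, y]`, with the orientation for
which the normal points towards `y`. Those through its end count, those through its beginning do
not. -/
def crossing (x y : Hyp 2) (N k : ℕ) : Set OrientedGeodesic :=
  {e | mink (divisionPoint x y N k) e.1 < 0 ∧ 0 ≤ mink (divisionPoint x y N (k + 1)) e.1}

namespace MeasuredLamination

/-- The transverse measure of the `k`-th part of the segment `[x, y]`. -/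
noncomputable def mass (L : MeasuredLamination) (x y : Hyp 2) (N k : ℕ) : ℝ :=
  (L.measure (crossing x y N k)).toReal

/-- A choice, for every `N`, of a leaf crossing each of the `N` parts of `[x, y]`; the choice is
arbitrary for the parts of transverse measure zero. -/
def IsChoiceOfLeaves (L : MeasuredLamination) (x y : Hyp 2) (e : ℕ → ℕ → OrientedGeodesic) :
    Prop :=
  ∀ N k, k < N → (e N k ∈ L.leaves ∧ e N k ∈ crossing x y N k) ∨ L.mass x y N k = 0

/-- The image of `y` when the plane is bent, along the `N` chosen leaves crossing `[x, y]`, by the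
transverse measures of the `N` parts of `[x, y]`, with `x` held fixed: the rotation about the leaf
closest to `y` is applied first, the one about the leaf closest to `x` last. -/
noncomputable def finiteBending (L : MeasuredLamination) (x y : Hyp 2)
    (e : ℕ → ℕ → OrientedGeodesic) (N : ℕ) : Fin 4 → ℝ :=
  (List.range N).foldr (fun k z => bendRotation (e N k) (L.mass x y N k) z) (planeIncl y.1)

/-- `β` is the bending map of `L`, which is defined up to an isometry of hyperbolic 3-space: for
some base point `x` that is not on a leaf of positive weight, and some isometry `g` (a linear map
preserving the Minkowski form and the upper sheet), `β y` is, for every `y`, the image under `g`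
of the limit of the finite bendings along `[x, y]`. -/
def IsBendingMap (L : MeasuredLamination) (β : Hyp 2 → Hyp 3) : Prop :=
  ∃ x : Hyp 2, L.measure {e | x ∈ e.carrier} = 0 ∧
    ∃ g : (Fin 4 → ℝ) →ₗ[ℝ] (Fin 4 → ℝ),
      (∀ v w, mink (g v) (g w) = mink v w) ∧ (∀ p : Hyp 3, 0 < g p.1 0) ∧
      ∀ y : Hyp 2, ∀ e : ℕ → ℕ → OrientedGeodesic, L.IsChoiceOfLeaves x y e →
        Tendsto (fun N => g (L.finiteBending x y e N)) atTop (𝓝 (β y).1)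

end MeasuredLamination

/-! A leaf is represented by its unit spacelike normal. Disjointness forces `1 ≤ ⟨e, f⟩²`, and for
two leaves that cross a segment in the same sense the difference of the normals is causal
(`causal_sub`). Hence the leaves separating two points are ordered by the time coordinate of their
normals, and two of them that cross the same short piece have close normals.

Bending maps exist because two fine divisions of the same set of leaves can be compared on their
common refinement. Both respect the order, so the nonempty cells form a monotone staircase and the
refined product can be regrouped by rows or by columns (`oprod_oprod_comm`). Angles add, axes within
a cell are close, and the two products differ by a multiple of the mesh (`norm_bendProd_sub_le`).
Zero area enters by providing a base point off the lamination.

For the geometry, let `l` cross the leaves at angles less than `ε`. Disjointness makes the slopes of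
the leaves against `l` small and Lipschitz with small constant (`abs_slope_sub_le`), so they extend
to a direction field along `l`. A rotation about the leaf through `l.pt t` fixes both this point and
the direction there (`bent_eq_of_mem`): position and direction together do not notice the bends. For
a null vector `q`, `A = -⟨X, q⟩` is the exponential of a Busemann function at position `X`, and
`-⟨Y, q⟩ ≥ (1 - κ) A` says that the direction `Y` lies in a thin cone about the direction away from
the ideal point `q`. Hyperbolic divergence pushes `Y` into this cone at a rate of order `κ`, which
beats the drift of the slope, and inside the cone `log A` grows at rate at least `1 - 2κ`
(`cone_step`). These estimates compose and pass to limits, in both directions of time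
(`DirectionField.coneRelated`).

Invariance of cones and compactness yield one ideal point ahead and one behind, towards which the
direction field and its negative point along the whole curve (`exists_forward`, `exists_backward`).
The two Busemann functions change at speed between `1 - 2κ` and `1`, which gives the bilipschitz
bounds, since the foot on `m` is half the difference of the two (`foot_sub_mem`, `hdist_mem`). The
two ends are seen in nearly opposite directions, so the curve is close to `m` (`cdist_sq_le`).
Differentiating the foot controls the tangent vectors (`le_mink_deriv_vel`). -/

/-! ### Causal vectors and Cauchy–Schwarz inequalities in Minkowski space -/

section Minkowski

variable {n : ℕ}

theorem mink_add_left (x y z : Fin (n + 1) → ℝ) : mink (x + y) z = mink x z + mink y z := by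
  simpa using mink_comb_left x y z 1 1

theorem mink_add_right (x y z : Fin (n + 1) → ℝ) : mink x (y + z) = mink x y + mink x z := by
  simpa using mink_comb y z x 1 1

theorem mink_smul_left (a : ℝ) (x y : Fin (n + 1) → ℝ) : mink (a • x) y = a * mink x y := by
  simpa using mink_comb_left x x y a 0

theorem mink_smul_right (a : ℝ) (x y : Fin (n + 1) → ℝ) : mink x (a • y) = a * mink x y := by
  simpa using mink_comb y y x a 0

theorem mink_neg_left (x y : Fin (n + 1) → ℝ) : mink (-x) y = -mink x y := by
  simpa using mink_smul_left (-1) x y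

theorem mink_neg_right (x y : Fin (n + 1) → ℝ) : mink x (-y) = -mink x y := by
  simpa using mink_smul_right (-1) x y

theorem mink_sub_left (x y z : Fin (n + 1) → ℝ) : mink (x - y) z = mink x z - mink y z := by
  rw [sub_eq_add_neg, mink_add_left, mink_neg_left, sub_eq_add_neg]

theorem mink_sub_right (x y z : Fin (n + 1) → ℝ) : mink x (y - z) = mink x y - mink x z := by
  rw [sub_eq_add_neg, mink_add_right, mink_neg_right, sub_eq_add_neg]

theorem continuous_mink {X : Type*} [TopologicalSpace X] {f g : X → Fin (n + 1) → ℝ}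
    (hf : Continuous f) (hg : Continuous g) : Continuous (fun x => mink (f x) (g x)) := by
  have h : ∀ {k : X → Fin (n + 1) → ℝ}, Continuous k → ∀ i, Continuous (fun x => k x i) :=
    fun h i => (continuous_apply i).comp h
  have h1 : Continuous (fun x => ∑ i : Fin n, f x i.succ * g x i.succ) := 
    continuous_finsetSum _ fun i _ => (h hf i.succ).mul (h hg i.succ)
  have h2 := (h hf 0).mul (h hg 0)
  exact h1.sub h2

theorem tendsto_mink {X : Type*} {F : Filter X} {f g : X → Fin (n + 1) → ℝ}
    {a b : Fin (n + 1) → ℝ} (hf : Tendsto f F (𝓝 a)) (hg : Tendsto g F (𝓝 b)) :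
    Tendsto (fun x => mink (f x) (g x)) F (𝓝 (mink a b)) := by
  have h : ∀ {k : X → Fin (n + 1) → ℝ} {a}, Tendsto k F (𝓝 a) → ∀ i, Tendsto (fun x => k x i) F (𝓝 (a i)) :=
    fun h i => tendsto_pi_nhds.1 h i
  exact (tendsto_finsetSum _ fun i _ => (h hf i.succ).mul (h hg i.succ)).sub ((h hf 0).mul (h hg 0))

theorem abs_mink_le (x y : Fin (n + 1) → ℝ) : |mink x y| ≤ (n + 1) * (‖x‖ * ‖y‖) := by
  have h : ∀ i j, |x i * y j| ≤ ‖x‖ * ‖y‖ := fun i j => by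
    rw [abs_mul]
    exact mul_le_mul (norm_le_pi_norm x i) (norm_le_pi_norm y j) (abs_nonneg _) (norm_nonneg _)
  calc |mink x y| ≤ |∑ i : Fin n, x i.succ * y i.succ| + |x 0 * y 0| := abs_sub _ _
    _ ≤ ∑ i : Fin n, ‖x‖ * ‖y‖ + ‖x‖ * ‖y‖ :=
        add_le_add ((Finset.abs_sum_le_sum_abs _ _).trans (Finset.sum_le_sum fun i _ => h _ _))
          (h _ _)
    _ = _ := by simp; ring

theorem sq_spatial_le (x y : Fin (n + 1) → ℝ) :
    (mink x y + x 0 * y 0) ^ 2 ≤ (mink x x + x 0 ^ 2) * (mink y y + y 0 ^ 2) := by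
  have cs := Finset.sum_mul_sq_le_sq_mul_sq Finset.univ
    (fun i : Fin n => x i.succ) (fun i : Fin n => y i.succ)
  simp only [mink, ← sq, sub_add_cancel]
  exact cs

theorem spatial_nonneg (x : Fin (n + 1) → ℝ) : 0 ≤ mink x x + x 0 ^ 2 := by
  simp only [mink, ← sq, sub_add_cancel]
  positivity

theorem mink_nonpos_of_causal {p v : Fin (n + 1) → ℝ} (hp : mink p p ≤ 0) (hp0 : 0 ≤ p 0)
    (hv : mink v v ≤ 0) (hv0 : 0 ≤ v 0) : mink p v ≤ 0 := by
  have h := sq_spatial_le p v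
  have h1 : (mink p p + p 0 ^ 2) * (mink v v + v 0 ^ 2) ≤ p 0 ^ 2 * v 0 ^ 2 :=
    mul_le_mul (by linarith) (by linarith) (spatial_nonneg v) (by positivity)
  have h2 : (mink p v + p 0 * v 0) ^ 2 ≤ (p 0 * v 0) ^ 2 := by nlinarith
  have := abs_le.1 (abs_le_of_sq_le_sq h2 (by positivity))
  linarith [this.2]

theorem mink_nonneg_of_causal {p v : Fin (n + 1) → ℝ} (hp : mink p p ≤ 0) (hp0 : 0 ≤ p 0)
    (hv : mink v v ≤ 0) (hv0 : v 0 ≤ 0) : 0 ≤ mink p v := by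
  have := mink_nonpos_of_causal (v := -v) hp hp0 (by simpa [mink_neg_left, mink_neg_right] using hv)
    (by simpa using hv0)
  rw [mink_neg_right] at this
  linarith

/-- A single timelike functional controls a causal vector. This is what makes two leaf normals close
as soon as they take close values at one point. -/
theorem abs_zero_le_of_causal {p v : Fin (n + 1) → ℝ} (hp : mink p p ≤ -1) (hp0 : 0 < p 0)
    (hv : mink v v ≤ 0) : |v 0| ≤ 2 * p 0 * |mink p v| := by
  have h := sq_spatial_le p v
  have h1 : (mink p p + p 0 ^ 2) * (mink v v + v 0 ^ 2) ≤ (p 0 ^ 2 - 1) * v 0 ^ 2 :=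
    mul_le_mul (by linarith) (by linarith) (spatial_nonneg v)
      (by linarith [spatial_nonneg p])
  have h2 : v 0 ^ 2 ≤ -(2 * mink p v * p 0 * v 0) := by nlinarith [sq_nonneg (mink p v)]
  have h3 : |v 0| * |v 0| ≤ (2 * p 0 * |mink p v|) * |v 0| := by
    have h4 : -(2 * mink p v * p 0 * v 0) ≤ |2 * mink p v * p 0 * v 0| := neg_le_abs _
    rw [abs_mul, abs_mul, abs_mul, abs_of_pos hp0, abs_two] at h4
    rw [abs_mul_abs_self]
    nlinarith
  rcases (abs_nonneg (v 0)).eq_or_lt with h0 | h0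
  · rw [← h0]; positivity
  · exact le_of_mul_le_mul_right h3 h0

theorem norm_le_of_causal {v : Fin (n + 1) → ℝ} (hv : mink v v ≤ 0) : ‖v‖ ≤ |v 0| := by
  refine (pi_norm_le_iff_of_nonneg (abs_nonneg _)).2 fun i => ?_
  refine Fin.cases le_rfl (fun j => ?_) i
  refine sq_le_sq.1 ?_
  have h1 : v j.succ ^ 2 ≤ ∑ i : Fin n, v i.succ ^ 2 :=
    Finset.single_le_sum (f := fun i : Fin n => v i.succ ^ 2) (fun i _ => sq_nonneg _)
      (Finset.mem_univ j)
  simp only [mink, ← sq] at hv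
  linarith

/-- The upper sheet of the hyperboloid, as a predicate on vectors. -/
def OnSheet (x : Fin (n + 1) → ℝ) : Prop := mink x x = -1 ∧ 0 < x 0

/-- A null vector pointing to the future. -/
def FutureNull (q : Fin (n + 1) → ℝ) : Prop := mink q q = 0 ∧ 0 < q 0

theorem OnSheet.one_le {x : Fin (n + 1) → ℝ} (hx : OnSheet x) : 1 ≤ x 0 := by
  have := spatial_nonneg x
  rw [hx.1] at this
  nlinarith [hx.2]

theorem OnSheet.mink_neg {p q : Fin (n + 1) → ℝ} (hp : OnSheet p) (hq : FutureNull q) :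
    mink p q < 0 := by
  refine lt_of_le_of_ne (mink_nonpos_of_causal (by linarith [hp.1]) hp.2.le hq.1.le hq.2.le)
    fun h => ?_
  have := abs_zero_le_of_causal hp.1.le hp.2 hq.1.le
  rw [h, abs_zero, mul_zero, abs_of_pos hq.2] at this
  linarith [hq.2]

theorem OnSheet.of_mink_neg {p z : Fin (n + 1) → ℝ} (hp : OnSheet p) (hz : mink z z = -1)
    (h : mink p z < 0) : OnSheet z := by
  refine ⟨hz, ?_⟩
  by_contra h0
  have := mink_nonneg_of_causal (v := z) (by linarith [hp.1]) hp.2.le (by linarith) (not_lt.1 h0)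
  linarith

/-- Cauchy–Schwarz on the tangent space at `p`, where the form is nonnegative: the quadratic
polynomial `⟨v + t w, v + t w⟩` has nonpositive discriminant. -/
theorem OnSheet.tangent_sq_le {p v w : Fin (n + 1) → ℝ} (hp : OnSheet p) (hv : mink p v = 0)
    (hw : mink p w = 0) : mink v w ^ 2 ≤ mink v v * mink w w := by
  have h : ∀ t : ℝ, 0 ≤ mink w w * (t * t) + (2 * mink v w) * t + mink v v := fun t => by
    have h1 := (tangent_bound ⟨p, hp⟩ (v + t • w)
      (by simp [mink_add_right, mink_smul_right, hv, hw])).1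
    simp only [mink_add_right, mink_smul_right, mink_add_left, mink_smul_left] at h1
    rw [mink_comm w v] at h1
    linarith
  have := discrim_le_zero h
  rw [discrim] at this
  linarith

theorem OnSheet.tangent_nonneg {p v : Fin (n + 1) → ℝ} (hp : OnSheet p) (hv : mink p v = 0) :
    0 ≤ mink v v := (tangent_bound ⟨p, hp⟩ v hv).1

/-- Cauchy–Schwarz for `v` and the tangential part `q + ⟨p, q⟩ p` of `q` at `p`. -/
theorem OnSheet.mink_sq_le {p v q : Fin (n + 1) → ℝ} (hp : OnSheet p) (hv : mink p v = 0) :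
    mink v q ^ 2 ≤ mink v v * (mink q q + mink p q ^ 2) := by
  have h := hp.tangent_sq_le (w := q + mink p q • p) hv
    (by rw [mink_add_right, mink_smul_right, hp.1]; ring)
  simp only [mink_add_right, mink_smul_right, mink_add_left, mink_smul_left, hp.1,
    mink_comm v p, hv, mink_comm q p] at h
  nlinarith

theorem OnSheet.abs_mink_le {p v q : Fin (n + 1) → ℝ} (hp : OnSheet p) (hv : mink p v = 0)
    (hv1 : mink v v = 1) (hq : FutureNull q) : |mink v q| ≤ -mink p q := by
  have h := hp.mink_sq_le (q := q) hv
  rw [hv1, hq.1, zero_add, one_mul] at h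
  have := sq_le_sq.1 h
  rwa [abs_of_neg (hp.mink_neg hq)] at this

/-- The reversed Cauchy–Schwarz inequality. -/
theorem OnSheet.mink_le_neg_one {p q : Fin (n + 1) → ℝ} (hp : OnSheet p) (hq : OnSheet q) :
    mink p q ≤ -1 := by
  have h := hp.tangent_nonneg (v := q + mink p q • p)
    (by rw [mink_add_right, mink_smul_right, hp.1]; ring)
  simp only [mink_add_right, mink_smul_right, mink_add_left, mink_smul_left, hp.1, hq.1,
    mink_comm q p] at h
  have h1 := mink_nonpos_of_causal (p := p) (v := q) (by linarith [hp.1]) hp.2.le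
    (by linarith [hq.1]) hq.2.le
  nlinarith

/-- The triangle inequality of hyperbolic space. -/
theorem OnSheet.neg_mink_le_cosh_add {x y z : Fin (n + 1) → ℝ} (hx : OnSheet x) (hy : OnSheet y)
    (hz : OnSheet z) {a b : ℝ} (ha : 0 ≤ a) (hb : 0 ≤ b) (hxy : -mink x y ≤ Real.cosh a)
    (hyz : -mink y z ≤ Real.cosh b) : -mink x z ≤ Real.cosh (a + b) := by
  have hv : mink y (x + mink y x • y) = 0 := by
    rw [mink_add_right, mink_smul_right, hy.1]; ring
  have h := hy.mink_sq_le (q := z) hv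
  simp only [mink_add_right, mink_smul_right, mink_add_left, mink_smul_left, hx.1, hy.1, hz.1,
    mink_comm y x] at h
  have h1 := hx.mink_le_neg_one hy
  have h2 := hy.mink_le_neg_one hz
  have sa := Real.sinh_nonneg_iff.2 ha
  have sb := Real.sinh_nonneg_iff.2 hb
  have ca := Real.cosh_sq a
  have cb := Real.cosh_sq b
  have k1 : mink x y ^ 2 - 1 ≤ Real.sinh a ^ 2 := by nlinarith
  have k2 : mink y z ^ 2 - 1 ≤ Real.sinh b ^ 2 := by nlinarith
  have k3 : (mink x y ^ 2 - 1) * (mink y z ^ 2 - 1) ≤ Real.sinh a ^ 2 * Real.sinh b ^ 2 :=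
    mul_le_mul k1 k2 (by nlinarith) (sq_nonneg _)
  have k4 : (mink x z + mink x y * mink y z) ^ 2 ≤ (Real.sinh a * Real.sinh b) ^ 2 := by
    rw [mul_pow]
    refine le_trans ?_ k3
    refine h.trans (le_of_eq ?_)
    ring
  have k5 := (abs_le.1 (abs_le_of_sq_le_sq k4 (mul_nonneg sa sb))).1
  have k6 : mink x y * mink y z ≤ Real.cosh a * Real.cosh b := by
    have := mul_le_mul hxy hyz (by linarith) (Real.cosh_pos a).le
    linarith
  rw [Real.cosh_add]
  linarith

/-- Null functionals grow at most exponentially with the distance. -/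
theorem OnSheet.neg_mink_le_exp_mul {x y q : Fin (n + 1) → ℝ} (hx : OnSheet x) (hy : OnSheet y)
    (hq : FutureNull q) {a : ℝ} (ha : 0 ≤ a) (h : -mink x y ≤ Real.cosh a) :
    -mink y q ≤ Real.exp a * -mink x q := by
  have hv : mink x (y + mink x y • x) = 0 := by
    rw [mink_add_right, mink_smul_right, hx.1]; ring
  have h1 := hx.mink_sq_le (q := q) hv
  simp only [mink_add_right, mink_smul_right, mink_add_left, mink_smul_left, hx.1, hy.1, hq.1,
    mink_comm y x] at h1
  have h2 := hx.mink_le_neg_one hy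
  have h3 := hx.mink_neg hq
  have sa := Real.sinh_nonneg_iff.2 ha
  have k1 : mink x y ^ 2 - 1 ≤ Real.sinh a ^ 2 := by nlinarith [Real.cosh_sq a]
  have k2 : (mink y q + mink x y * mink x q) ^ 2 ≤ (Real.sinh a * -mink x q) ^ 2 := by
    nlinarith [sq_nonneg (mink x q)]
  have k3 := (abs_le.1 (abs_le_of_sq_le_sq k2 (mul_nonneg sa (by linarith)))).1
  rw [← Real.cosh_add_sinh]
  nlinarith

end Minkowski

/-! ### Isometries and rotations about leaves -/

/-- A linear operator that preserves the Minkowski form and the upper sheet. -/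
def IsHypIsometry (P : (Fin 4 → ℝ) → (Fin 4 → ℝ)) : Prop :=
  (∀ v w, mink (P v) (P w) = mink v w) ∧ ∀ x, OnSheet x → OnSheet (P x)

theorem IsHypIsometry.comp {P Q : (Fin 4 → ℝ) → (Fin 4 → ℝ)} (hP : IsHypIsometry P)
    (hQ : IsHypIsometry Q) : IsHypIsometry fun x => P (Q x) :=
  ⟨fun v w => by rw [hP.1, hQ.1], fun x hx => hP.2 _ (hQ.2 _ hx)⟩

theorem mink_planeIncl (x y : Fin 3 → ℝ) : mink (planeIncl x) (planeIncl y) = mink x y := by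
  simp [mink, planeIncl, Fin.sum_univ_succ]

theorem mink_planeIncl_planeNormal (x : Fin 3 → ℝ) : mink (planeIncl x) planeNormal = 0 := by
  simp [mink, planeIncl, planeNormal, Fin.sum_univ_succ]

theorem mink_planeNormal_self : mink planeNormal planeNormal = 1 := by
  simp [mink, planeNormal, Fin.sum_univ_succ]

theorem planeIncl_add (x y : Fin 3 → ℝ) : planeIncl (x + y) = planeIncl x + planeIncl y := by
  ext i; fin_cases i <;> simp [planeIncl]

theorem planeIncl_sub (x y : Fin 3 → ℝ) : planeIncl (x - y) = planeIncl x - planeIncl y := by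
  ext i; fin_cases i <;> simp [planeIncl]

theorem planeIncl_smul (a : ℝ) (x : Fin 3 → ℝ) : planeIncl (a • x) = a • planeIncl x := by
  ext i; fin_cases i <;> simp [planeIncl]

theorem norm_planeIncl_le (x : Fin 3 → ℝ) : ‖planeIncl x‖ ≤ ‖x‖ := by
  refine (pi_norm_le_iff_of_nonneg (norm_nonneg _)).2 fun i => ?_
  fin_cases i
  · exact norm_le_pi_norm x 0
  · exact norm_le_pi_norm x 1
  · exact norm_le_pi_norm x 2
  · simp [planeIncl]

theorem norm_planeNormal_le : ‖planeNormal‖ ≤ 1 := by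
  refine (pi_norm_le_iff_of_nonneg zero_le_one).2 fun i => ?_
  fin_cases i <;> simp [planeNormal]

theorem onSheet_planeIncl {x : Fin 3 → ℝ} (hx : OnSheet x) : OnSheet (planeIncl x) :=
  ⟨by rw [mink_planeIncl]; exact hx.1, hx.2⟩

section BendRotation

variable (e : OrientedGeodesic) (θ φ : ℝ) (x y : Fin 4 → ℝ)

theorem mink_bendRotation_planeIncl : mink (bendRotation e θ x) (planeIncl e.1) =
    mink x (planeIncl e.1) * Real.cos θ - mink x planeNormal * Real.sin θ := by
  simp only [bendRotation, mink_add_left, mink_smul_left, mink_planeIncl, e.2,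
    mink_comm planeNormal, mink_planeIncl_planeNormal]
  ring

theorem mink_bendRotation_planeNormal : mink (bendRotation e θ x) planeNormal =
    mink x (planeIncl e.1) * Real.sin θ + mink x planeNormal * Real.cos θ := by
  simp only [bendRotation, mink_add_left, mink_smul_left, mink_planeNormal_self,
    mink_planeIncl_planeNormal]
  ring

theorem mink_bendRotation : mink (bendRotation e θ x) (bendRotation e θ y) = mink x y := by
  conv_lhs => rw [bendRotation.eq_def e θ y]
  rw [mink_add_right, mink_add_right, mink_smul_right, mink_smul_right,
    mink_bendRotation_planeIncl, mink_bendRotation_planeNormal, mink_comm _ y]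
  conv_lhs => rw [bendRotation]
  rw [mink_add_right, mink_add_right, mink_smul_right, mink_smul_right, mink_comm y x]
  linear_combination (mink y (planeIncl e.1) * mink x (planeIncl e.1) +
    mink y planeNormal * mink x planeNormal) * Real.sin_sq_add_cos_sq θ

theorem bendRotation_add : bendRotation e (θ + φ) x = bendRotation e θ (bendRotation e φ x) := by
  conv_rhs => rw [bendRotation.eq_def e θ]
  rw [mink_bendRotation_planeIncl, mink_bendRotation_planeNormal]
  ext i
  simp only [bendRotation, Pi.add_apply, Pi.smul_apply, smul_eq_mul, Real.cos_add, Real.sin_add]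
  ring

theorem bendRotation_zero : bendRotation e 0 x = x := by
  simp [bendRotation]

/-- The sine terms cancel in `⟨x, R x⟩ = -1 + (a² + b²)(cos θ - 1)`, where `a`, `b` are the
components of `x` in the rotated plane. This is negative, so `x` and `R x` lie on the same sheet. -/
theorem isHypIsometry_bendRotation : IsHypIsometry (bendRotation e θ) := by
  refine ⟨mink_bendRotation e θ, fun x hx => ?_⟩
  refine hx.of_mink_neg (by rw [mink_bendRotation, hx.1]) ?_
  rw [bendRotation, mink_add_right, mink_add_right, mink_smul_right, mink_smul_right, hx.1]
  nlinarith [Real.cos_le_one θ, sq_nonneg (mink x (planeIncl e.1)), sq_nonneg (mink x planeNormal)]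

theorem bendRotation_planeIncl_of_mem (v : Fin 3 → ℝ) (h : mink v e.1 = 0) :
    bendRotation e θ (planeIncl v) = planeIncl v := by
  simp [bendRotation, mink_planeIncl, h, mink_planeIncl_planeNormal]

/-- `bendRotation` as a continuous linear map. -/
noncomputable def rot : (Fin 4 → ℝ) →L[ℝ] (Fin 4 → ℝ) :=
  LinearMap.toContinuousLinearMap
    { toFun := bendRotation e θ
      map_add' := fun x y => by
        simp only [bendRotation, mink_add_left]
        module
      map_smul' := fun a x => by
        simp only [bendRotation, mink_smul_left, RingHom.id_apply]
        module }

@[simp]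
theorem rot_apply : rot e θ x = bendRotation e θ x := rfl

theorem rot_add : rot e (θ + φ) = rot e θ * rot e φ :=
  ContinuousLinearMap.ext fun x => bendRotation_add e θ φ x

theorem rot_zero : rot e 0 = 1 :=
  ContinuousLinearMap.ext fun x => bendRotation_zero e x

theorem abs_cos_sub_one_le : |Real.cos θ - 1| ≤ |θ| := by
  have := Real.abs_cos_sub_cos_le θ 0
  simpa using this

variable {e θ}

theorem norm_rot_sub_one_le {M : ℝ} (hM : ‖e.1‖ ≤ M) : ‖rot e θ - 1‖ ≤ 8 * (M + 1) ^ 2 * |θ| := by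
  have hM0 : 0 ≤ M := (norm_nonneg _).trans hM
  refine ContinuousLinearMap.opNorm_le_bound _ (by positivity) fun x => ?_
  have hE := (norm_planeIncl_le e.1).trans hM
  have h1 := abs_mink_le x (planeIncl e.1)
  have h2 := abs_mink_le x planeNormal
  have hc := abs_cos_sub_one_le θ
  have hs := Real.abs_sin_le_abs (x := θ)
  have hN := norm_planeNormal_le
  have hx := norm_nonneg x
  have ht := abs_nonneg θ
  have h1' : |mink x (planeIncl e.1)| ≤ 4 * ‖x‖ * M := by
    refine h1.trans ?_
    have := mul_le_mul_of_nonneg_left hE hx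
    norm_num; linarith
  have h2' : |mink x planeNormal| ≤ 4 * ‖x‖ := by
    refine h2.trans ?_
    have := mul_le_mul_of_nonneg_left hN hx
    norm_num; linarith
  have k : ∀ {a b c d : ℝ}, |c| ≤ |θ| → |d| ≤ |θ| → |a| ≤ 4 * ‖x‖ * M → |b| ≤ 4 * ‖x‖ →
      |a * c + b * d| ≤ 4 * ‖x‖ * (M + 1) * |θ| := by
    intro a b c d hc hd ha hb
    refine (abs_add_le _ _).trans ?_
    rw [abs_mul, abs_mul]
    have := mul_le_mul ha hc (abs_nonneg _) (by positivity)
    have := mul_le_mul hb hd (abs_nonneg _) (by positivity)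
    linarith
  have e1 : (rot e θ - 1) x = (mink x (planeIncl e.1) * (Real.cos θ - 1)
      + mink x planeNormal * (-Real.sin θ)) • planeIncl e.1
      + (mink x (planeIncl e.1) * Real.sin θ + mink x planeNormal * (Real.cos θ - 1)) •
      planeNormal := by
    simp only [sub_apply, rot_apply, one_apply_eq_self,
      bendRotation]
    module
  rw [e1]
  refine (norm_add_le _ _).trans ?_
  rw [norm_smul, norm_smul, Real.norm_eq_abs, Real.norm_eq_abs]
  have c1 := mul_le_mul (k hc ((abs_neg (Real.sin θ)).trans_le hs) h1' h2') hE (norm_nonneg _) (by positivity)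
  have c2 := mul_le_mul (k hs hc h1' h2') hN (norm_nonneg _) (by positivity)
  have : 0 ≤ ‖x‖ * |θ| := by positivity
  nlinarith [mul_nonneg this hM0, mul_nonneg (mul_nonneg this hM0) hM0]

theorem norm_rot_le {M : ℝ} (hM : ‖e.1‖ ≤ M) : ‖rot e θ‖ ≤ Real.exp (8 * (M + 1) ^ 2 * |θ|) := by
  calc ‖rot e θ‖ = ‖(rot e θ - 1) + 1‖ := by rw [sub_add_cancel]
    _ ≤ ‖rot e θ - 1‖ + ‖(1 : (Fin 4 → ℝ) →L[ℝ] (Fin 4 → ℝ))‖ := norm_add_le _ _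
    _ ≤ 8 * (M + 1) ^ 2 * |θ| + 1 := add_le_add (norm_rot_sub_one_le hM) (by simp)
    _ ≤ _ := Real.add_one_le_exp _

/-- The factor `|θ|` is essential: summed over a division, the errors are bounded by the total
measure times the mesh, whatever the number of pieces. -/
theorem norm_rot_sub_rot_le {f : OrientedGeodesic} {M : ℝ} (hM : ‖e.1‖ ≤ M) (hf : ‖f.1‖ ≤ M) :
    ‖rot e θ - rot f θ‖ ≤ 8 * (M + 1) ^ 2 * |θ| * ‖e.1 - f.1‖ := by
  have hM0 : 0 ≤ M := (norm_nonneg _).trans hM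
  refine ContinuousLinearMap.opNorm_le_bound _ (by positivity) fun x => ?_
  obtain ⟨D, hD⟩ : ∃ D, D = ‖e.1 - f.1‖ := ⟨_, rfl⟩
  have hD0 : 0 ≤ D := hD ▸ norm_nonneg _
  have hE := (norm_planeIncl_le e.1).trans hM
  have hF := (norm_planeIncl_le f.1).trans hf
  have hEF : ‖planeIncl e.1 - planeIncl f.1‖ ≤ D := by
    rw [← planeIncl_sub, hD]; exact norm_planeIncl_le _
  have hc := abs_cos_sub_one_le θ
  have hs := Real.abs_sin_le_abs (x := θ)
  have hN := norm_planeNormal_le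
  have hx := norm_nonneg x
  have ht := abs_nonneg θ
  have b1 : ∀ {v : Fin 4 → ℝ} {r : ℝ}, ‖v‖ ≤ r → |mink x v| ≤ 4 * ‖x‖ * r := by
    intro v r hv
    refine (abs_mink_le x v).trans ?_
    have := mul_le_mul_of_nonneg_left hv hx
    norm_num; linarith
  have h1 := b1 hEF
  have h2 := b1 hF
  have h3 := b1 hN
  have e1 : (rot e θ - rot f θ) x =
      (mink x (planeIncl e.1 - planeIncl f.1) * (Real.cos θ - 1)) • planeIncl e.1
      + (mink x (planeIncl f.1) * (Real.cos θ - 1) - mink x planeNormal * Real.sin θ) •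
        (planeIncl e.1 - planeIncl f.1)
      + (mink x (planeIncl e.1 - planeIncl f.1) * Real.sin θ) • planeNormal := by
    simp only [sub_apply, rot_apply, bendRotation, mink_sub_right]
    module
  rw [e1, ← hD]
  refine (norm_add_le _ _).trans ((add_le_add_left (norm_add_le _ _) _).trans ?_)
  rw [norm_smul, norm_smul, norm_smul, Real.norm_eq_abs, Real.norm_eq_abs, Real.norm_eq_abs]
  have c1 : |mink x (planeIncl e.1 - planeIncl f.1) * (Real.cos θ - 1)| ≤ 4 * ‖x‖ * D * |θ| := by
    rw [abs_mul]; exact mul_le_mul h1 hc (abs_nonneg _) (by positivity)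
  have c3 : |mink x (planeIncl e.1 - planeIncl f.1) * Real.sin θ| ≤ 4 * ‖x‖ * D * |θ| := by
    rw [abs_mul]; exact mul_le_mul h1 hs (abs_nonneg _) (by positivity)
  have c2 : |mink x (planeIncl f.1) * (Real.cos θ - 1) - mink x planeNormal * Real.sin θ|
      ≤ 4 * ‖x‖ * (M + 1) * |θ| := by
    refine (abs_sub _ _).trans ?_
    rw [abs_mul, abs_mul]
    have := mul_le_mul h2 hc (abs_nonneg _) (by positivity)
    have := mul_le_mul h3 hs (abs_nonneg _) (by positivity)
    linarith
  have d1 := mul_le_mul c1 hE (norm_nonneg _) (by positivity)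
  have d2 := mul_le_mul c2 hEF (norm_nonneg _) (by positivity)
  have d3 := mul_le_mul c3 hN (norm_nonneg _) (by positivity)
  have : 0 ≤ ‖x‖ * |θ| * D := by positivity
  nlinarith [mul_nonneg this hM0, mul_nonneg (mul_nonneg this hM0) hM0]

end BendRotation

/-! ### Ordered products of noncommuting factors -/

section OrderedProduct

variable {A : Type*}

/-- The ordered product `f 0 * f 1 * ⋯ * f (N - 1)`. -/
def oprod [Monoid A] (f : ℕ → A) (N : ℕ) : A := ((List.range N).map f).prod

@[simp]
theorem oprod_zero [Monoid A] (f : ℕ → A) : oprod f 0 = 1 := rfl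

theorem oprod_succ [Monoid A] (f : ℕ → A) (N : ℕ) : oprod f (N + 1) = oprod f N * f N :=
  List.prod_range_succ f N

theorem oprod_congr [Monoid A] {f g : ℕ → A} {N : ℕ} (h : ∀ k < N, f k = g k) :
    oprod f N = oprod g N := by
  unfold oprod
  congr 1
  exact List.map_congr_left fun k hk => h k (List.mem_range.1 hk)

theorem oprod_eq_one [Monoid A] {f : ℕ → A} {N : ℕ} (h : ∀ k < N, f k = 1) : oprod f N = 1 := by
  rw [oprod_congr h]
  induction N with
  | zero => rfl
  | succ N ih => rw [oprod_succ, ih fun k hk => h k (by omega), mul_one]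

theorem oprod_add [Monoid A] (f : ℕ → A) (N K : ℕ) :
    oprod f (N + K) = oprod f N * oprod (fun k => f (N + k)) K := by
  induction K with
  | zero => simp
  | succ K ih => rw [← add_assoc, oprod_succ, ih, oprod_succ, mul_assoc]

theorem commute_oprod [Monoid A] {f : ℕ → A} {N : ℕ} {a : A} (h : ∀ k < N, Commute a (f k)) :
    Commute a (oprod f N) := by
  induction N with
  | zero => simp
  | succ N ih =>
    rw [oprod_succ]
    exact (ih fun k hk => h k (by omega)).mul_right (h N (by omega))

theorem oprod_mul [Monoid A] {f g : ℕ → A} {N : ℕ}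
    (h : ∀ i j, i < j → j < N → Commute (f j) (g i)) :
    oprod (fun k => f k * g k) N = oprod f N * oprod g N := by
  induction N with
  | zero => simp
  | succ N ih =>
    rw [oprod_succ, oprod_succ, oprod_succ, ih fun i j hij hj => h i j hij (by omega)]
    have : Commute (f N) (oprod g N) := commute_oprod fun k hk => h k N hk (by omega)
    rw [mul_assoc, ← mul_assoc (oprod g N), ← this.eq, mul_assoc, mul_assoc]

/-- Interchange of the two ordered products over a grid whose nontrivial entries form a monotone
staircase. -/
theorem oprod_oprod_comm [Monoid A] {c : ℕ → ℕ → A} {N J : ℕ}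
    (h : ∀ i k j l, i < k → k < N → l < j → j < J → c i j = 1 ∨ c k l = 1) :
    oprod (fun k => oprod (c k) J) N = oprod (fun j => oprod (fun k => c k j) N) J := by
  induction N with
  | zero => exact (oprod_eq_one fun _ _ => rfl).symm
  | succ N ih =>
    rw [oprod_succ, ih fun i k j l hik hk => h i k j l hik (by omega)]
    simp only [oprod_succ]
    refine (oprod_mul fun l j hlj hj => ?_).symm
    -- Either the entry `c N l` is trivial, or the staircase makes every earlier entry of column `j`
    -- trivial. In both cases the commutation is with the identity.
    by_cases h1 : c N l = 1
    · rw [h1]; exact Commute.one_right _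
    · rw [oprod_eq_one fun i hi => (h i N j l hi (by omega) hlj hj).resolve_right h1]
      exact Commute.one_left _

variable [NormedRing A] [NormOneClass A]

theorem norm_oprod_le {f : ℕ → A} {c : ℕ → ℝ} {N : ℕ} (h : ∀ k < N, ‖f k‖ ≤ Real.exp (c k)) :
    ‖oprod f N‖ ≤ Real.exp (∑ k ∈ Finset.range N, c k) := by
  induction N with
  | zero => simp
  | succ N ih =>
    rw [oprod_succ, Finset.sum_range_succ, Real.exp_add]
    exact (norm_mul_le _ _).trans (mul_le_mul (ih fun k hk => h k (by omega)) (h N (by omega))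
      (norm_nonneg _) (Real.exp_pos _).le)

/-- Telescoping: the factors are exchanged one at a time, between partial products of bounded norm.
-/
theorem norm_oprod_sub_oprod_le {f g : ℕ → A} {c d : ℕ → ℝ} {N : ℕ}
    (hf : ∀ k < N, ‖f k‖ ≤ Real.exp (c k)) (hg : ∀ k < N, ‖g k‖ ≤ Real.exp (c k))
    (hc : ∀ k < N, 0 ≤ c k) (hd : ∀ k < N, ‖f k - g k‖ ≤ d k) :
    ‖oprod f N - oprod g N‖ ≤
      Real.exp (∑ k ∈ Finset.range N, c k) * ∑ k ∈ Finset.range N, d k := by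
  induction N with
  | zero => simp
  | succ N ih =>
    have ih := ih (fun k hk => hf k (by omega)) (fun k hk => hg k (by omega))
      (fun k hk => hc k (by omega)) (fun k hk => hd k (by omega))
    have e : oprod f (N + 1) - oprod g (N + 1) =
        (oprod f N - oprod g N) * f N + oprod g N * (f N - g N) := by
      rw [oprod_succ, oprod_succ]; noncomm_ring
    have h1 := norm_oprod_le (N := N) fun k hk => hg k (by omega)
    have hcN := hc N (by omega)
    rw [e, Finset.sum_range_succ, Finset.sum_range_succ, Real.exp_add, mul_add]
    refine (norm_add_le _ _).trans (add_le_add ?_ ?_)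
    · refine (norm_mul_le _ _).trans ((mul_le_mul ih (hf N (by omega)) (norm_nonneg _)
        ((norm_nonneg _).trans ih)).trans (le_of_eq (by ring)))
    · refine (norm_mul_le _ _).trans ((mul_le_mul h1 (hd N (by omega)) (norm_nonneg _)
        (Real.exp_pos _).le).trans ?_)
      refine mul_le_mul_of_nonneg_right ?_ ((norm_nonneg _).trans (hd N (by omega)))
      exact le_mul_of_one_le_right (Real.exp_pos _).le (Real.one_le_exp hcN)

end OrderedProduct

/-! ### Divisions of sets of leaves and the limits of their products -/

theorem rot_sum (e : OrientedGeodesic) (f : ℕ → ℝ) (N : ℕ) :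
    rot e (∑ k ∈ Finset.range N, f k) = oprod (fun k => rot e (f k)) N := by
  induction N with
  | zero => simp [rot_zero]
  | succ N ih => rw [Finset.sum_range_succ, rot_add, ih, oprod_succ]

/-- Two products of rotations whose angles have a common monotone refinement `w`, with nearby axes
whenever the refined angle does not vanish, are close to each other. -/
theorem norm_oprod_rot_sub_le {M η : ℝ} (hη : 0 ≤ η) {N J : ℕ} {w : ℕ → ℕ → ℝ}
    {e f : ℕ → OrientedGeodesic}
    (hw : ∀ k j, 0 ≤ w k j)
    (hstair : ∀ i k j l, i < k → k < N → l < j → j < J → w i j = 0 ∨ w k l = 0)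
    (he : ∀ k < N, ∀ j < J, w k j ≠ 0 → ‖(e k).1‖ ≤ M ∧ ‖(f j).1‖ ≤ M ∧
      ‖(e k).1 - (f j).1‖ ≤ η) :
    ‖oprod (fun k => rot (e k) (∑ j ∈ Finset.range J, w k j)) N -
      oprod (fun j => rot (f j) (∑ k ∈ Finset.range N, w k j)) J‖ ≤
      Real.exp (8 * (M + 1) ^ 2 * ∑ k ∈ Finset.range N, ∑ j ∈ Finset.range J, w k j) ^ 2 *
        (8 * (M + 1) ^ 2 * (∑ k ∈ Finset.range N, ∑ j ∈ Finset.range J, w k j) * η) := by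
  obtain ⟨K, hK⟩ : ∃ K, K = 8 * (M + 1) ^ 2 := ⟨_, rfl⟩
  have hK0 : 0 ≤ K := by rw [hK]; positivity
  have hsw : oprod (fun k => oprod (fun j => rot (f j) (w k j)) J) N =
      oprod (fun j => oprod (fun k => rot (f j) (w k j)) N) J := by
    refine oprod_oprod_comm fun i k j l hik hk hlj hj => ?_
    refine (hstair i k j l hik hk hlj hj).imp ?_ ?_ <;> intro h <;> simp only [h, rot_zero]
  simp only [rot_sum]
  rw [← hsw, ← hK]
  have n1 : ∀ k < N, ∀ j < J, ‖rot (e k) (w k j)‖ ≤ Real.exp (K * w k j) := fun k hk j hj => by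
    by_cases h0 : w k j = 0
    · simp [h0, rot_zero]
    · simpa [abs_of_nonneg (hw k j), hK] using norm_rot_le (θ := w k j) (he k hk j hj h0).1
  have n2 : ∀ k < N, ∀ j < J, ‖rot (f j) (w k j)‖ ≤ Real.exp (K * w k j) := fun k hk j hj => by
    by_cases h0 : w k j = 0
    · simp [h0, rot_zero]
    · simpa [abs_of_nonneg (hw k j), hK] using norm_rot_le (θ := w k j) (he k hk j hj h0).2.1
  have n3 : ∀ k < N, ∀ j < J, ‖rot (e k) (w k j) - rot (f j) (w k j)‖ ≤ K * w k j * η :=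
    fun k hk j hj => by
    by_cases h0 : w k j = 0
    · simp [h0, rot_zero]
    · obtain ⟨a, b, c⟩ := he k hk j hj h0
      refine (norm_rot_sub_rot_le a b).trans ?_
      rw [abs_of_nonneg (hw k j), ← hK]
      exact mul_le_mul_of_nonneg_left c (mul_nonneg hK0 (hw k j))
  have hTk : ∀ k < N, ∑ j ∈ Finset.range J, K * w k j ≤
      K * ∑ k ∈ Finset.range N, ∑ j ∈ Finset.range J, w k j := fun k hk => by
    rw [← Finset.mul_sum]
    exact mul_le_mul_of_nonneg_left (Finset.single_le_sum
      (f := fun k => ∑ j ∈ Finset.range J, w k j)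
      (fun k _ => Finset.sum_nonneg fun j _ => hw k j) (Finset.mem_range.2 hk)) hK0
  refine (norm_oprod_sub_oprod_le (c := fun k => ∑ j ∈ Finset.range J, K * w k j)
    (d := fun k => Real.exp (K * ∑ k ∈ Finset.range N, ∑ j ∈ Finset.range J, w k j) *
      ∑ j ∈ Finset.range J, K * w k j * η)
    (fun k hk => norm_oprod_le (n1 k hk)) (fun k hk => norm_oprod_le (n2 k hk))
    (fun k _ => Finset.sum_nonneg fun j _ => mul_nonneg hK0 (hw k j)) fun k hk => ?_).trans
    (le_of_eq ?_)
  · refine (norm_oprod_sub_oprod_le (n1 k hk) (n2 k hk) (fun j _ => mul_nonneg hK0 (hw k j))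
      (n3 k hk)).trans ?_
    refine mul_le_mul_of_nonneg_right (Real.exp_le_exp.2 (hTk k hk)) ?_
    exact Finset.sum_nonneg fun j _ => mul_nonneg (mul_nonneg hK0 (hw k j)) hη
  · rw [← Finset.mul_sum]
    simp only [← Finset.sum_mul, ← Finset.mul_sum]
    ring

/-- A division of a set `D` of geodesics into finitely many consecutive pieces `p k` of diameter at
most `η`, in the order given by the coordinate `x₀` of the normals, with representatives `e k` of
the pieces of positive measure. -/
structure ChainPartition (μ : Measure OrientedGeodesic) (η : ℝ) (D : Set OrientedGeodesic)
    (N : ℕ) (p : ℕ → Set OrientedGeodesic) (e : ℕ → OrientedGeodesic) : Prop where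
  nullMeas : ∀ k < N, NullMeasurableSet (p k) μ
  cover : ∀ a, a ∈ D ↔ ∃ k < N, a ∈ p k
  lt : ∀ i j, i < j → j < N → ∀ a ∈ p i, ∀ b ∈ p j, a.1 0 < b.1 0
  close : ∀ k < N, ∀ a ∈ p k, ∀ b ∈ p k, ‖a.1 - b.1‖ ≤ η
  rep : ∀ k < N, e k ∈ p k ∨ μ.real (p k) = 0

/-- The product of the rotations about the representatives of a division. -/
noncomputable def bendProd (μ : Measure OrientedGeodesic) (p : ℕ → Set OrientedGeodesic)
    (e : ℕ → OrientedGeodesic) (N : ℕ) : (Fin 4 → ℝ) →L[ℝ] (Fin 4 → ℝ) :=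
  oprod (fun k => rot (e k) (μ.real (p k))) N

namespace ChainPartition

variable {μ : Measure OrientedGeodesic} {η η' : ℝ} {D E F : Set OrientedGeodesic} {N J : ℕ}
  {p q : ℕ → Set OrientedGeodesic} {e f : ℕ → OrientedGeodesic}

theorem subset (h : ChainPartition μ η D N p e) {k : ℕ} (hk : k < N) : p k ⊆ D :=
  fun a ha => (h.cover a).2 ⟨k, hk, ha⟩

theorem eq_of_mem (h : ChainPartition μ η D N p e) {i j : ℕ} (hi : i < N) (hj : j < N)
    {a : OrientedGeodesic} (hai : a ∈ p i) (haj : a ∈ p j) : i = j := by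
  rcases lt_trichotomy i j with hij | hij | hij
  · exact absurd (h.lt i j hij hj a hai a haj) (lt_irrefl _)
  · exact hij
  · exact absurd (h.lt j i hij hi a haj a hai) (lt_irrefl _)

theorem sum_measureReal_inter (h : ChainPartition μ η D N p e) {S : Set OrientedGeodesic}
    (hS : NullMeasurableSet S μ) (hSD : S ⊆ D) (hD : μ D ≠ ⊤) :
    μ.real S = ∑ k ∈ Finset.range N, μ.real (S ∩ p k) := by
  have hU : S = ⋃ k ∈ Finset.range N, S ∩ p k := by
    ext a
    simp only [Finset.mem_range, Set.mem_iUnion, Set.mem_inter_iff, exists_prop]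
    constructor
    · intro ha
      obtain ⟨k, hk, hak⟩ := (h.cover a).1 (hSD ha)
      exact ⟨k, hk, ha, hak⟩
    · rintro ⟨k, _, ha, _⟩
      exact ha
  have hfin : ∀ T ⊆ S, μ T ≠ ⊤ := fun T hT => measure_ne_top_of_subset (hT.trans hSD) hD
  have h1 : μ (⋃ k ∈ Finset.range N, S ∩ p k) = ∑ k ∈ Finset.range N, μ (S ∩ p k) := by
    refine measure_biUnion_finset₀ ?_ ?_
    · intro i hi j hj hij
      refine Disjoint.aedisjoint (Set.disjoint_left.2 fun a hai haj => hij ?_)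
      exact h.eq_of_mem (by simpa using hi) (by simpa using hj) hai.2 haj.2
    · intro k hk
      exact hS.inter (h.nullMeas k (by simpa using hk))
  rw [← hU] at h1
  simp only [Measure.real]
  rw [h1, ENNReal.toReal_sum fun k _ => hfin _ Set.inter_subset_left]

/-- Two divisions of the same set give nearly the same product. -/
theorem norm_bendProd_sub_le (hp : ChainPartition μ η D N p e) (hq : ChainPartition μ η' D J q f)
    {M : ℝ} (hM : ∀ a ∈ D, ‖a.1‖ ≤ M) (hD : μ D ≠ ⊤) (hη : 0 ≤ η) (hη' : 0 ≤ η') :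
    ‖bendProd μ p e N - bendProd μ q f J‖ ≤
      Real.exp (8 * (M + 1) ^ 2 * μ.real D) ^ 2 * (8 * (M + 1) ^ 2 * μ.real D * (η + η')) := by
  have hw1 : ∀ k < N, μ.real (p k) = ∑ j ∈ Finset.range J, μ.real (p k ∩ q j) := fun k hk =>
    hq.sum_measureReal_inter (hp.nullMeas k hk) (hp.subset hk) hD
  have hw2 : ∀ j < J, μ.real (q j) = ∑ k ∈ Finset.range N, μ.real (p k ∩ q j) := fun j hj => by
    rw [hp.sum_measureReal_inter (hq.nullMeas j hj) (hq.subset hj) hD]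
    exact Finset.sum_congr rfl fun k _ => by rw [Set.inter_comm]
  have hDm : NullMeasurableSet D μ := by
    have : D = ⋃ k ∈ Finset.range N, p k := by
      ext a; simp [hp.cover]
    rw [this]
    exact Finset.nullMeasurableSet_biUnion _ fun k hk => hp.nullMeas k (by simpa using hk)
  have hT : ∑ k ∈ Finset.range N, ∑ j ∈ Finset.range J, μ.real (p k ∩ q j) = μ.real D := by
    rw [hp.sum_measureReal_inter hDm subset_rfl hD]
    refine Finset.sum_congr rfl fun k hk => ?_
    rw [← hw1 k (by simpa using hk), Set.inter_eq_right.2 (hp.subset (by simpa using hk))]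
  have hne : ∀ {S : Set OrientedGeodesic}, μ.real S ≠ 0 → S.Nonempty := fun {S} h => by
    by_contra h0
    rw [Set.not_nonempty_iff_eq_empty] at h0
    simp [h0] at h
  -- The refinement is by the cells `p k ∩ q j`. If two cells in antidiagonal position both had
  -- nonzero measure, a leaf from each would be ordered one way by `p` and the other way by `q`. A
  -- leaf in the cell serves as intermediate point between the two representatives.
  have key := norm_oprod_rot_sub_le (M := M) (η := η + η') (by positivity) (N := N) (J := J)
    (w := fun k j => μ.real (p k ∩ q j)) (e := e) (f := f) (fun _ _ => measureReal_nonneg)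
    (fun i k j l hik hk hlj hj => by
      by_contra hcon
      push Not at hcon
      obtain ⟨a, ha, ha'⟩ := hne hcon.1
      obtain ⟨b, hb, hb'⟩ := hne hcon.2
      exact lt_asymm (hp.lt i k hik hk a ha b hb) (hq.lt l j hlj hj b hb' a ha'))
    (fun k hk j hj h0 => by
      obtain ⟨a, ha, ha'⟩ := hne h0
      have hfin : ∀ T ⊆ D, μ T ≠ ⊤ := fun T hT => measure_ne_top_of_subset hT hD
      have h1 : μ.real (p k) ≠ 0 := fun h => h0 (le_antisymm
        (h ▸ measureReal_mono Set.inter_subset_left (hfin _ (hp.subset hk))) measureReal_nonneg)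
      have h2 : μ.real (q j) ≠ 0 := fun h => h0 (le_antisymm
        (h ▸ measureReal_mono Set.inter_subset_right (hfin _ (hq.subset hj))) measureReal_nonneg)
      have he := (hp.rep k hk).resolve_right h1
      have hf := (hq.rep j hj).resolve_right h2
      refine ⟨hM _ (hp.subset hk he), hM _ (hq.subset hj hf), ?_⟩
      calc ‖(e k).1 - (f j).1‖ = ‖((e k).1 - a.1) + (a.1 - (f j).1)‖ := by congr 1; abel
        _ ≤ _ := norm_add_le _ _
        _ ≤ _ := add_le_add (hp.close k hk _ he _ ha) (hq.close j hj _ ha' _ hf))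
  rw [hT] at key
  have e1 : bendProd μ p e N =
      oprod (fun k => rot (e k) (∑ j ∈ Finset.range J, μ.real (p k ∩ q j))) N :=
    oprod_congr fun k hk => by rw [hw1 k hk]
  have e2 : bendProd μ q f J =
      oprod (fun j => rot (f j) (∑ k ∈ Finset.range N, μ.real (p k ∩ q j))) J :=
    oprod_congr fun j hj => by rw [hw2 j hj]
  rw [e1, e2]
  exact key

-- The old representatives need not lie in `E`, so new ones are chosen; a piece that misses `E` has
-- measure zero and needs none.
open Classical in
theorem exists_inter [Nonempty OrientedGeodesic] (hp : ChainPartition μ η D N p e) (hE : E ⊆ D)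
    (hEm : NullMeasurableSet E μ) :
    ∃ e', ChainPartition μ η E N (fun k => p k ∩ E) e' := by
  refine ⟨fun k => if h : (p k ∩ E).Nonempty then h.some else Classical.arbitrary _,
    fun k hk => (hp.nullMeas k hk).inter hEm, fun a => ?_,
    fun i j hij hj a ha b hb => hp.lt i j hij hj a ha.1 b hb.1,
    fun k hk a ha b hb => hp.close k hk a ha.1 b hb.1, fun k hk => ?_⟩
  · constructor
    · intro ha
      obtain ⟨k, hk, hak⟩ := (hp.cover a).1 (hE ha)
      exact ⟨k, hk, hak, ha⟩
    · rintro ⟨k, _, _, ha⟩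
      exact ha
  · by_cases h : (p k ∩ E).Nonempty
    · left
      simp only [h, dif_pos]
      exact h.some_mem
    · right
      simp [Set.not_nonempty_iff_eq_empty.1 h]

theorem append (hp : ChainPartition μ η E N p e) (hq : ChainPartition μ η F J q f)
    (hEF : ∀ a ∈ E, ∀ b ∈ F, a.1 0 < b.1 0) :
    ∃ p' e', ChainPartition μ η (E ∪ F) (N + J) p' e' ∧
      bendProd μ p' e' (N + J) = bendProd μ p e N * bendProd μ q f J := by
  refine ⟨fun k => if k < N then p k else q (k - N), fun k => if k < N then e k else f (k - N),
    ⟨fun k hk => ?_, fun a => ?_, fun i j hij hj a ha b hb => ?_, fun k hk a ha b hb => ?_,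
      fun k hk => ?_⟩, ?_⟩
  · by_cases h : k < N
    · simpa [h] using hp.nullMeas k h
    · simpa [h] using hq.nullMeas (k - N) (by omega)
  · rw [Set.mem_union, hp.cover, hq.cover]
    constructor
    · rintro (⟨k, hk, ha⟩ | ⟨k, hk, ha⟩)
      · exact ⟨k, by omega, by simpa [hk] using ha⟩
      · exact ⟨N + k, by omega, by simpa using ha⟩
    · rintro ⟨k, hk, ha⟩
      by_cases h : k < N
      · exact Or.inl ⟨k, h, by simpa [h] using ha⟩
      · exact Or.inr ⟨k - N, by omega, by simpa [h] using ha⟩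
  · by_cases h : j < N
    · have hi : i < N := by omega
      simp only [h, hi, if_true] at ha hb
      exact hp.lt i j hij h a ha b hb
    · simp only [h, if_false] at hb
      by_cases hi : i < N
      · simp only [hi, if_true] at ha
        exact hEF a (hp.subset hi ha) b (hq.subset (by omega) hb)
      · simp only [hi, if_false] at ha
        exact hq.lt (i - N) (j - N) (by omega) (by omega) a ha b hb
  · by_cases h : k < N
    · simp only [h, if_true] at ha hb
      exact hp.close k h a ha b hb
    · simp only [h, if_false] at ha hb
      exact hq.close (k - N) (by omega) a ha b hb
  · by_cases h : k < N
    · simpa [h] using hp.rep k h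
    · simpa [h] using hq.rep (k - N) (by omega)
  · unfold bendProd
    rw [oprod_add]
    congr 1
    · exact oprod_congr fun k hk => by simp [hk]
    · exact oprod_congr fun k hk => by simp

end ChainPartition

/-- `P` is the limit of the products over ever finer divisions of `D`. -/
def IsBendLimit (μ : Measure OrientedGeodesic) (D : Set OrientedGeodesic)
    (P : (Fin 4 → ℝ) →L[ℝ] (Fin 4 → ℝ)) : Prop :=
  ∀ (η : ℕ → ℝ) (N : ℕ → ℕ) (p : ℕ → ℕ → Set OrientedGeodesic) (e : ℕ → ℕ → OrientedGeodesic),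
    (∀ i, 0 ≤ η i) → Tendsto η atTop (𝓝 0) →
    (∀ᶠ i in atTop, ChainPartition μ (η i) D (N i) (p i) (e i)) →
    Tendsto (fun i => bendProd μ (p i) (e i) (N i)) atTop (𝓝 P)

/-- One sequence of divisions with mesh tending to zero suffices: the comparison of two divisions
makes its products Cauchy, and forces every other such sequence to have the same limit. -/
theorem exists_isBendLimit {μ : Measure OrientedGeodesic} {D : Set OrientedGeodesic} {M : ℝ}
    (hM : ∀ a ∈ D, ‖a.1‖ ≤ M) (hD : μ D ≠ ⊤) {η : ℕ → ℝ} {N : ℕ → ℕ}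
    {p : ℕ → ℕ → Set OrientedGeodesic} {e : ℕ → ℕ → OrientedGeodesic} (hη : ∀ i, 0 ≤ η i)
    (hη0 : Tendsto η atTop (𝓝 0))
    (h : ∀ᶠ i in atTop, ChainPartition μ (η i) D (N i) (p i) (e i)) :
    ∃ P, IsBendLimit μ D P := by
  obtain ⟨C, hC⟩ : ∃ C, C = Real.exp (8 * (M + 1) ^ 2 * μ.real D) ^ 2 *
    (8 * (M + 1) ^ 2 * μ.real D) := ⟨_, rfl⟩
  have hC0 : 0 ≤ C := by rw [hC]; positivity
  have hcomp : ∀ {η η' : ℝ} {N J : ℕ} {p q e f}, 0 ≤ η → 0 ≤ η' → ChainPartition μ η D N p e →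
      ChainPartition μ η' D J q f → dist (bendProd μ p e N) (bendProd μ q f J) ≤ C * (η + η') := by
    intro η η' N J p q e f h1 h2 hp hq
    rw [dist_eq_norm, hC, mul_assoc]
    exact hp.norm_bendProd_sub_le hq hM hD h1 h2
  have hcauchy : CauchySeq fun i => bendProd μ (p i) (e i) (N i) := by
    rw [Metric.cauchySeq_iff]
    intro ε hε
    have h1 : ∀ᶠ i in atTop, C * (η i + η i) < ε := by
      have : Tendsto (fun i => C * (η i + η i)) atTop (𝓝 (C * (0 + 0))) :=
        (hη0.add hη0).const_mul C
      rw [add_zero, mul_zero] at this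
      exact this.eventually (gt_mem_nhds hε)
    obtain ⟨n, hn⟩ := eventually_atTop.1 (h.and h1)
    refine ⟨n, fun i hi j hj => ?_⟩
    refine (hcomp (hη i) (hη j) (hn i hi).1 (hn j hj).1).trans_lt ?_
    linarith [(hn i hi).2, (hn j hj).2]
  obtain ⟨P, hP⟩ := cauchySeq_tendsto_of_complete hcauchy
  refine ⟨P, fun η' N' p' e' hη' hη0' h' => ?_⟩
  refine hP.congr_dist ?_
  have h2 : Tendsto (fun i => C * (η i + η' i)) atTop (𝓝 0) := by
    simpa using (hη0.add hη0').const_mul C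
  refine squeeze_zero' (Eventually.of_forall fun _ => dist_nonneg) ?_ h2
  filter_upwards [h, h'] with i hi hi'
  exact hcomp (hη i) (hη' i) hi hi'

/-! ### The causal order of the leaves that cross a segment -/

theorem mink_two (x y : Fin 3 → ℝ) : mink x y = x 1 * y 1 + x 2 * y 2 - x 0 * y 0 := by
  simp [mink, Fin.sum_univ_two]

/-- The Minkowski cross product of two vectors. -/
def minkCross (e f : Fin 3 → ℝ) : Fin 3 → ℝ :=
  ![-(e 1 * f 2 - e 2 * f 1), e 2 * f 0 - e 0 * f 2, e 0 * f 1 - e 1 * f 0]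

theorem mink_minkCross_left (e f : Fin 3 → ℝ) : mink (minkCross e f) e = 0 := by
  simp [mink_two, minkCross]; ring

theorem mink_minkCross_right (e f : Fin 3 → ℝ) : mink (minkCross e f) f = 0 := by
  simp [mink_two, minkCross]; ring

theorem mink_minkCross_self (e f : Fin 3 → ℝ) :
    mink (minkCross e f) (minkCross e f) = mink e f ^ 2 - mink e e * mink f f := by
  simp [mink_two, minkCross]; ring

/-- The cross product of the normals is orthogonal to both and has square `⟨e, f⟩² - 1 < 0`. It is
timelike, so a multiple of it is a point of the plane on both geodesics. -/
theorem OrientedGeodesic.exists_mem_inter {e f : OrientedGeodesic} (h : mink e.1 f.1 ^ 2 < 1) :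
    (e.carrier ∩ f.carrier).Nonempty := by
  obtain ⟨z, hz⟩ : ∃ z, z = minkCross e.1 f.1 := ⟨_, rfl⟩
  have hzz : mink z z < 0 := by
    rw [hz, mink_minkCross_self, e.2, f.2]; linarith
  have hze : mink z e.1 = 0 := hz ▸ mink_minkCross_left _ _
  have hzf : mink z f.1 = 0 := hz ▸ mink_minkCross_right _ _
  have hz0 : z 0 ≠ 0 := fun h0 => by
    have := spatial_nonneg z
    rw [h0] at this
    linarith
  obtain ⟨r, hr⟩ : ∃ r, r = Real.sqrt (-mink z z) := ⟨_, rfl⟩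
  have hrp : 0 < r := by rw [hr]; exact Real.sqrt_pos.2 (by linarith)
  have hr2 : r ^ 2 = -mink z z := by rw [hr]; exact Real.sq_sqrt (by linarith)
  have key : ∀ c : ℝ, c ^ 2 * r ^ 2 = 1 → 0 < c * z 0 → (e.carrier ∩ f.carrier).Nonempty := by
    intro c hc hc0
    refine ⟨⟨c • z, ?_, hc0⟩, ?_, ?_⟩
    · rw [mink_smul_left, mink_smul_right]
      rw [hr2] at hc
      linarith
    · change mink (c • z) e.1 = 0
      rw [mink_smul_left, hze, mul_zero]
    · change mink (c • z) f.1 = 0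
      rw [mink_smul_left, hzf, mul_zero]
  rcases hz0.lt_or_gt with h0 | h0
  · refine key (-r⁻¹) (by field_simp) ?_
    have := mul_pos (inv_pos.2 hrp) (neg_pos.2 h0)
    linarith
  · exact key r⁻¹ (by field_simp) (mul_pos (inv_pos.2 hrp) h0)

/-- A timelike vector pointing to the future, on or above the hyperboloid. -/
def InFuture (p : Fin 3 → ℝ) : Prop := mink p p ≤ -1 ∧ 0 < p 0

theorem Hyp.inFuture (x : Hyp 2) : InFuture x.1 := ⟨x.2.1.le, x.2.2⟩

theorem eq_zero_of_causal {p v : Fin 3 → ℝ} (hp : InFuture p) (hv : mink v v ≤ 0)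
    (h : mink p v = 0) : v = 0 := by
  have h1 := abs_zero_le_of_causal hp.1 hp.2 hv
  rw [h, abs_zero, mul_zero] at h1
  exact norm_le_zero_iff.1 ((norm_le_of_causal hv).trans h1)

theorem zero_neg_of_mink_pos {p v : Fin 3 → ℝ} (hp : InFuture p) (hv : mink v v ≤ 0)
    (h : 0 < mink p v) : v 0 < 0 := by
  by_contra h0
  have := mink_nonpos_of_causal (by linarith [hp.1]) hp.2.le hv (not_lt.1 h0)
  linarith

theorem mink_nonneg_of_zero_nonpos {p v : Fin 3 → ℝ} (hp : InFuture p) (hv : mink v v ≤ 0)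
    (h : v 0 ≤ 0) : 0 ≤ mink p v :=
  mink_nonneg_of_causal (by linarith [hp.1]) hp.2.le hv h

theorem norm_le_of_mink_le {p v : Fin 3 → ℝ} (hp : InFuture p) (hv : mink v v ≤ 0) :
    ‖v‖ ≤ 2 * p 0 * |mink p v| :=
  (norm_le_of_causal hv).trans (abs_zero_le_of_causal hp.1 hp.2 hv)

namespace MeasuredLamination

variable (L : MeasuredLamination)

theorem one_le_mink_sq {e f : OrientedGeodesic} (he : e ∈ L.leaves) (hf : f ∈ L.leaves) :
    1 ≤ mink e.1 f.1 ^ 2 := by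
  by_contra h
  rcases L.pairwise_disjoint e he f hf (OrientedGeodesic.exists_mem_inter (not_le.1 h)) with
    rfl | rfl
  · simp [f.2] at h
  · simp [OrientedGeodesic.flip, mink_neg_right, e.2] at h

/-- Leaves that cross a segment with the same orientation are causally related. -/
theorem causal_sub {e f : OrientedGeodesic} (he : e ∈ L.leaves) (hf : f ∈ L.leaves)
    {x y : Fin 3 → ℝ} (hx : InFuture x) (hy : InFuture y) (hxn : mink x e.1 + mink x f.1 < 0)
    (hyn : 0 ≤ mink y e.1 + mink y f.1) : mink (e.1 - f.1) (e.1 - f.1) ≤ 0 := by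
  have hs := L.one_le_mink_sq he hf
  have h1 : mink (e.1 - f.1) (e.1 - f.1) = 2 - 2 * mink e.1 f.1 := by
    rw [mink_sub_left, mink_sub_right, mink_sub_right, e.2, f.2, mink_comm f.1]; ring
  have h2 : mink (e.1 + f.1) (e.1 + f.1) = 2 + 2 * mink e.1 f.1 := by
    rw [mink_add_left, mink_add_right, mink_add_right, e.2, f.2, mink_comm f.1]; ring
  rw [h1]
  -- Otherwise `e + f` is causal. Pairing with a causal vector cannot change sign from negative to
  -- nonnegative between two future points, but `⟨·, e + f⟩` does so from `x` to `y`.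
  by_contra hcon
  have h3 : mink e.1 f.1 ≤ -1 := by nlinarith
  have hc : mink (e.1 + f.1) (e.1 + f.1) ≤ 0 := by linarith
  rw [← mink_add_right] at hxn hyn
  rcases hyn.eq_or_lt with h0 | h0
  · rw [eq_zero_of_causal hy hc h0.symm] at hxn
    simp [mink] at hxn
  · have := mink_nonneg_of_zero_nonpos hx hc (zero_neg_of_mink_pos hy hc h0).le
    linarith

/-- The leaves that separate `x` from `y`, oriented towards `y`; leaves through `y` count. -/
def between (x y : Hyp 2) : Set OrientedGeodesic :=
  {e | e ∈ L.leaves ∧ mink x.1 e.1 < 0 ∧ 0 ≤ mink y.1 e.1}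

variable {L} in
theorem between_causal {x y : Hyp 2} {e f : OrientedGeodesic} (he : e ∈ L.between x y)
    (hf : f ∈ L.between x y) : mink (e.1 - f.1) (e.1 - f.1) ≤ 0 :=
  L.causal_sub he.1 hf.1 x.inFuture y.inFuture (by linarith [he.2.1, hf.2.1])
    (by linarith [he.2.2, hf.2.2])

end MeasuredLamination

theorem norm_le_of_unit {e : Fin 3 → ℝ} (he : mink e e = 1) : ‖e‖ ≤ 1 + |e 0| := by
  rw [mink_two] at he
  have h0 := abs_nonneg (e 0)
  have hsq := sq_abs (e 0)
  refine (pi_norm_le_iff_of_nonneg (by positivity)).2 fun i => ?_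
  rw [Real.norm_eq_abs]
  fin_cases i
  · simp
  · exact abs_le_of_sq_le_sq (by simp; nlinarith [sq_nonneg (e 2)]) (by positivity)
  · exact abs_le_of_sq_le_sq (by simp; nlinarith [sq_nonneg (e 1)]) (by positivity)

theorem abs_zero_le_of_orthogonal {p e : Fin 3 → ℝ} (hp : InFuture p) (he : mink e e = 1)
    (h : mink p e = 0) : |e 0| ≤ p 0 := by
  have h1 := sq_spatial_le p e
  rw [h, he, zero_add] at h1
  have h2 : (mink p p + p 0 ^ 2) * (1 + e 0 ^ 2) ≤ (p 0 ^ 2 - 1) * (1 + e 0 ^ 2) :=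
    mul_le_mul_of_nonneg_right (by linarith [hp.1]) (by positivity)
  exact abs_le_of_sq_le_sq (by nlinarith) hp.2.le

theorem inFuture_combo (x y : Hyp 2) {t : ℝ} (h0 : 0 ≤ t) (h1 : t ≤ 1) :
    InFuture ((1 - t) • x.1 + t • y.1) := by
  have hxy := OnSheet.mink_le_neg_one (p := x.1) (q := y.1) x.2 y.2
  refine ⟨?_, ?_⟩
  · rw [mink_comb, mink_comb_left, mink_comb_left, x.2.1, y.2.1, mink_comm y.1]
    nlinarith [mul_nonneg h0 (sub_nonneg.2 h1)]
  · have hx := x.2.2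
    have hy := y.2.2
    simp only [Pi.add_apply, Pi.smul_apply, smul_eq_mul]
    rcases h0.eq_or_lt with h | h
    · rw [← h]; simpa using hx
    · have := mul_pos h hy
      have := mul_nonneg (sub_nonneg.2 h1) hx.le
      linarith

theorem combo_zero_le (x y : Hyp 2) {t : ℝ} (h0 : 0 ≤ t) (h1 : t ≤ 1) :
    ((1 - t) • x.1 + t • y.1) 0 ≤ x.1 0 + y.1 0 := by
  have hx := x.2.2
  have hy := y.2.2
  simp only [Pi.add_apply, Pi.smul_apply, smul_eq_mul]
  nlinarith

/-- The leaf is orthogonal to a point of the chord from `x` to `y`, which bounds its time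
coordinate. So the leaves separating two points lie in a compact set, where a locally finite measure
is finite. -/
theorem norm_le_of_between {L : MeasuredLamination} {x y : Hyp 2} {e : OrientedGeodesic}
    (he : e ∈ L.between x y) : ‖e.1‖ ≤ 1 + (x.1 0 + y.1 0) := by
  obtain ⟨a, ha⟩ : ∃ a, a = mink x.1 e.1 := ⟨_, rfl⟩
  obtain ⟨b, hb⟩ : ∃ b, b = mink y.1 e.1 := ⟨_, rfl⟩
  have ha0 : a < 0 := ha ▸ he.2.1
  have hb0 : 0 ≤ b := hb ▸ he.2.2
  have hd : 0 < b - a := by linarith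
  have h0 : 0 ≤ -a / (b - a) := div_nonneg (by linarith) hd.le
  have h1 : -a / (b - a) ≤ 1 := (div_le_one hd).2 (by linarith)
  have h2 := abs_zero_le_of_orthogonal (inFuture_combo x y h0 h1) e.2 (by
    rw [mink_comb_left, ← ha, ← hb]; field_simp; ring)
  linarith [norm_le_of_unit e.2, combo_zero_le x y h0 h1]

instance : Nonempty OrientedGeodesic := ⟨⟨![0, 1, 0], by simp [mink_two]⟩⟩

theorem measurableSet_mink_lt (p : Fin 3 → ℝ) :
    MeasurableSet {e : OrientedGeodesic | mink p e.1 < 0} :=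
  (isOpen_lt (continuous_mink continuous_const continuous_subtype_val)
    continuous_const).measurableSet

theorem measurableSet_le_mink (p : Fin 3 → ℝ) :
    MeasurableSet {e : OrientedGeodesic | 0 ≤ mink p e.1} :=
  (isClosed_le continuous_const
    (continuous_mink continuous_const continuous_subtype_val)).measurableSet

theorem isCompact_norm_le (M : ℝ) : IsCompact {e : OrientedGeodesic | ‖e.1‖ ≤ M} := by
  have hcl : IsClosed {e : Fin 3 → ℝ | mink e e = 1} :=
    isClosed_eq (continuous_mink continuous_id continuous_id) continuous_const
  have h := hcl.isClosedEmbedding_subtypeVal.isCompact_preimage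
    (isCompact_closedBall (0 : Fin 3 → ℝ) M)
  have he : {e : OrientedGeodesic | ‖e.1‖ ≤ M} =
      Subtype.val ⁻¹' Metric.closedBall (0 : Fin 3 → ℝ) M := by
    ext e
    simp
  rw [he]
  exact h

/-! ### The divisions of a segment as divisions of its set of leaves -/

namespace MeasuredLamination

variable (L : MeasuredLamination)

theorem nullMeasurableSet_leaves : NullMeasurableSet L.leaves L.measure :=
  (NullMeasurableSet.of_null L.measure_compl).of_compl

theorem nullMeasurableSet_between (x y : Hyp 2) :
    NullMeasurableSet (L.between x y) L.measure :=
  L.nullMeasurableSet_leaves.inter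
    ((measurableSet_mink_lt x.1).inter (measurableSet_le_mink y.1)).nullMeasurableSet

theorem measure_between_ne_top (x y : Hyp 2) : L.measure (L.between x y) ≠ ⊤ := by
  have := L.locallyFinite
  exact measure_ne_top_of_subset (fun e he => norm_le_of_between he)
    (isCompact_norm_le (1 + (x.1 0 + y.1 0))).measure_lt_top.ne

theorem mass_eq (x y : Hyp 2) (N k : ℕ) :
    L.mass x y N k = L.measure.real (crossing x y N k ∩ L.leaves) := by
  rw [mass, Measure.real, measure_inter_conull L.measure_compl]

theorem mink_divisionPoint (x y : Hyp 2) (N k : ℕ) (e : Fin 3 → ℝ) :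
    mink (divisionPoint x y N k) e = (1 - (k : ℝ) / N) * mink x.1 e + (k : ℝ) / N * mink y.1 e := by
  rw [divisionPoint, mink_comb_left]

variable {L}

theorem crossing_subset_between {x y : Hyp 2} {N k : ℕ} (hk : k < N) {e : OrientedGeodesic}
    (he : e ∈ crossing x y N k) : mink x.1 e.1 < 0 ∧ 0 ≤ mink y.1 e.1 := by
  have hN : (0 : ℝ) < N := by exact_mod_cast (by omega : 0 < N)
  obtain ⟨h1, h2⟩ := he
  rw [mink_divisionPoint] at h1 h2
  have hk1 : ((k + 1 : ℕ) : ℝ) ≤ N := by exact_mod_cast hk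
  have a1 : ((k + 1 : ℕ) : ℝ) / N ≤ 1 := (div_le_one hN).2 hk1
  have a2 : (0 : ℝ) ≤ (k : ℝ) / N := by positivity
  have a3 : (k : ℝ) / N < ((k + 1 : ℕ) : ℝ) / N := by
    apply div_lt_div_of_pos_right _ hN
    push_cast; linarith
  have h3 : 0 < (((k + 1 : ℕ) : ℝ) / N - (k : ℝ) / N) * (mink y.1 e.1 - mink x.1 e.1) := by
    nlinarith
  have h4 : 0 < mink y.1 e.1 - mink x.1 e.1 := by
    by_contra hc
    have := mul_nonpos_of_nonneg_of_nonpos (sub_pos.2 a3).le (not_lt.1 hc)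
    linarith
  constructor
  · nlinarith
  · nlinarith

theorem exists_mem_crossing {x y : Hyp 2} {N : ℕ} (hN : 0 < N) {e : OrientedGeodesic}
    (hx : mink x.1 e.1 < 0) (hy : 0 ≤ mink y.1 e.1) : ∃ k < N, e ∈ crossing x y N k := by
  classical
  have hN' : (0 : ℝ) < N := by exact_mod_cast hN
  have hex : ∃ k : ℕ, 0 ≤ mink (divisionPoint x y N k) e.1 :=
    ⟨N, by rw [mink_divisionPoint, div_self hN'.ne']; linarith⟩
  have h0 : Nat.find hex ≠ 0 := fun h => by
    have := Nat.find_spec hex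
    rw [h, mink_divisionPoint] at this
    norm_num at this
    linarith
  obtain ⟨k, hk⟩ := Nat.exists_eq_succ_of_ne_zero h0
  refine ⟨k, ?_, ?_, ?_⟩
  · have : Nat.find hex ≤ N :=
      Nat.find_min' hex (by rw [mink_divisionPoint, div_self hN'.ne']; linarith)
    omega
  · exact not_le.1 (Nat.find_min hex (by omega))
  · have := Nat.find_spec hex
    rwa [hk] at this

theorem inFuture_divisionPoint (x y : Hyp 2) {N k : ℕ} (hN : 0 < N) (hk : k ≤ N) :
    InFuture (divisionPoint x y N k) := by
  have hN' : (0 : ℝ) < N := by exact_mod_cast hN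
  exact inFuture_combo x y (by positivity) ((div_le_one hN').2 (by exact_mod_cast hk))

/-- Both the order and the mesh come from causality of `a - b`: its pairing with a division point
determines the sign of its time coordinate and bounds its norm. -/
theorem chainPartition_crossing (x y : Hyp 2) {N : ℕ} (hN : 0 < N) {e : ℕ → OrientedGeodesic}
    (he : ∀ k < N, (e k ∈ L.leaves ∧ e k ∈ crossing x y N k) ∨ L.mass x y N k = 0) :
    ChainPartition L.measure (12 * (x.1 0 + y.1 0) * ‖y.1 - x.1‖ * (1 + (x.1 0 + y.1 0)) / N)
      (L.between x y) N (fun k => crossing x y N k ∩ L.leaves) e := by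
  have hN' : (0 : ℝ) < N := by exact_mod_cast hN
  have hb : ∀ k < N, ∀ a ∈ crossing x y N k ∩ L.leaves, a ∈ L.between x y := fun k hk a ha =>
    ⟨ha.2, crossing_subset_between hk ha.1⟩
  refine ⟨fun k _ => ?_, fun a => ?_, fun i j hij hj a ha b hb' => ?_, fun k hk a ha b hb' => ?_,
    fun k hk => ?_⟩
  · exact ((measurableSet_mink_lt _).inter (measurableSet_le_mink _)).nullMeasurableSet.inter
      L.nullMeasurableSet_leaves
  · constructor
    · rintro ⟨h1, h2, h3⟩
      obtain ⟨k, hk, hak⟩ := exists_mem_crossing hN h2 h3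
      exact ⟨k, hk, hak, h1⟩
    · rintro ⟨k, hk, ha⟩
      exact hb k hk a ha
  · have hA := hb i (by omega) a ha
    have hB := hb j hj b hb'
    have hc := between_causal hA hB
    have h1 : 0 < mink (divisionPoint x y N (i + 1)) (a.1 - b.1) := by
      have h2 := hb'.1.1
      have h3 := ha.1.2
      rw [mink_sub_right]
      have h4 : mink (divisionPoint x y N (i + 1)) b.1 ≤ mink (divisionPoint x y N j) b.1 := by
        rw [mink_divisionPoint, mink_divisionPoint]
        have : ((i + 1 : ℕ) : ℝ) / N ≤ (j : ℝ) / N :=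
          div_le_div_of_nonneg_right (by exact_mod_cast hij) hN'.le
        nlinarith [hB.2.1, hB.2.2]
      linarith
    have := zero_neg_of_mink_pos (inFuture_divisionPoint x y hN (by omega)) hc h1
    simpa using this
  · have hA := hb k hk a ha
    have hB := hb k hk b hb'
    have hc := between_causal hA hB
    have h1 := norm_le_of_mink_le (inFuture_divisionPoint x y hN hk.le) hc
    have hp0 : divisionPoint x y N k 0 ≤ x.1 0 + y.1 0 := combo_zero_le x y (by positivity)
      ((div_le_one hN').2 (by exact_mod_cast hk.le))
    have hp1 := (inFuture_divisionPoint x y hN hk.le).2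
    -- The pairing with `c` changes sign over the `k`-th part, so at its beginning it is at most its
    -- increment `⟨y - x, c⟩ / N` in absolute value. Two leaves double this bound, and the passage
    -- to the norm of the difference costs twice the time coordinate of the division point; hence
    -- the constant `12`.
    have key : ∀ c ∈ crossing x y N k ∩ L.leaves, |mink (divisionPoint x y N k) c.1| ≤
        3 * (‖y.1 - x.1‖ * (1 + (x.1 0 + y.1 0))) / N := by
      intro c hc
      have h2 := hc.1.1
      have h3 := hc.1.2
      have h4 : mink (divisionPoint x y N (k + 1)) c.1 - mink (divisionPoint x y N k) c.1 =
          mink (y.1 - x.1) c.1 / N := by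
        rw [mink_divisionPoint, mink_divisionPoint, mink_sub_left]
        push_cast
        field_simp
        ring
      have h5 := abs_mink_le (y.1 - x.1) c.1
      have h6 := norm_le_of_between (hb k hk c hc)
      have h7 : mink (y.1 - x.1) c.1 ≤ 3 * (‖y.1 - x.1‖ * (1 + (x.1 0 + y.1 0))) := by
        refine (le_abs_self _).trans (h5.trans ?_)
        have := mul_le_mul_of_nonneg_left h6 (norm_nonneg (y.1 - x.1))
        push_cast
        linarith
      rw [abs_of_neg h2]
      have h8 := div_le_div_of_nonneg_right h7 hN'.le
      linarith
    have h2 := key a ha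
    have h3 := key b hb'
    have h4 : |mink (divisionPoint x y N k) (a.1 - b.1)| ≤
        6 * (‖y.1 - x.1‖ * (1 + (x.1 0 + y.1 0))) / N := by
      rw [mink_sub_right]
      refine (abs_sub _ _).trans ((add_le_add h2 h3).trans (le_of_eq ?_))
      ring
    refine h1.trans ((mul_le_mul (mul_le_mul_of_nonneg_left hp0 zero_le_two) h4 (abs_nonneg _)
      ?_).trans (le_of_eq ?_))
    · linarith
    · ring
  · rw [← L.mass_eq]
    exact (he k hk).imp_left fun h => ⟨h.2, h.1⟩

variable (L)

theorem exists_isChoiceOfLeaves (x y : Hyp 2) : ∃ e, L.IsChoiceOfLeaves x y e := by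
  have h : ∀ N k, ∃ a : OrientedGeodesic,
      (a ∈ L.leaves ∧ a ∈ crossing x y N k) ∨ L.mass x y N k = 0 := by
    intro N k
    by_cases h : (crossing x y N k ∩ L.leaves).Nonempty
    · obtain ⟨a, ha⟩ := h
      exact ⟨a, Or.inl ⟨ha.2, ha.1⟩⟩
    · refine ⟨Classical.arbitrary _, Or.inr ?_⟩
      rw [L.mass_eq, Set.not_nonempty_iff_eq_empty.1 h]
      simp
  choose e he using h
  exact ⟨e, fun N k _ => he N k⟩

theorem finiteBending_eq (x y : Hyp 2) (e : ℕ → ℕ → OrientedGeodesic) (N : ℕ) :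
    L.finiteBending x y e N =
      bendProd L.measure (fun k => crossing x y N k ∩ L.leaves) (e N) N (planeIncl y.1) := by
  have h : ∀ (l : List ℕ) (z : Fin 4 → ℝ),
      l.foldr (fun k z => bendRotation (e N k) (L.mass x y N k) z) z =
        (l.map fun k => rot (e N k) (L.measure.real (crossing x y N k ∩ L.leaves))).prod z := by
    intro l z
    induction l with
    | nil => rfl
    | cons a l ih =>
      rw [List.foldr_cons, ih, List.map_cons, List.prod_cons, mass_eq]
      rfl
  exact h _ _

/-- A set of geodesics that has arbitrarily fine divisions. -/
def HasFinePartitions (μ : Measure OrientedGeodesic) (D : Set OrientedGeodesic) : Prop :=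
  ∀ η > 0, ∃ N p e, ChainPartition μ η D N p e

theorem tendsto_mesh (C : ℝ) : Tendsto (fun N : ℕ => C / N) atTop (𝓝 0) :=
  tendsto_const_div_atTop_nhds_zero_nat C

theorem hasFinePartitions_between (x y : Hyp 2) :
    HasFinePartitions L.measure (L.between x y) := by
  intro η hη
  obtain ⟨e, he⟩ := L.exists_isChoiceOfLeaves x y
  have h := (tendsto_mesh (12 * (x.1 0 + y.1 0) * ‖y.1 - x.1‖ * (1 + (x.1 0 + y.1 0)))).eventually
    (gt_mem_nhds hη)
  obtain ⟨N, hN, hN0⟩ := (h.and (eventually_gt_atTop 0)).exists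
  have hp := chainPartition_crossing x y hN0 (he N)
  exact ⟨N, _, _, ⟨hp.nullMeas, hp.cover, hp.lt,
    fun k hk a ha b hb => (hp.close k hk a ha b hb).trans hN.le, hp.rep⟩⟩

/-- The finite bendings converge, independently of the choice of leaves. -/
theorem tendsto_finiteBending {x y : Hyp 2} {P : (Fin 4 → ℝ) →L[ℝ] (Fin 4 → ℝ)}
    (hP : IsBendLimit L.measure (L.between x y) P) {e : ℕ → ℕ → OrientedGeodesic}
    (he : L.IsChoiceOfLeaves x y e) :
    Tendsto (fun N => L.finiteBending x y e N) atTop (𝓝 (P (planeIncl y.1))) := by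
  have h := hP (fun N : ℕ => 12 * (x.1 0 + y.1 0) * ‖y.1 - x.1‖ * (1 + (x.1 0 + y.1 0)) / N)
    (fun N => N) (fun N k => crossing x y N k ∩ L.leaves) e
    (fun N => by
      have := x.2.2
      have := y.2.2
      positivity)
    (tendsto_mesh _) (by
      -- For `N = 0` there are no pieces, so the divisions are available only eventually.
      filter_upwards [eventually_gt_atTop 0] with N hN
      exact chainPartition_crossing x y hN (he N))
  simp only [finiteBending_eq]
  exact ((ContinuousLinearMap.apply ℝ (Fin 4 → ℝ) (planeIncl y.1)).continuous.tendsto P).comp h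

end MeasuredLamination

/-! ### Bending limits are isometries and are multiplicative -/

namespace MeasuredLamination.HasFinePartitions

variable {μ : Measure OrientedGeodesic} {D E F : Set OrientedGeodesic}

theorem mono (h : HasFinePartitions μ D) (hE : E ⊆ D) (hEm : NullMeasurableSet E μ) :
    HasFinePartitions μ E := fun η hη => by
  obtain ⟨N, p, e, hp⟩ := h η hη
  obtain ⟨e', h'⟩ := hp.exists_inter hE hEm
  exact ⟨N, _, e', h'⟩

theorem exists_seq (h : HasFinePartitions μ D) :
    ∃ (η : ℕ → ℝ) (N : ℕ → ℕ) (p : ℕ → ℕ → Set OrientedGeodesic) (e : ℕ → ℕ → OrientedGeodesic),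
      (∀ i, 0 ≤ η i) ∧ Tendsto η atTop (𝓝 0) ∧ ∀ i, ChainPartition μ (η i) D (N i) (p i) (e i) := by
  choose N p e hp using fun i : ℕ => h (1 / ((i : ℝ) + 1)) (by positivity)
  exact ⟨_, N, p, e, fun i => by positivity, tendsto_one_div_add_atTop_nhds_zero_nat, hp⟩

theorem exists_isBendLimit {M : ℝ} (h : HasFinePartitions μ D) (hM : ∀ a ∈ D, ‖a.1‖ ≤ M)
    (hD : μ D ≠ ⊤) : ∃ P, IsBendLimit μ D P := by
  obtain ⟨η, N, p, e, h1, h2, h3⟩ := h.exists_seq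
  exact _root_.exists_isBendLimit hM hD h1 h2 (Eventually.of_forall h3)

end MeasuredLamination.HasFinePartitions

/-- The upper sheet survives the limit because its points satisfy the closed condition `1 ≤ x₀`. -/
theorem IsHypIsometry.of_tendsto {P : ℕ → (Fin 4 → ℝ) →L[ℝ] (Fin 4 → ℝ)}
    {Q : (Fin 4 → ℝ) →L[ℝ] (Fin 4 → ℝ)} (h : Tendsto P atTop (𝓝 Q))
    (hP : ∀ i, IsHypIsometry (P i)) : IsHypIsometry Q := by
  have h' : ∀ v, Tendsto (fun i => P i v) atTop (𝓝 (Q v)) := fun v =>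
    ((ContinuousLinearMap.apply ℝ (Fin 4 → ℝ) v).continuous.tendsto Q).comp h
  have h1 : ∀ v w, mink (Q v) (Q w) = mink v w := fun v w => by
    have := tendsto_mink (h' v) (h' w)
    simp only [(hP _).1] at this
    exact tendsto_nhds_unique this tendsto_const_nhds
  refine ⟨h1, fun x hx => ⟨by rw [h1, hx.1], ?_⟩⟩
  have h2 : Tendsto (fun i => P i x 0) atTop (𝓝 (Q x 0)) := (tendsto_pi_nhds.1 (h' x)) 0
  exact zero_lt_one.trans_le (ge_of_tendsto' h2 fun i => ((hP i).2 x hx).one_le)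

theorem isHypIsometry_oprod {P : ℕ → (Fin 4 → ℝ) →L[ℝ] (Fin 4 → ℝ)} {N : ℕ}
    (h : ∀ k < N, IsHypIsometry (P k)) : IsHypIsometry ⇑(oprod P N) := by
  induction N with
  | zero => exact ⟨fun _ _ => rfl, fun _ h => h⟩
  | succ N ih =>
    rw [oprod_succ]
    exact (ih fun k hk => h k (by omega)).comp (h N (by omega))

theorem isHypIsometry_bendProd (μ : Measure OrientedGeodesic) (p : ℕ → Set OrientedGeodesic)
    (e : ℕ → OrientedGeodesic) (N : ℕ) : IsHypIsometry (bendProd μ p e N) :=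
  isHypIsometry_oprod (P := fun k => rot (e k) (μ.real (p k)))
    fun k _ => isHypIsometry_bendRotation (e k) _

namespace IsBendLimit

open MeasuredLamination

variable {μ : Measure OrientedGeodesic} {D E F : Set OrientedGeodesic}
  {P Q R : (Fin 4 → ℝ) →L[ℝ] (Fin 4 → ℝ)}

theorem isHypIsometry (h : IsBendLimit μ D P) (hD : HasFinePartitions μ D) : IsHypIsometry P := by
  obtain ⟨η, N, p, e, h1, h2, h3⟩ := hD.exists_seq
  exact IsHypIsometry.of_tendsto (h η N p e h1 h2 (Eventually.of_forall h3))
    fun i => isHypIsometry_bendProd _ _ _ _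

/-- Divisions of `E` followed by divisions of `F` are divisions of the union, and their products
factor exactly. -/
theorem mul_eq (hP : IsBendLimit μ E P) (hQ : IsBendLimit μ F Q) (hR : IsBendLimit μ (E ∪ F) R)
    (hE : HasFinePartitions μ E) (hF : HasFinePartitions μ F)
    (hEF : ∀ a ∈ E, ∀ b ∈ F, a.1 0 < b.1 0) : R = P * Q := by
  choose N p e hp using fun i : ℕ => hE (1 / ((i : ℝ) + 1)) (by positivity)
  choose J q f hq using fun i : ℕ => hF (1 / ((i : ℝ) + 1)) (by positivity)
  choose p' e' hp' hprod using fun i => (hp i).append (hq i) hEF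
  have h0 : ∀ i : ℕ, (0 : ℝ) ≤ 1 / ((i : ℝ) + 1) := fun i => by positivity
  have hl := tendsto_one_div_add_atTop_nhds_zero_nat (𝕜 := ℝ)
  have t1 := hP _ N p e h0 hl (Eventually.of_forall hp)
  have t2 := hQ _ J q f h0 hl (Eventually.of_forall hq)
  have t3 := hR _ _ p' e' h0 hl (Eventually.of_forall hp')
  simp only [hprod] at t3
  exact tendsto_nhds_unique t3 (t1.mul t2)

end IsBendLimit

/-! ### Expansion of cones along a motion -/

/-- How far the direction `Y` at the point `X` is from being within the cone of opening `κ` about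
the direction that points away from the ideal point `q`; the value `0` means inside the cone. -/
noncomputable def coneDefect (κ : ℝ) (q X Y : Fin 4 → ℝ) : ℝ :=
  min (-mink Y q - (1 - κ) * -mink X q) 0

theorem coneDefect_nonpos (κ : ℝ) (q X Y : Fin 4 → ℝ) : coneDefect κ q X Y ≤ 0 := min_le_right _ _

/-- Travelling for the time `h` from `X` with direction `Y` to `X'` with direction `Y'` expands the
cones around the directions away from the ideal points. -/
structure ConeExpanding (κ h : ℝ) (X Y X' Y' : Fin 4 → ℝ) : Prop where
  cone : ∀ q, FutureNull q → Real.exp h * coneDefect κ q X Y ≤ coneDefect κ q X' Y'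
  growth : ∀ q, FutureNull q → Real.exp ((1 - 2 * κ) * h) * -mink X q +
    h * Real.exp h * coneDefect κ q X Y ≤ -mink X' q

/-- Cones are expanded in both directions of time, and the distance is at most `h`. -/
structure ConeRelated (κ h : ℝ) (X Y X' Y' : Fin 4 → ℝ) : Prop where
  fwd : ConeExpanding κ h X Y X' Y'
  bwd : ConeExpanding κ h X' (-Y') X (-Y)
  dist : -mink X X' ≤ Real.cosh h

/-- The error factor `h * exp h` is chosen to be stable under composition: the two contributions are
at worst `h * exp (h + k)` and `k * exp (h + k)` times the initial defect, which add up to the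
factor for `h + k`. -/
theorem ConeExpanding.trans {κ h k : ℝ} {X Y X' Y' X'' Y'' : Fin 4 → ℝ} (hκ : 0 ≤ κ) (hh : 0 ≤ h)
    (hk : 0 ≤ k) (h1 : ConeExpanding κ h X Y X' Y') (h2 : ConeExpanding κ k X' Y' X'' Y'') :
    ConeExpanding κ (h + k) X Y X'' Y'' := by
  refine ⟨fun q hq => ?_, fun q hq => ?_⟩
  · have a1 := h1.cone q hq
    have a2 := h2.cone q hq
    have := mul_le_mul_of_nonneg_left a1 (Real.exp_pos k).le
    rw [Real.exp_add]
    linarith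
  · have a1 := h1.cone q hq
    have b1 := h1.growth q hq
    have b2 := h2.growth q hq
    have m0 := coneDefect_nonpos κ q X Y
    have c1 := mul_le_mul_of_nonneg_left b1 (Real.exp_pos ((1 - 2 * κ) * k)).le
    have c2 := mul_le_mul_of_nonneg_left a1 (mul_nonneg hk (Real.exp_pos k).le)
    have c3 : Real.exp ((1 - 2 * κ) * k) ≤ Real.exp k := Real.exp_le_exp.2 (by nlinarith)
    have c4 : Real.exp k * (h * Real.exp h * coneDefect κ q X Y) ≤
        Real.exp ((1 - 2 * κ) * k) * (h * Real.exp h * coneDefect κ q X Y) :=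
      mul_le_mul_of_nonpos_right c3
        (mul_nonpos_of_nonneg_of_nonpos (mul_nonneg hh (Real.exp_pos h).le) m0)
    rw [mul_add, Real.exp_add, Real.exp_add]
    linarith

theorem ConeRelated.trans {κ h k : ℝ} {X Y X' Y' X'' Y'' : Fin 4 → ℝ} (hκ : 0 ≤ κ) (hh : 0 ≤ h)
    (hk : 0 ≤ k) (hX : OnSheet X) (hX' : OnSheet X') (hX'' : OnSheet X'')
    (h1 : ConeRelated κ h X Y X' Y') (h2 : ConeRelated κ k X' Y' X'' Y'') :
    ConeRelated κ (h + k) X Y X'' Y'' :=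
  ⟨h1.fwd.trans hκ hh hk h2.fwd, add_comm k h ▸ h2.bwd.trans hκ hk hh h1.bwd,
    hX.neg_mink_le_cosh_add hX' hX'' hh hk h1.dist h2.dist⟩

section Limits

variable {κ h : ℝ} {x y x' y' : ℕ → Fin 4 → ℝ} {X Y X' Y' : Fin 4 → ℝ}

theorem tendsto_coneDefect (hx : Tendsto x atTop (𝓝 X)) (hy : Tendsto y atTop (𝓝 Y))
    (q : Fin 4 → ℝ) :
    Tendsto (fun i => coneDefect κ q (x i) (y i)) atTop (𝓝 (coneDefect κ q X Y)) :=
  (((tendsto_mink hy tendsto_const_nhds).neg).sub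
    ((tendsto_mink hx tendsto_const_nhds).neg.const_mul _)).min tendsto_const_nhds

/-- This is why the defect appears in the inequalities: a mere implication "in the cone before, in
the cone after" is not closed under limits, since the approximants may start slightly outside the
cone. -/
theorem ConeExpanding.of_tendsto (hx : Tendsto x atTop (𝓝 X)) (hy : Tendsto y atTop (𝓝 Y))
    (hx' : Tendsto x' atTop (𝓝 X')) (hy' : Tendsto y' atTop (𝓝 Y'))
    (H : ∀ i, ConeExpanding κ h (x i) (y i) (x' i) (y' i)) : ConeExpanding κ h X Y X' Y' :=
  ⟨fun q hq => le_of_tendsto_of_tendsto' ((tendsto_coneDefect hx hy q).const_mul _)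
      (tendsto_coneDefect hx' hy' q) fun i => (H i).cone q hq,
    fun q hq => le_of_tendsto_of_tendsto'
      (((tendsto_mink hx tendsto_const_nhds).neg.const_mul _).add
        ((tendsto_coneDefect hx hy q).const_mul _))
      (tendsto_mink hx' tendsto_const_nhds).neg fun i => (H i).growth q hq⟩

theorem ConeRelated.of_tendsto (hx : Tendsto x atTop (𝓝 X)) (hy : Tendsto y atTop (𝓝 Y))
    (hx' : Tendsto x' atTop (𝓝 X')) (hy' : Tendsto y' atTop (𝓝 Y'))
    (H : ∀ i, ConeRelated κ h (x i) (y i) (x' i) (y' i)) : ConeRelated κ h X Y X' Y' :=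
  ⟨ConeExpanding.of_tendsto hx hy hx' hy' fun i => (H i).fwd,
    ConeExpanding.of_tendsto hx' hy'.neg hx hy.neg fun i => (H i).bwd,
    le_of_tendsto' (tendsto_mink hx hx').neg fun i => (H i).dist⟩

end Limits

/-- Convexity of `exp`, with `c * d` written as a convex combination of `d` and `-d`. -/
theorem exp_mul_le_cosh_add_mul_sinh {c d : ℝ} (h0 : 0 ≤ c) (h1 : c ≤ 1) :
    Real.exp (c * d) ≤ Real.cosh d + c * Real.sinh d := by
  have h := convexOn_exp.2 (Set.mem_univ d) (Set.mem_univ (-d))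
    (by linarith : 0 ≤ (1 + c) / 2) (by linarith : 0 ≤ (1 - c) / 2) (by ring)
  simp only [smul_eq_mul] at h
  have e : (1 + c) / 2 * d + (1 - c) / 2 * -d = c * d := by ring
  rw [e] at h
  rw [Real.cosh_eq, Real.sinh_eq]
  linarith

theorem sinh_le_mul_exp {d : ℝ} : Real.sinh d ≤ d * Real.exp d := by
  have h1 := Real.add_one_le_exp (-(2 * d))
  have h2 : Real.exp (-d) = Real.exp d * Real.exp (-(2 * d)) := by
    rw [← Real.exp_add]; congr 1; ring
  rw [Real.sinh_eq, h2]
  nlinarith [Real.exp_pos d]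

/-- Here `A`, `V`, `W` are minus the pairings of `q` with position, velocity and normal. Under the
geodesic flow `(A, V)` undergoes a hyperbolic rotation while `W` is constant. The pairing with the
direction is `B = V + s W`, and the quantity `B - (1 - κ) A` is driven upwards by `A - (1 - κ) B`,
which is at least `(κ - η) A`. -/
theorem cone_step {A V W s s' d η κ K : ℝ} (hV : |V| ≤ A) (hW : |W| ≤ A)
    (hs : |s| ≤ η) (hss : |s' - s| ≤ K * η * d) (hd : 0 ≤ d) (hK : 0 ≤ K) (hη : 0 ≤ η)
    (hκ : (K + 3) * η ≤ κ) (hκ1 : κ ≤ 1 / 2) :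
    Real.exp d * min (V + s * W - (1 - κ) * A) 0 ≤
        min (Real.sinh d * A + Real.cosh d * V + s' * W -
          (1 - κ) * (Real.cosh d * A + Real.sinh d * V)) 0 ∧
      Real.exp ((1 - 2 * κ) * d) * A + d * Real.exp d * min (V + s * W - (1 - κ) * A) 0 ≤
        Real.cosh d * A + Real.sinh d * V := by
  have hA : 0 ≤ A := (abs_nonneg _).trans hV
  have hKη : 0 ≤ K * η := mul_nonneg hK hη
  have hηκ : η ≤ κ := by nlinarith
  obtain ⟨m, hm⟩ : ∃ m, m = min (V + s * W - (1 - κ) * A) 0 := ⟨_, rfl⟩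
  have hm0 : m ≤ 0 := hm ▸ min_le_right _ _
  have hmf : m ≤ V + s * W - (1 - κ) * A := hm ▸ min_le_left _ _
  rw [← hm]
  have hS0 : 0 ≤ Real.sinh d := Real.sinh_nonneg_iff.2 hd
  have hSd : d ≤ Real.sinh d := Real.self_le_sinh_iff.2 hd
  have hC1 := Real.one_le_cosh d
  have hCS : Real.cosh d - 1 ≤ Real.sinh d := by
    have h1 := Real.cosh_sub_sinh d
    have h2 : Real.exp (-d) ≤ 1 := Real.exp_le_one_iff.2 (by linarith)
    linarith
  have hCE : Real.cosh d + Real.sinh d = Real.exp d := Real.cosh_add_sinh d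
  have hsW : |s * W| ≤ η * A := by
    rw [abs_mul]; exact mul_le_mul hs hW (abs_nonneg _) hη
  have hsW' := abs_le.1 hsW
  have hV' := abs_le.1 hV
  constructor
  · obtain ⟨B, hB⟩ : ∃ B, B = V + s * W := ⟨_, rfl⟩
    have hBA : B ≤ (1 + η) * A := by rw [hB]; linarith
    have h1 : (κ - η) * A ≤ A - (1 - κ) * B := by
      have := mul_le_mul_of_nonneg_left hBA (by linarith : 0 ≤ 1 - κ)
      nlinarith [mul_nonneg (mul_nonneg (hη.trans hηκ) hη) hA]
    have h2 : |(s' - s) * W| ≤ K * η * d * A := by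
      rw [abs_mul]; exact mul_le_mul hss hW (abs_nonneg _) (by positivity)
    have h2' := (abs_le.1 h2).1
    have h3 : -(η * A * Real.sinh d) ≤ s * W * (1 - Real.cosh d) := by
      have : s * W * (Real.cosh d - 1) ≤ η * A * Real.sinh d :=
        (mul_le_mul_of_nonneg_right hsW'.2 (by linarith)).trans
          (mul_le_mul_of_nonneg_left hCS (by positivity))
      linarith
    have h4 : -(η * A * Real.sinh d) ≤ (1 - κ) * (s * W) * Real.sinh d := by
      have : -(η * A) ≤ (1 - κ) * (s * W) := by
        nlinarith [mul_nonneg hη hA]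
      nlinarith
    have h5 : K * η * d * A ≤ K * η * Real.sinh d * A := by
      have := mul_le_mul_of_nonneg_left hSd hKη
      exact mul_le_mul_of_nonneg_right this hA
    have h6 := mul_le_mul_of_nonneg_left h1 hS0
    -- The budget: the gain is `κ - η`, the change of slope costs `K * η`, and each of the two terms
    -- by which `s W` fails to follow the flow costs `η`.
    have h7 : 0 ≤ Real.sinh d * A * (κ - (K + 3) * η) :=
      mul_nonneg (mul_nonneg hS0 hA) (by linarith)
    have key : Real.cosh d * (B - (1 - κ) * A) ≤ Real.sinh d * A + Real.cosh d * V + s' * W -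
          (1 - κ) * (Real.cosh d * A + Real.sinh d * V) := by
      have : Real.sinh d * A + Real.cosh d * V + s' * W -
          (1 - κ) * (Real.cosh d * A + Real.sinh d * V) = Real.cosh d * (B - (1 - κ) * A) +
          Real.sinh d * (A - (1 - κ) * B) + (s' - s) * W + s * W * (1 - Real.cosh d) +
          (1 - κ) * (s * W) * Real.sinh d := by rw [hB]; ring
      rw [this]
      nlinarith
    refine le_min ?_ (mul_nonpos_of_nonneg_of_nonpos (Real.exp_pos _).le hm0)
    rw [← hB] at hmf
    nlinarith
  -- Removing `s W` from `B` costs at most `η * A ≤ κ * A`, hence the rate `1 - 2κ`.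
  · have h1 : m + (1 - 2 * κ) * A ≤ V := by nlinarith
    have h2 := exp_mul_le_cosh_add_mul_sinh (c := 1 - 2 * κ) (d := d) (by linarith)
      (by linarith)
    have h3 := mul_le_mul_of_nonneg_right h2 hA
    have h4 := mul_le_mul_of_nonneg_left h1 hS0
    have h5 := mul_le_mul_of_nonpos_right (sinh_le_mul_exp (d := d)) hm0
    linarith

/-! ### Direction fields along a geodesic and chains of bends -/

namespace GeodesicLine

variable {n : ℕ} (l : GeodesicLine n)

theorem onSheet_pt (t : ℝ) : OnSheet (l.pt t).1 := (l.pt t).2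

theorem mink_pt_vel (t : ℝ) : mink (l.pt t).1 (l.vel t) = 0 := by
  simp only [pt, vel]
  rw [mink_comb, mink_comb_left, mink_comb_left, mink_comm l.dir l.base.1, l.dir_unit,
    l.dir_tangent, l.base.2.1]
  ring

theorem mink_vel_vel (t : ℝ) : mink (l.vel t) (l.vel t) = 1 := by
  simp only [vel]
  rw [mink_comb, mink_comb_left, mink_comb_left, mink_comm l.dir l.base.1, l.dir_unit,
    l.dir_tangent, l.base.2.1]
  nlinarith [Real.cosh_sq t]

theorem pt_eq (t r : ℝ) : (l.pt r).1 =
    Real.cosh (r - t) • (l.pt t).1 + Real.sinh (r - t) • l.vel t := by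
  have h : r = (r - t) + t := by ring
  ext i
  simp only [pt, vel, Pi.add_apply, Pi.smul_apply, smul_eq_mul]
  conv_lhs => rw [h, Real.cosh_add, Real.sinh_add]
  ring

theorem vel_eq (t r : ℝ) : l.vel r =
    Real.sinh (r - t) • (l.pt t).1 + Real.cosh (r - t) • l.vel t := by
  have h : r = (r - t) + t := by ring
  ext i
  simp only [pt, vel, Pi.add_apply, Pi.smul_apply, smul_eq_mul]
  conv_lhs => rw [h, Real.cosh_add, Real.sinh_add]
  ring

end GeodesicLine

/-- A unit normal to the geodesic `l` and a Lipschitz function `slope` along `l` such that the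
vectors `l.vel t + slope t • normal` are tangent to the leaves that cross `l`. -/
structure DirectionField (L : MeasuredLamination) (l : GeodesicLine 2) (K η : ℝ) where
  normal : Fin 3 → ℝ
  slope : ℝ → ℝ
  normal_unit : mink normal normal = 1
  mink_base : mink l.base.1 normal = 0
  mink_dir : mink l.dir normal = 0
  abs_slope_le : ∀ t, |slope t| ≤ η
  lipschitz : ∀ s t, |slope s - slope t| ≤ K * η * |s - t|
  tangent : ∀ e ∈ L.leaves, ∀ t, l.pt t ∈ e.carrier →
    mink (l.vel t + slope t • normal) e.1 = 0

namespace DirectionField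

variable {L : MeasuredLamination} {l : GeodesicLine 2} {K η κ : ℝ} (u : DirectionField L l K η)

/-- The direction at time `t`. -/
noncomputable def dirAt (t : ℝ) : Fin 3 → ℝ := l.vel t + u.slope t • u.normal

theorem mink_pt (t : ℝ) : mink (l.pt t).1 u.normal = 0 := by
  simp only [GeodesicLine.pt]
  rw [mink_comb_left, u.mink_base, u.mink_dir]; ring

theorem mink_vel (t : ℝ) : mink (l.vel t) u.normal = 0 := by
  simp only [GeodesicLine.vel]
  rw [mink_comb_left, u.mink_base, u.mink_dir]; ring

theorem mink_pt_dirAt (t : ℝ) : mink (l.pt t).1 (u.dirAt t) = 0 := by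
  rw [dirAt, mink_add_right, mink_smul_right, l.mink_pt_vel, u.mink_pt]; ring

theorem mink_dirAt_dirAt (t : ℝ) : mink (u.dirAt t) (u.dirAt t) = 1 + u.slope t ^ 2 := by
  simp only [dirAt, mink_add_right, mink_add_left, mink_smul_right, mink_smul_left,
    l.mink_vel_vel, u.normal_unit, mink_comm u.normal, u.mink_vel]
  ring

/-- The bent position at time `t`. -/
noncomputable def pos (l : GeodesicLine 2) (P : (Fin 4 → ℝ) →L[ℝ] (Fin 4 → ℝ)) (t : ℝ) :
    Fin 4 → ℝ := P (planeIncl (l.pt t).1)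

/-- The bent direction at time `t`. -/
noncomputable def heading (P : (Fin 4 → ℝ) →L[ℝ] (Fin 4 → ℝ)) (t : ℝ) : Fin 4 → ℝ :=
  P (planeIncl (u.dirAt t))

variable {P : (Fin 4 → ℝ) →L[ℝ] (Fin 4 → ℝ)}

theorem onSheet_pos (hP : IsHypIsometry P) (t : ℝ) : OnSheet (pos l P t) :=
  hP.2 _ (onSheet_planeIncl (l.onSheet_pt t))

/-- Moving along the geodesic, between two bends. -/
theorem coneRelated_step (hP : IsHypIsometry P) (hK : 0 ≤ K) (hκ : (K + 3) * η ≤ κ)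
    (hκ1 : κ ≤ 1 / 2) {s t : ℝ} (hst : s ≤ t) :
    ConeRelated κ (t - s) (pos l P s) (u.heading P s) (pos l P t) (u.heading P t) := by
  have hη : 0 ≤ η := (abs_nonneg _).trans (u.abs_slope_le 0)
  have hd : 0 ≤ t - s := by linarith
  have habs : |t - s| = t - s := abs_of_nonneg hd
  have hpos : pos l P t = Real.cosh (t - s) • pos l P s +
      Real.sinh (t - s) • P (planeIncl (l.vel s)) := by
    rw [pos, l.pt_eq s t, planeIncl_add, planeIncl_smul, planeIncl_smul, map_add, map_smul,
      map_smul, pos]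
  have hvel : P (planeIncl (l.vel t)) = Real.sinh (t - s) • pos l P s +
      Real.cosh (t - s) • P (planeIncl (l.vel s)) := by
    rw [l.vel_eq s t, planeIncl_add, planeIncl_smul, planeIncl_smul, map_add, map_smul,
      map_smul, pos]
  have hhead : ∀ r, u.heading P r = P (planeIncl (l.vel r)) +
      u.slope r • P (planeIncl u.normal) := fun r => by
    rw [heading, dirAt, planeIncl_add, planeIncl_smul, map_add, map_smul]
  have hV : ∀ r q, FutureNull q → |-mink (P (planeIncl (l.vel r))) q| ≤ -mink (pos l P r) q :=
    fun r q hq => by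
      rw [abs_neg]
      refine (onSheet_pos hP r).abs_mink_le ?_ ?_ hq
      · rw [pos, hP.1, mink_planeIncl, l.mink_pt_vel]
      · rw [hP.1, mink_planeIncl, l.mink_vel_vel]
  have hW : ∀ r q, FutureNull q → |-mink (P (planeIncl u.normal)) q| ≤ -mink (pos l P r) q :=
    fun r q hq => by
      rw [abs_neg]
      refine (onSheet_pos hP r).abs_mink_le ?_ ?_ hq
      · rw [pos, hP.1, mink_planeIncl, u.mink_pt]
      · rw [hP.1, mink_planeIncl, u.normal_unit]
  have hf : ∀ q, FutureNull q → _ := fun q hq => cone_step (hV s q hq) (hW s q hq)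
    (u.abs_slope_le s) (habs ▸ u.lipschitz t s) hd hK hη hκ hκ1
  -- Moving backwards is the same step, started at time `t` with velocity and normal negated; `eA`
  -- and `eV` undo the hyperbolic rotation.
  have hb : ∀ q, FutureNull q → _ := fun q hq => cone_step
    ((abs_neg (-mink (P (planeIncl (l.vel t))) q)).trans_le (hV t q hq))
    ((abs_neg (-mink (P (planeIncl u.normal)) q)).trans_le (hW t q hq))
    (u.abs_slope_le t) (habs ▸ abs_sub_comm s t ▸ u.lipschitz s t) hd hK hη hκ hκ1
  have hcs := Real.cosh_sq (t - s)
  have eA : ∀ q, Real.cosh (t - s) * -mink (pos l P t) q + Real.sinh (t - s) *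
      -(-mink (P (planeIncl (l.vel t))) q) = -mink (pos l P s) q := fun q => by
    rw [hpos, hvel, mink_comb_left, mink_comb_left]
    linear_combination (-mink (pos l P s) q) * hcs
  have eV : ∀ q, Real.sinh (t - s) * -mink (pos l P t) q + Real.cosh (t - s) *
      -(-mink (P (planeIncl (l.vel t))) q) = mink (P (planeIncl (l.vel s))) q := fun q => by
    rw [hpos, hvel, mink_comb_left, mink_comb_left]
    linear_combination (mink (P (planeIncl (l.vel s))) q) * hcs
  refine ⟨⟨fun q hq => ?_, fun q hq => ?_⟩, ⟨fun q hq => ?_, fun q hq => ?_⟩, ?_⟩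
  · have := (hf q hq).1
    simp only [coneDefect, hhead, mink_add_left, mink_smul_left]
    rw [hpos, hvel, mink_comb_left, mink_comb_left]
    convert this using 3 <;> ring
  · have := (hf q hq).2
    simp only [coneDefect, hhead, mink_add_left, mink_smul_left]
    rw [hpos, mink_comb_left]
    convert this using 1
    · congr 3; ring
    · ring
  · have := (hb q hq).1
    rw [eA, eV] at this
    simp only [coneDefect, hhead, mink_add_left, mink_smul_left, mink_neg_left]
    convert this using 3 <;> ring
  · have := (hb q hq).2
    rw [eA] at this
    simp only [coneDefect, hhead, mink_add_left, mink_smul_left, mink_neg_left]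
    convert this using 1
    congr 3; ring
  · rw [hpos, mink_comb, (onSheet_pos hP s).1, pos, hP.1, mink_planeIncl, l.mink_pt_vel]
    linarith

section Chains

variable {e : ℕ → OrientedGeodesic} {w τ : ℕ → ℝ} {N : ℕ} {r : ℝ}

/-- The rotation fixes every vector of the plane orthogonal to the normal of its leaf, in particular
the crossing point and the direction tangent to the leaf there. -/
theorem bent_eq_of_mem {a : OrientedGeodesic} (ha : a ∈ L.leaves) {t : ℝ}
    (hat : l.pt t ∈ a.carrier) (Q : (Fin 4 → ℝ) →L[ℝ] (Fin 4 → ℝ)) (θ : ℝ) :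
    pos l (Q * rot a θ) t = pos l Q t ∧ u.heading (Q * rot a θ) t = u.heading Q t := by
  constructor
  · simp only [pos, mul_apply_eq_comp, rot_apply]
    rw [bendRotation_planeIncl_of_mem _ _ _ hat]
  · simp only [heading, mul_apply_eq_comp, rot_apply]
    rw [bendRotation_planeIncl_of_mem _ _ (u.dirAt t) (u.tangent a ha t hat)]

theorem isHypIsometry_mul_oprod (hP : IsHypIsometry P) (e : ℕ → OrientedGeodesic) (w : ℕ → ℝ)
    (n : ℕ) : IsHypIsometry ⇑(P * oprod (fun k => rot (e k) (w k)) n) :=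
  hP.comp (isHypIsometry_oprod fun k _ => isHypIsometry_bendRotation (e k) _)

/-- The last rotation is inserted at its crossing time, where it changes neither position nor
direction. So the earlier chain up to that time is followed by a motion without bends. -/
theorem coneRelated_up (hP : IsHypIsometry P) (hK : 0 ≤ K) (hκ : (K + 3) * η ≤ κ)
    (hκ1 : κ ≤ 1 / 2) (hκ0 : 0 ≤ κ)
    (hτ : ∀ k < N, w k ≠ 0 → e k ∈ L.leaves ∧ l.pt (τ k) ∈ (e k).carrier ∧ r ≤ τ k)
    (hmono : ∀ i j, i < j → j < N → w i ≠ 0 → w j ≠ 0 → τ i ≤ τ j) {n : ℕ} (hn : n ≤ N) :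
    ∀ t, r ≤ t → (∀ k < n, w k ≠ 0 → τ k ≤ t) → ConeRelated κ (t - r) (pos l P r) (u.heading P r)
      (pos l (P * oprod (fun k => rot (e k) (w k)) n) t)
      (u.heading (P * oprod (fun k => rot (e k) (w k)) n) t) := by
  induction n with
  | zero =>
    intro t hrt _
    rw [oprod_zero, mul_one]
    exact u.coneRelated_step hP hK hκ hκ1 hrt
  | succ n ih =>
    intro t hrt ht
    have ih := ih (by omega)
    have hiso := isHypIsometry_mul_oprod hP e w (n + 1)
    rw [oprod_succ, ← mul_assoc] at hiso ⊢
    by_cases h0 : w n = 0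
    · rw [h0, rot_zero, mul_one]
      exact ih t hrt fun k hk => ht k (by omega)
    · obtain ⟨h1, h2, h3⟩ := hτ n (by omega) h0
      have i1 := ih (τ n) h3 fun k hk hw => hmono k n hk (by omega) hw h0
      obtain ⟨e1, e2⟩ := u.bent_eq_of_mem h1 h2 (P * oprod (fun k => rot (e k) (w k)) n) (w n)
      rw [← e1, ← e2] at i1
      have i2 := u.coneRelated_step hiso hK hκ hκ1 (ht n (by omega) h0)
      have := i1.trans hκ0 (by linarith) (by linarith [ht n (by omega) h0])
        (onSheet_pos hP r) (onSheet_pos hiso _) (onSheet_pos hiso _) i2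
      rwa [show τ n - r + (t - τ n) = t - r by ring] at this

theorem coneRelated_down (hP : IsHypIsometry P) (hK : 0 ≤ K) (hκ : (K + 3) * η ≤ κ)
    (hκ1 : κ ≤ 1 / 2) (hκ0 : 0 ≤ κ)
    (hτ : ∀ k < N, w k ≠ 0 → e k ∈ L.leaves ∧ l.pt (τ k) ∈ (e k).carrier ∧ τ k ≤ r)
    (hmono : ∀ i j, i < j → j < N → w i ≠ 0 → w j ≠ 0 → τ j ≤ τ i) {n : ℕ} (hn : n ≤ N) :
    ∀ s, s ≤ r → (∀ k < n, w k ≠ 0 → s ≤ τ k) → ConeRelated κ (r - s)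
      (pos l (P * oprod (fun k => rot (e k) (w k)) n) s)
      (u.heading (P * oprod (fun k => rot (e k) (w k)) n) s) (pos l P r) (u.heading P r) := by
  induction n with
  | zero =>
    intro s hsr _
    rw [oprod_zero, mul_one]
    exact u.coneRelated_step hP hK hκ hκ1 hsr
  | succ n ih =>
    intro s hsr hs
    have ih := ih (by omega)
    have hiso := isHypIsometry_mul_oprod hP e w (n + 1)
    rw [oprod_succ, ← mul_assoc] at hiso ⊢
    by_cases h0 : w n = 0
    · rw [h0, rot_zero, mul_one]
      exact ih s hsr fun k hk => hs k (by omega)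
    · obtain ⟨h1, h2, h3⟩ := hτ n (by omega) h0
      have i1 := ih (τ n) h3 fun k hk hw => hmono k n hk (by omega) hw h0
      obtain ⟨e1, e2⟩ := u.bent_eq_of_mem h1 h2 (P * oprod (fun k => rot (e k) (w k)) n) (w n)
      rw [← e1, ← e2] at i1
      have i2 := u.coneRelated_step hiso hK hκ hκ1 (hs n (by omega) h0)
      have := i2.trans hκ0 (by linarith [hs n (by omega) h0]) (by linarith)
        (onSheet_pos hiso _) (onSheet_pos hiso _) (onSheet_pos hP r) i1
      rwa [show τ n - s + (r - τ n) = r - s by ring] at this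

end Chains

end DirectionField

/-! ### Slopes of leaves and construction of the direction field -/

theorem mink_minkCross_sq (a b e : Fin 3 → ℝ) : mink (minkCross a b) e ^ 2 =
    -(mink a a * (mink b b * mink e e - mink b e ^ 2) -
      mink a b * (mink a b * mink e e - mink b e * mink a e) +
      mink a e * (mink a b * mink b e - mink b b * mink a e)) := by
  simp [mink_two, minkCross]; ring

namespace GeodesicLine

variable (l : GeodesicLine 2)

/-- The unit normal of a geodesic of the plane. -/
def normal : Fin 3 → ℝ := minkCross l.base.1 l.dir

theorem minkCross_pt_vel (t : ℝ) : minkCross (l.pt t).1 (l.vel t) = l.normal := by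
  have h := Real.cosh_sq t
  ext i
  fin_cases i <;> simp [minkCross, normal, pt, vel]
  · linear_combination (l.base.1 2 * l.dir 1 - l.base.1 1 * l.dir 2) * h
  · linear_combination (l.base.1 2 * l.dir 0 - l.base.1 0 * l.dir 2) * h
  · linear_combination (l.base.1 0 * l.dir 1 - l.base.1 1 * l.dir 0) * h

theorem mink_normal_normal : mink l.normal l.normal = 1 := by
  rw [normal, mink_minkCross_self, l.dir_unit, l.dir_tangent, l.base.2.1]; ring

theorem mink_base_normal : mink l.base.1 l.normal = 0 := by
  rw [normal, mink_comm, mink_minkCross_left]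

theorem mink_dir_normal : mink l.dir l.normal = 0 := by
  rw [normal, mink_comm, mink_minkCross_right]

theorem mink_vel_normal (t : ℝ) : mink (l.vel t) l.normal = 0 := by
  rw [← l.minkCross_pt_vel t, mink_comm, mink_minkCross_right]

theorem mink_pt_normal (t : ℝ) : mink (l.pt t).1 l.normal = 0 := by
  rw [← l.minkCross_pt_vel t, mink_comm, mink_minkCross_left]

variable {l}

/-- The normal `e` is a unit vector of the tangent plane at the crossing point, with orthonormal
frame `l.vel t`, `l.normal`; the identity comes from a Gram determinant. -/
theorem sq_add_sq_of_mem {e : OrientedGeodesic} {t : ℝ} (h : l.pt t ∈ e.carrier) :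
    mink (l.vel t) e.1 ^ 2 + mink l.normal e.1 ^ 2 = 1 := by
  have h' : mink (l.pt t).1 e.1 = 0 := h
  rw [← l.minkCross_pt_vel t, mink_minkCross_sq, h', l.mink_pt_vel, l.mink_vel_vel,
    (l.pt t).2.1, e.2]
  ring

theorem eq_of_mem {e : OrientedGeodesic} {t : ℝ} (h : l.pt t ∈ e.carrier) :
    e.1 = mink (l.vel t) e.1 • l.vel t + mink l.normal e.1 • l.normal := by
  have h' : mink (l.pt t).1 e.1 = 0 := h
  have h1 := sq_add_sq_of_mem h
  rw [← sub_eq_zero]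
  refine eq_zero_of_causal (l.pt t).inFuture ?_ (p := (l.pt t).1) ?_
  · simp only [mink_sub_left, mink_sub_right, mink_add_left, mink_add_right, mink_smul_left,
      mink_smul_right, e.2, l.mink_vel_vel, l.mink_normal_normal, l.mink_vel_normal,
      mink_comm l.normal (l.vel t), mink_comm e.1]
    nlinarith
  · rw [mink_sub_right, mink_comb, h', l.mink_pt_vel, l.mink_pt_normal]; ring

/-- Both normals are expanded in the moving frame of `l`, in which only the velocity depends on
time. -/
theorem mink_of_mem {e f : OrientedGeodesic} {s t : ℝ} (he : l.pt s ∈ e.carrier)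
    (hf : l.pt t ∈ f.carrier) : mink e.1 f.1 =
      mink (l.vel s) e.1 * mink (l.vel t) f.1 * Real.cosh (t - s) +
        mink l.normal e.1 * mink l.normal f.1 := by
  have h1 : mink (l.vel s) (l.vel t) = Real.cosh (t - s) := by
    rw [l.vel_eq s t, mink_comb, mink_comm, l.mink_pt_vel, l.mink_vel_vel]; ring
  conv_lhs => rw [eq_of_mem he, eq_of_mem hf]
  simp only [mink_add_left, mink_add_right, mink_smul_left, mink_smul_right, l.mink_vel_normal,
    mink_comm l.normal (l.vel t), l.mink_normal_normal, h1]
  ring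

theorem mink_pt_of_mem {e : OrientedGeodesic} {t : ℝ} (h : l.pt t ∈ e.carrier) (r : ℝ) :
    mink (l.pt r).1 e.1 = Real.sinh (r - t) * mink (l.vel t) e.1 := by
  have h' : mink (l.pt t).1 e.1 = 0 := h
  rw [l.pt_eq t r, mink_comb_left, h']; ring

end GeodesicLine

theorem cosh_sub_one_le_sq {d : ℝ} (h : |d| ≤ 1) : Real.cosh d - 1 ≤ d ^ 2 := by
  have h1 := Real.cosh_le_exp_half_sq d
  have h2 : d ^ 2 ≤ 1 := by rw [← sq_abs]; nlinarith [abs_nonneg d]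
  have h3 := Real.abs_exp_sub_one_le (x := d ^ 2 / 2) (by rw [abs_of_nonneg (by positivity)]; linarith)
  rw [abs_of_nonneg (by positivity : 0 ≤ d ^ 2 / 2)] at h3
  linarith [le_abs_self (Real.exp (d ^ 2 / 2) - 1)]

/-- Slopes of disjoint geodesics that cross a given one at small angles. -/
theorem abs_slope_sub_le {σ τ d η : ℝ} (hσ : |σ| ≤ η) (hτ : |τ| ≤ η) (hη : η ≤ 1)
    (h : (1 + σ ^ 2) * (1 + τ ^ 2) ≤ (1 + σ * τ * Real.cosh d) ^ 2) :
    |σ - τ| ≤ 3 * η * |d| := by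
  have hη0 : 0 ≤ η := (abs_nonneg _).trans hσ
  rcases le_total |d| 1 with hd | hd
  · have h1 := cosh_sub_one_le_sq hd
    have h2 := Real.one_le_cosh d
    have hd2 : d ^ 2 ≤ 1 := by rw [← sq_abs]; nlinarith [abs_nonneg d]
    have hp : |σ * τ| ≤ η ^ 2 := by
      rw [abs_mul, sq]; exact mul_le_mul hσ hτ (abs_nonneg _) hη0
    have hp1 := (abs_le.1 hp).2
    have hp2 : (σ * τ) ^ 2 ≤ η ^ 2 := by
      rw [← sq_abs]
      have : η ^ 2 ≤ 1 := by nlinarith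
      nlinarith [abs_nonneg (σ * τ), sq_nonneg η]
    have a1 : σ * τ * (Real.cosh d - 1) ≤ η ^ 2 * d ^ 2 :=
      mul_le_mul hp1 h1 (by linarith) (sq_nonneg _)
    have a2 : Real.cosh d ^ 2 - 1 ≤ 3 * d ^ 2 := by nlinarith
    have a3 : (σ * τ) ^ 2 * (Real.cosh d ^ 2 - 1) ≤ η ^ 2 * (3 * d ^ 2) :=
      mul_le_mul hp2 a2 (by nlinarith) (sq_nonneg _)
    refine abs_le_of_sq_le_sq ?_ (by positivity)
    rw [mul_pow, sq_abs]
    -- Since `(1 + σ²)(1 + τ²) = (1 + στ)² + (σ - τ)²`, the hypothesis bounds `(σ - τ)²` by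
    -- `2στ(cosh d - 1) + (στ)²(cosh² d - 1)`, hence by `5η²d²`.
    nlinarith [mul_nonneg (sq_nonneg η) (sq_nonneg d)]
  · have h1 := (abs_sub σ τ).trans (add_le_add hσ hτ)
    nlinarith

namespace MeasuredLamination

variable {L : MeasuredLamination} {l : GeodesicLine 2}

theorem abs_mink_vel_lt_of_angle_lt {ε : ℝ} (h : L.angle l < ε) {e : OrientedGeodesic}
    (he : e ∈ L.leaves) {t : ℝ} (ht : l.pt t ∈ e.carrier) : |mink (l.vel t) e.1| < ε := by
  have h1 : Real.arcsin |mink (l.vel t) e.1| ≤ L.angle l := by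
    refine le_csSup ⟨Real.pi / 2, ?_⟩ ⟨e, he, t, ht, rfl⟩
    rintro θ ⟨_, _, _, _, rfl⟩
    exact Real.arcsin_le_pi_div_two _
  have h2 : |mink (l.vel t) e.1| ≤ 1 := by
    have := GeodesicLine.sq_add_sq_of_mem ht
    exact abs_le_of_sq_le_sq (by nlinarith [sq_nonneg (mink l.normal e.1)]) zero_le_one
  have h3 := Real.sin_arcsin (by linarith [abs_nonneg (mink (l.vel t) e.1)]) h2
  have h4 := Real.sin_le (Real.arcsin_nonneg.2 (abs_nonneg (mink (l.vel t) e.1)))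
  linarith

-- At crossing times the slope is prescribed by the leaf. Disjointness makes it Lipschitz on the set
-- of these times, in particular independent of the leaf chosen at a given time, so it extends to
-- all times.
open Classical in
theorem exists_directionField {ε : ℝ} (hε : ε ≤ 1 / 4) (h : L.angle l < ε) :
    Nonempty (DirectionField L l 3 (2 * ε)) := by
  obtain ⟨σ, hσ⟩ : ∃ σ : OrientedGeodesic → ℝ → ℝ,
      σ = fun e t => -mink (l.vel t) e.1 / mink l.normal e.1 := ⟨_, rfl⟩
  have hbound : ∀ e ∈ L.leaves, ∀ t, l.pt t ∈ e.carrier →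
      mink l.normal e.1 ≠ 0 ∧ |σ e t| ≤ 2 * ε ∧ mink l.normal e.1 ^ 2 * (1 + σ e t ^ 2) = 1 := by
    intro e he t ht
    have h1 := abs_mink_vel_lt_of_angle_lt h he ht
    have h2 := GeodesicLine.sq_add_sq_of_mem ht
    obtain ⟨α, hα⟩ : ∃ α, α = mink (l.vel t) e.1 := ⟨_, rfl⟩
    obtain ⟨β, hβ⟩ : ∃ β, β = mink l.normal e.1 := ⟨_, rfl⟩
    rw [← hα] at h1
    rw [← hα, ← hβ] at h2
    have hs : σ e t = -α / β := by rw [hσ, hα, hβ]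
    rw [hs, ← hβ]
    have h3 : α ^ 2 ≤ 1 / 16 := by rw [← sq_abs]; nlinarith [abs_nonneg α]
    have h4 : β ≠ 0 := fun h0 => by rw [h0] at h2; linarith
    -- As `ε ≤ 1 / 4`, the normal component `β` is not small, and the slope `-α / β` is at most `2ε`
    -- in absolute value.
    have h5 : 1 / 2 ≤ |β| := by
      by_contra hc
      nlinarith [sq_abs β, abs_nonneg β]
    refine ⟨h4, ?_, ?_⟩
    · rw [abs_div, abs_neg, div_le_iff₀ (by linarith)]
      nlinarith [abs_nonneg α]
    · field_simp
      linarith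
  have hlip : ∀ e ∈ L.leaves, ∀ f ∈ L.leaves, ∀ s t, l.pt s ∈ e.carrier → l.pt t ∈ f.carrier →
      |σ e s - σ f t| ≤ 3 * (2 * ε) * |s - t| := by
    intro e he f hf s t hs ht
    obtain ⟨e0, e1, e2⟩ := hbound e he s hs
    obtain ⟨f0, f1, f2⟩ := hbound f hf t ht
    have h1 := L.one_le_mink_sq he hf
    rw [GeodesicLine.mink_of_mem hs ht] at h1
    rw [abs_sub_comm s t]
    refine abs_slope_sub_le e1 f1 (by linarith) ?_
    have e3 : mink (l.vel s) e.1 = -(σ e s * mink l.normal e.1) := by rw [hσ]; field_simp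
    have f3 : mink (l.vel t) f.1 = -(σ f t * mink l.normal f.1) := by rw [hσ]; field_simp
    rw [e3, f3] at h1
    obtain ⟨β, hβ⟩ : ∃ β, β = mink l.normal e.1 := ⟨_, rfl⟩
    obtain ⟨γ, hγ⟩ : ∃ γ, γ = mink l.normal f.1 := ⟨_, rfl⟩
    rw [← hβ] at e2 h1
    rw [← hγ] at f2 h1
    have h2 : 0 ≤ (1 + σ e s ^ 2) * (1 + σ f t ^ 2) := by positivity
    have h3 := mul_le_mul_of_nonneg_left h1 h2
    have h4 : (1 + σ e s ^ 2) * (1 + σ f t ^ 2) *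
        (-(σ e s * β) * -(σ f t * γ) * Real.cosh (t - s) + β * γ) ^ 2 =
        (β ^ 2 * (1 + σ e s ^ 2)) * (γ ^ 2 * (1 + σ f t ^ 2)) *
          (1 + σ e s * σ f t * Real.cosh (t - s)) ^ 2 := by ring
    rw [h4, e2, f2] at h3
    linarith
  have hε0 : 0 ≤ ε := by
    refine le_trans (Real.sSup_nonneg ?_) h.le
    rintro θ ⟨_, _, _, _, rfl⟩
    exact Real.arcsin_nonneg.2 (abs_nonneg _)
  obtain ⟨T, hT⟩ : ∃ T : Set ℝ, T = {t | ∃ e ∈ L.leaves, l.pt t ∈ e.carrier} := ⟨_, rfl⟩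
  have hch : ∀ t, ∃ e, t ∈ T → e ∈ L.leaves ∧ l.pt t ∈ e.carrier := by
    intro t
    by_cases ht : t ∈ T
    · rw [hT] at ht
      obtain ⟨e, he⟩ := ht
      exact ⟨e, fun _ => he⟩
    · exact ⟨Classical.arbitrary _, fun h => absurd h ht⟩
  choose c hc using hch
  have hL : LipschitzOnWith ⟨3 * (2 * ε), by positivity⟩ (fun t => σ (c t) t) T :=
    LipschitzOnWith.of_dist_le_mul fun s hs t ht => by
      rw [Real.dist_eq, Real.dist_eq]
      exact hlip _ (hc s hs).1 _ (hc t ht).1 s t (hc s hs).2 (hc t ht).2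
  obtain ⟨g, hg, hgT⟩ := hL.extend_real
  -- The extension `g` may exceed the bound on slopes. Truncation restores it, keeps the Lipschitz
  -- constant and changes nothing at crossing times.
  refine ⟨⟨l.normal, fun t => max (-(2 * ε)) (min (g t) (2 * ε)), l.mink_normal_normal,
    l.mink_base_normal, l.mink_dir_normal, fun t => ?_, fun s t => ?_, fun e he t ht => ?_⟩⟩
  · exact abs_le.2 ⟨le_max_left _ _, max_le (by linarith) (min_le_right _ _)⟩
  · have h1 := hg.dist_le_mul s t
    rw [Real.dist_eq, Real.dist_eq] at h1
    refine le_trans ?_ h1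
    refine (abs_max_sub_max_le_max _ _ _ _).trans ?_
    rw [sub_self, abs_zero, max_eq_right (abs_nonneg _)]
    refine (abs_min_sub_min_le_max _ _ _ _).trans ?_
    rw [sub_self, abs_zero, max_eq_left (abs_nonneg _)]
  · obtain ⟨h0, h1, -⟩ := hbound e he t ht
    have htT : t ∈ T := by rw [hT]; exact ⟨e, he, ht⟩
    have h2 : g t = σ e t := by
      rw [← hgT htT]
      have := hlip _ (hc t htT).1 e he t t (hc t htT).2 ht
      rw [sub_self, abs_zero, mul_zero] at this
      linarith [abs_nonpos_iff.1 this]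
    have h3 := abs_le.1 h1
    rw [h2, min_eq_left h3.2, max_eq_right h3.1, mink_add_left, mink_smul_left, hσ]
    field_simp
    ring

/-- The times at which `l` crosses the leaves that separate one of its points from another. -/
theorem exists_crossing_time {a b : ℝ} {e : OrientedGeodesic}
    (h : mink (l.pt a).1 e.1 * mink (l.pt b).1 e.1 ≤ 0) :
    ∃ t ∈ Set.uIcc a b, l.pt t ∈ e.carrier := by
  have hcont : Continuous fun t => mink (l.pt t).1 e.1 := by
    refine continuous_mink ?_ continuous_const
    simp only [GeodesicLine.pt]
    fun_prop
  have h0 : (0 : ℝ) ∈ Set.uIcc (mink (l.pt a).1 e.1) (mink (l.pt b).1 e.1) := by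
    rw [Set.mem_uIcc]
    by_contra hc
    push Not at hc
    rcases le_or_gt (mink (l.pt a).1 e.1) 0 with h1 | h1
    · have h2 := hc.1 h1
      have h3 : mink (l.pt a).1 e.1 = 0 := by nlinarith
      exact absurd (hc.2 h2.le) (by linarith)
    · have h2 : 0 < mink (l.pt b).1 e.1 := by
        by_contra h3
        exact absurd (hc.2 (not_lt.1 h3)) (by linarith)
      nlinarith
  obtain ⟨t, ht, ht0⟩ := intermediate_value_uIcc hcont.continuousOn h0
  exact ⟨t, ht, ht0⟩

end MeasuredLamination

theorem sinh_sub_nonneg_iff {r t : ℝ} : 0 ≤ Real.sinh (r - t) ↔ t ≤ r := by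
  rw [Real.sinh_nonneg_iff, sub_nonneg]

/-! ### Comparison of two times for an arbitrary base point -/

namespace DirectionField

open MeasuredLamination

variable {L : MeasuredLamination} {l : GeodesicLine 2} {K η κ : ℝ} (u : DirectionField L l K η)

theorem tendsto_apply {b : ℕ → (Fin 4 → ℝ) →L[ℝ] (Fin 4 → ℝ)} {Q : (Fin 4 → ℝ) →L[ℝ] (Fin 4 → ℝ)}
    (h : Tendsto b atTop (𝓝 Q)) (P : (Fin 4 → ℝ) →L[ℝ] (Fin 4 → ℝ)) (v : Fin 4 → ℝ) :
    Tendsto (fun i => (P * b i) v) atTop (𝓝 ((P * Q) v)) :=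
  (P.continuous.tendsto _).comp
    (((ContinuousLinearMap.apply ℝ (Fin 4 → ℝ) v).continuous.tendsto Q).comp h)

theorem tendsto_const_state (v : Fin 4 → ℝ) : Tendsto (fun _ : ℕ => v) atTop (𝓝 v) :=
  tendsto_const_nhds

/-- Bending between two points of `l`, for an arbitrary base point `x`. -/
theorem coneRelated (hK : 0 ≤ K) (hκ : (K + 3) * η ≤ κ) (hκ1 : κ ≤ 1 / 2) (hκ0 : 0 ≤ κ)
    {x : Hyp 2} {s t : ℝ} (hst : s ≤ t) {P Φ Ψ : (Fin 4 → ℝ) →L[ℝ] (Fin 4 → ℝ)}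
    (hP : IsHypIsometry P) (hΦ : IsBendLimit L.measure (L.between x (l.pt s)) Φ)
    (hΨ : IsBendLimit L.measure (L.between x (l.pt t)) Ψ) :
    ConeRelated κ (t - s) (pos l (P * Φ) s) (u.heading (P * Φ) s) (pos l (P * Ψ) t)
      (u.heading (P * Ψ) t) := by
  -- Leaves in `A ∩ B` separate `x` from both points and contribute a common isometry. Those in `A \
  -- B` and `B \ A` are crossed by `l` between the times `s` and `t`: the former are unbent on the
  -- way, then the latter are bent.
  obtain ⟨A, hA⟩ : ∃ A, A = L.between x (l.pt s) := ⟨_, rfl⟩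
  obtain ⟨B, hB⟩ : ∃ B, B = L.between x (l.pt t) := ⟨_, rfl⟩
  have hAm : NullMeasurableSet A L.measure := hA ▸ L.nullMeasurableSet_between _ _
  have hBm : NullMeasurableSet B L.measure := hB ▸ L.nullMeasurableSet_between _ _
  have hAf : HasFinePartitions L.measure A := hA ▸ L.hasFinePartitions_between _ _
  have hBf : HasFinePartitions L.measure B := hB ▸ L.hasFinePartitions_between _ _
  have hAM : ∀ a ∈ A, ‖a.1‖ ≤ 1 + (x.1 0 + (l.pt s).1 0) := fun a ha =>
    norm_le_of_between (hA ▸ ha)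
  have hBM : ∀ a ∈ B, ‖a.1‖ ≤ 1 + (x.1 0 + (l.pt t).1 0) := fun a ha =>
    norm_le_of_between (hB ▸ ha)
  have hAt : L.measure A ≠ ⊤ := hA ▸ L.measure_between_ne_top _ _
  have hBt : L.measure B ≠ ⊤ := hB ▸ L.measure_between_ne_top _ _
  have hEf := hAf.mono Set.inter_subset_left (hAm.inter hBm)
  have hFf := hAf.mono Set.sdiff_subset (hAm.diff hBm)
  have hGf := hBf.mono Set.sdiff_subset (hBm.diff hAm)
  obtain ⟨PE, hPE⟩ := hEf.exists_isBendLimit (fun a ha => hAM a ha.1)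
    (measure_ne_top_of_subset Set.inter_subset_left hAt)
  obtain ⟨PF, hPF⟩ := hFf.exists_isBendLimit (fun a ha => hAM a ha.1)
    (measure_ne_top_of_subset Set.sdiff_subset hAt)
  obtain ⟨PG, hPG⟩ := hGf.exists_isBendLimit (fun a ha => hBM a ha.1)
    (measure_ne_top_of_subset Set.sdiff_subset hBt)
  have memA : ∀ {a}, a ∈ A ↔ a ∈ L.leaves ∧ mink x.1 a.1 < 0 ∧ 0 ≤ mink (l.pt s).1 a.1 :=
    fun {a} => by rw [hA]; rfl
  have memB : ∀ {a}, a ∈ B ↔ a ∈ L.leaves ∧ mink x.1 a.1 < 0 ∧ 0 ≤ mink (l.pt t).1 a.1 :=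
    fun {a} => by rw [hB]; rfl
  have memF : ∀ {a}, a ∈ A \ B → a ∈ L.leaves ∧ mink x.1 a.1 < 0 ∧ 0 ≤ mink (l.pt s).1 a.1 ∧
      mink (l.pt t).1 a.1 < 0 := fun {a} ha => by
    have h1 := memA.1 ha.1
    exact ⟨h1.1, h1.2.1, h1.2.2, not_le.1 fun h => ha.2 (memB.2 ⟨h1.1, h1.2.1, h⟩)⟩
  have memG : ∀ {a}, a ∈ B \ A → a ∈ L.leaves ∧ mink x.1 a.1 < 0 ∧ 0 ≤ mink (l.pt t).1 a.1 ∧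
      mink (l.pt s).1 a.1 < 0 := fun {a} ha => by
    have h1 := memB.1 ha.1
    exact ⟨h1.1, h1.2.1, h1.2.2, not_le.1 fun h => ha.2 (memA.2 ⟨h1.1, h1.2.1, h⟩)⟩
  have hEF : ∀ a ∈ A ∩ B, ∀ b ∈ A \ B, a.1 0 < b.1 0 := fun a ha b hb => by
    have h1 := between_causal (L := L) (hA ▸ ha.1 : a ∈ L.between x (l.pt s)) (hA ▸ hb.1)
    have h2 := zero_neg_of_mink_pos (l.pt t).inFuture h1 (by
      rw [mink_sub_right]; linarith [(memB.1 ha.2).2.2, (memF hb).2.2.2])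
    simpa using h2
  have hEG : ∀ a ∈ A ∩ B, ∀ b ∈ B \ A, a.1 0 < b.1 0 := fun a ha b hb => by
    have h1 := between_causal (L := L) (hB ▸ ha.2 : a ∈ L.between x (l.pt t)) (hB ▸ hb.1)
    have h2 := zero_neg_of_mink_pos (l.pt s).inFuture h1 (by
      rw [mink_sub_right]; linarith [(memA.1 ha.1).2.2, (memG hb).2.2.2])
    simpa using h2
  have eΦ : Φ = PE * PF := hPE.mul_eq hPF (by rwa [Set.inter_union_sdiff, hA]) hEf hFf hEF
  have eΨ : Ψ = PE * PG := hPE.mul_eq hPG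
    (by rwa [Set.inter_comm, Set.inter_union_sdiff, hB]) hEf hGf hEG
  -- the crossing times
  have hτ : ∀ a : OrientedGeodesic, ∃ τ, (a ∈ A \ B ∨ a ∈ B \ A) →
      s ≤ τ ∧ τ ≤ t ∧ l.pt τ ∈ a.carrier := fun a => by
    by_cases h : a ∈ A \ B ∨ a ∈ B \ A
    · have h1 : mink (l.pt s).1 a.1 * mink (l.pt t).1 a.1 ≤ 0 := by
        rcases h with h | h
        · exact mul_nonpos_of_nonneg_of_nonpos (memF h).2.2.1 (memF h).2.2.2.le
        · exact mul_nonpos_of_nonpos_of_nonneg (memG h).2.2.2.le (memG h).2.2.1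
      obtain ⟨τ, h2, h3⟩ := exists_crossing_time h1
      rw [Set.uIcc_of_le hst] at h2
      exact ⟨τ, fun _ => ⟨h2.1, h2.2, h3⟩⟩
    · exact ⟨0, fun h' => absurd h' h⟩
  choose τ hτ using hτ
  have velF : ∀ {a}, a ∈ A \ B → mink (l.vel (τ a)) a.1 < 0 := fun {a} ha => by
    obtain ⟨-, h2, h3⟩ := hτ a (Or.inl ha)
    have h4 := (memF ha).2.2.2
    rw [GeodesicLine.mink_pt_of_mem h3] at h4
    by_contra h5
    linarith [mul_nonneg (sinh_sub_nonneg_iff.2 h2) (not_lt.1 h5)]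
  have velG : ∀ {a}, a ∈ B \ A → 0 < mink (l.vel (τ a)) a.1 := fun {a} ha => by
    obtain ⟨h2, -, h3⟩ := hτ a (Or.inr ha)
    have h4 := (memG ha).2.2.2
    rw [GeodesicLine.mink_pt_of_mem h3] at h4
    by_contra h5
    have h6 := sinh_sub_nonneg_iff.2 h2
    rw [← neg_sub, Real.sinh_neg] at h6
    nlinarith
  have leF : ∀ {a r}, a ∈ A \ B → 0 ≤ mink (l.pt r).1 a.1 → r ≤ τ a := fun {a r} ha h => by
    rw [GeodesicLine.mink_pt_of_mem (hτ a (Or.inl ha)).2.2] at h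
    by_contra h1
    have := mul_neg_of_pos_of_neg (Real.sinh_pos_iff.2 (sub_pos.2 (not_le.1 h1))) (velF ha)
    linarith
  have leF' : ∀ {a r}, a ∈ A \ B → mink (l.pt r).1 a.1 ≤ 0 → τ a ≤ r := fun {a r} ha h => by
    rw [GeodesicLine.mink_pt_of_mem (hτ a (Or.inl ha)).2.2] at h
    by_contra h1
    have := mul_pos_of_neg_of_neg (Real.sinh_neg_iff.2 (sub_neg.2 (not_le.1 h1))) (velF ha)
    linarith
  have leG : ∀ {a r}, a ∈ B \ A → 0 ≤ mink (l.pt r).1 a.1 → τ a ≤ r := fun {a r} ha h => by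
    rw [GeodesicLine.mink_pt_of_mem (hτ a (Or.inr ha)).2.2] at h
    by_contra h1
    have := mul_neg_of_neg_of_pos (Real.sinh_neg_iff.2 (sub_neg.2 (not_le.1 h1))) (velG ha)
    linarith
  -- A smaller time coordinate means closer to `x`. While `l` crosses leaves of `A \ B` it comes
  -- back towards the side of `x`, so the order of crossing is reversed.
  have hFmono : ∀ a ∈ A \ B, ∀ b ∈ A \ B, a.1 0 < b.1 0 → τ b ≤ τ a := fun a ha b hb hab => by
    have h1 := between_causal (L := L) (hA ▸ ha.1 : a ∈ L.between x (l.pt s)) (hA ▸ hb.1)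
    have h2 := mink_nonneg_of_zero_nonpos (l.pt (τ b)).inFuture h1 (by simpa using hab.le)
    have h3 : mink (l.pt (τ b)).1 b.1 = 0 := (hτ b (Or.inl hb)).2.2
    rw [mink_sub_right, h3, sub_zero] at h2
    exact leF ha h2
  have hGmono : ∀ a ∈ B \ A, ∀ b ∈ B \ A, a.1 0 < b.1 0 → τ a ≤ τ b := fun a ha b hb hab => by
    have h1 := between_causal (L := L) (hB ▸ ha.1 : a ∈ L.between x (l.pt t)) (hB ▸ hb.1)
    have h2 := mink_nonneg_of_zero_nonpos (l.pt (τ b)).inFuture h1 (by simpa using hab.le)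
    have h3 : mink (l.pt (τ b)).1 b.1 = 0 := (hτ b (Or.inr hb)).2.2
    rw [mink_sub_right, h3, sub_zero] at h2
    exact leG ha h2
  -- After flipping `a`, both leaves cross from `l.pt s` to `l.pt t` in the same sense, so they are
  -- causally related; their position relative to `x` decides the order.
  have hFG : ∀ a ∈ A \ B, ∀ b ∈ B \ A, τ a ≤ τ b := fun a ha b hb => by
    have mf := memF ha
    have mg := memG hb
    have hfl : a.flip.1 = -a.1 := rfl
    have h1 := L.causal_sub (L.flip_mem a mf.1) mg.1 (l.pt s).inFuture (l.pt t).inFuture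
      (by rw [hfl, mink_neg_right]; linarith [mf.2.2.1, mg.2.2.2])
      (by rw [hfl, mink_neg_right]; linarith [mf.2.2.2, mg.2.2.1])
    have h2 := zero_neg_of_mink_pos x.inFuture h1
      (by rw [hfl, mink_sub_right, mink_neg_right]; linarith [mf.2.1, mg.2.1])
    have h3 := mink_nonneg_of_zero_nonpos (l.pt (τ b)).inFuture h1 h2.le
    have h4 : mink (l.pt (τ b)).1 b.1 = 0 := (hτ b (Or.inr hb)).2.2
    rw [mink_sub_right, h4, sub_zero, hfl, mink_neg_right] at h3
    exact leF' ha (by linarith)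
  -- A turning time, at which the common isometry `P * PE` alone describes the state. The point `s`
  -- is inserted so that the supremum makes sense when `A \ B` is empty.
  obtain ⟨r, hsr, hrt, hFr, hGr⟩ : ∃ r, s ≤ r ∧ r ≤ t ∧ (∀ a ∈ A \ B, τ a ≤ r) ∧
      ∀ b ∈ B \ A, r ≤ τ b := by
    have hub : ∀ y ∈ insert s (τ '' (A \ B)), y ≤ t := by
      rintro y (rfl | ⟨a, ha, rfl⟩)
      · exact hst
      · exact (hτ a (Or.inl ha)).2.1
    refine ⟨sSup (insert s (τ '' (A \ B))), le_csSup ⟨t, hub⟩ (Set.mem_insert _ _),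
      csSup_le ⟨s, Set.mem_insert _ _⟩ hub,
      fun a ha => le_csSup ⟨t, hub⟩ (Set.mem_insert_of_mem _ ⟨a, ha, rfl⟩),
      fun b hb => csSup_le ⟨s, Set.mem_insert _ _⟩ ?_⟩
    rintro y (rfl | ⟨a, ha, rfl⟩)
    · exact (hτ b (Or.inr hb)).1
    · exact hFG a ha b hb
  have hQ : IsHypIsometry ⇑(P * PE) := hP.comp (hPE.isHypIsometry hEf)
  have hQF : IsHypIsometry ⇑(P * PE * PF) := hQ.comp (hPF.isHypIsometry hFf)
  have hQG : IsHypIsometry ⇑(P * PE * PG) := hQ.comp (hPG.isHypIsometry hGf)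
  have R1 : ConeRelated κ (r - s) (pos l (P * PE * PF) s) (u.heading (P * PE * PF) s)
      (pos l (P * PE) r) (u.heading (P * PE) r) := by
    obtain ⟨ξ, N, p, e, h1, h2, h3⟩ := hFf.exists_seq
    have hl := hPF ξ N p e h1 h2 (Eventually.of_forall h3)
    refine ConeRelated.of_tendsto (tendsto_apply hl _ _) (tendsto_apply hl _ _)
      (tendsto_const_state _) (tendsto_const_state _) fun i => ?_
    have hmem : ∀ k < N i, L.measure.real (p i k) ≠ 0 → e i k ∈ p i k ∧ e i k ∈ A \ B :=
      fun k hk hw => by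
        have := ((h3 i).rep k hk).resolve_right hw
        exact ⟨this, (h3 i).subset hk this⟩
    exact u.coneRelated_down (e := e i) (w := fun k => L.measure.real (p i k))
      (τ := fun k => τ (e i k)) (N := N i) hQ hK hκ hκ1 hκ0
      (fun k hk hw => ⟨(memF (hmem k hk hw).2).1, (hτ _ (Or.inl (hmem k hk hw).2)).2.2,
        hFr _ (hmem k hk hw).2⟩)
      (fun j k hjk hk hwj hwk => hFmono _ (hmem j (by omega) hwj).2 _ (hmem k hk hwk).2
        ((h3 i).lt j k hjk hk _ (hmem j (by omega) hwj).1 _ (hmem k hk hwk).1)) le_rfl s hsr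
      (fun k hk hw => (hτ _ (Or.inl (hmem k hk hw).2)).1)
  have R2 : ConeRelated κ (t - r) (pos l (P * PE) r) (u.heading (P * PE) r)
      (pos l (P * PE * PG) t) (u.heading (P * PE * PG) t) := by
    obtain ⟨ξ, N, p, e, h1, h2, h3⟩ := hGf.exists_seq
    have hl := hPG ξ N p e h1 h2 (Eventually.of_forall h3)
    refine ConeRelated.of_tendsto (tendsto_const_state _) (tendsto_const_state _)
      (tendsto_apply hl _ _) (tendsto_apply hl _ _) fun i => ?_
    have hmem : ∀ k < N i, L.measure.real (p i k) ≠ 0 → e i k ∈ p i k ∧ e i k ∈ B \ A :=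
      fun k hk hw => by
        have := ((h3 i).rep k hk).resolve_right hw
        exact ⟨this, (h3 i).subset hk this⟩
    exact u.coneRelated_up (e := e i) (w := fun k => L.measure.real (p i k))
      (τ := fun k => τ (e i k)) (N := N i) hQ hK hκ hκ1 hκ0
      (fun k hk hw => ⟨(memG (hmem k hk hw).2).1, (hτ _ (Or.inr (hmem k hk hw).2)).2.2,
        hGr _ (hmem k hk hw).2⟩)
      (fun j k hjk hk hwj hwk => hGmono _ (hmem j (by omega) hwj).2 _ (hmem k hk hwk).2
        ((h3 i).lt j k hjk hk _ (hmem j (by omega) hwj).1 _ (hmem k hk hwk).1)) le_rfl t hrt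
      (fun k hk hw => (hτ _ (Or.inr (hmem k hk hw).2)).2.1)
  have := R1.trans hκ0 (by linarith) (by linarith) (onSheet_pos hQF _) (onSheet_pos hQ _)
    (onSheet_pos hQG _) R2
  rwa [show r - s + (t - r) = t - s by ring, mul_assoc, mul_assoc, ← eΦ, ← eΨ] at this

end DirectionField

/-! ### Ideal points, null vectors and projection to a geodesic -/

section IdealPoints

variable {n : ℕ}

theorem FutureNull.smul {q : Fin (n + 1) → ℝ} (hq : FutureNull q) {a : ℝ} (ha : 0 < a) :
    FutureNull (a • q) :=
  ⟨by rw [mink_smul_left, mink_smul_right, hq.1]; ring, mul_pos ha hq.2⟩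

theorem FutureNull.sum_sq {q : Fin (n + 1) → ℝ} (hq : FutureNull q) (h0 : q 0 = 1) :
    ∑ i : Fin n, q i.succ ^ 2 = 1 := by
  have := hq.1
  simp only [mink, ← sq, h0] at this
  linarith

/-- A curve along which the functional of an ideal point decays converges to that point. -/
theorem hasIdealLimit_of_tendsto {c : ℝ → Hyp n} {F : Filter ℝ} {q : Fin (n + 1) → ℝ}
    (hq : FutureNull q) (h0 : q 0 = 1) (h : Tendsto (fun t => -mink (c t).1 q) F (𝓝 0)) :
    HasIdealLimit c F fun i => q i.succ := by
  refine ⟨hq.sum_sq h0, tendsto_pi_nhds.2 fun i => ?_⟩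
  rw [tendsto_iff_dist_tendsto_zero]
  have h1 : Tendsto (fun t => Real.sqrt (2 * -mink (c t).1 q)) F (𝓝 0) := by
    simpa using (h.const_mul 2).sqrt
  refine squeeze_zero (fun _ => dist_nonneg) (fun t => ?_) h1
  have hc : OnSheet (c t).1 := (c t).2
  have hc1 := hc.one_le
  have hcs := hc.1
  have hneg := hc.mink_neg hq
  have hqs := hq.sum_sq h0
  obtain ⟨r, hr⟩ : ∃ r, r = (c t).1 0 := ⟨_, rfl⟩
  rw [← hr] at hc1
  simp only [mink, ← sq, ← hr] at hcs
  rw [Real.dist_eq, ← hr]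
  refine Real.abs_le_sqrt ?_
  have h2 : ((c t).1 i.succ / r - q i.succ) ^ 2 ≤
      ∑ j : Fin n, ((c t).1 j.succ / r - q j.succ) ^ 2 :=
    Finset.single_le_sum (f := fun j : Fin n => ((c t).1 j.succ / r - q j.succ) ^ 2)
      (fun _ _ => sq_nonneg _) (Finset.mem_univ i)
  have h3 : ∑ j : Fin n, ((c t).1 j.succ / r - q j.succ) ^ 2 =
      (∑ j : Fin n, (c t).1 j.succ ^ 2) / r ^ 2 - 2 * (mink (c t).1 q + r) / r + ∑ j : Fin n, q j.succ ^ 2 := by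
    have h4 : mink (c t).1 q + r = ∑ j : Fin n, (c t).1 j.succ * q j.succ := by
      simp only [mink, h0, ← hr]; ring
    rw [h4, Finset.mul_sum, Finset.sum_div, Finset.sum_div, ← Finset.sum_sub_distrib,
      ← Finset.sum_add_distrib]
    refine Finset.sum_congr rfl fun j _ => ?_
    field_simp
    ring
  rw [hqs] at h3
  have h5 : (∑ j : Fin n, (c t).1 j.succ ^ 2) / r ^ 2 ≤ 1 := by
    rw [div_le_one (by positivity)]; linarith
  have h6 : 2 * (mink (c t).1 q + r) / r = 2 - 2 * (-mink (c t).1 q) / r := by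
    field_simp; ring
  have h7 : 2 * (-mink (c t).1 q) / r ≤ 2 * -mink (c t).1 q :=
    div_le_self (by linarith) hc1
  linarith

namespace GeodesicLine

variable (m : GeodesicLine n)

/-- The null vector representing the forward ideal endpoint. -/
def head : Fin (n + 1) → ℝ := m.base.1 + m.dir

/-- The null vector representing the backward ideal endpoint. -/
def tail : Fin (n + 1) → ℝ := m.base.1 - m.dir

theorem abs_dir_zero_lt : |m.dir 0| < m.base.1 0 := by
  have h := (tangent_bound m.base m.dir m.dir_tangent).2
  rw [m.dir_unit] at h
  exact abs_lt_of_sq_lt_sq (by linarith) m.base.2.2.le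

theorem futureNull_head : FutureNull m.head := by
  refine ⟨?_, ?_⟩
  · simp only [head, mink_add_left, mink_add_right, mink_comm m.dir, m.dir_tangent, m.dir_unit,
      m.base.2.1]
    ring
  · have := (abs_lt.1 m.abs_dir_zero_lt).1
    simp only [head, Pi.add_apply]
    linarith

theorem futureNull_tail : FutureNull m.tail := by
  refine ⟨?_, ?_⟩
  · simp only [tail, mink_sub_left, mink_sub_right, mink_comm m.dir, m.dir_tangent, m.dir_unit,
      m.base.2.1]
    ring
  · have := (abs_lt.1 m.abs_dir_zero_lt).2
    simp only [tail, Pi.sub_apply]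
    linarith

theorem mink_head_tail : mink m.head m.tail = -2 := by
  simp only [head, tail, mink_sub_right, mink_add_left, mink_comm m.dir m.base.1, m.dir_tangent,
    m.dir_unit, m.base.2.1]
  ring

theorem pt_eq_head_tail (r : ℝ) :
    (m.pt r).1 = (Real.exp r / 2) • m.head + (Real.exp (-r) / 2) • m.tail := by
  simp only [pt, head, tail, Real.cosh_eq, Real.sinh_eq]
  module

theorem vel_eq_head_tail (r : ℝ) :
    m.vel r = (Real.exp r / 2) • m.head + (-(Real.exp (-r) / 2)) • m.tail := by
  simp only [vel, head, tail, Real.cosh_eq, Real.sinh_eq]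
  module

theorem hasIdealLimit_atTop :
    HasIdealLimit m.pt atTop fun i => ((m.head 0)⁻¹ • m.head) i.succ := by
  have h0 := m.futureNull_head.2
  refine hasIdealLimit_of_tendsto (m.futureNull_head.smul (inv_pos.2 h0)) (by simp [h0.ne']) ?_
  have h1 : ∀ t, -mink (m.pt t).1 ((m.head 0)⁻¹ • m.head) = (m.head 0)⁻¹ * Real.exp (-t) := by
    intro t
    rw [mink_smul_right, pt_eq_head_tail, mink_comb_left, m.futureNull_head.1, mink_comm m.tail,
      m.mink_head_tail]
    ring
  simp only [h1]
  simpa using (Real.tendsto_exp_neg_atTop_nhds_zero).const_mul (m.head 0)⁻¹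

theorem hasIdealLimit_atBot :
    HasIdealLimit m.pt atBot fun i => ((m.tail 0)⁻¹ • m.tail) i.succ := by
  have h0 := m.futureNull_tail.2
  refine hasIdealLimit_of_tendsto (m.futureNull_tail.smul (inv_pos.2 h0)) (by simp [h0.ne']) ?_
  have h1 : ∀ t, -mink (m.pt t).1 ((m.tail 0)⁻¹ • m.tail) = (m.tail 0)⁻¹ * Real.exp t := by
    intro t
    rw [mink_smul_right, pt_eq_head_tail, mink_comb_left, m.futureNull_tail.1,
      m.mink_head_tail]
    ring
  simp only [h1]
  simpa using Real.tendsto_exp_atBot.const_mul (m.tail 0)⁻¹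

theorem eq_smul_of_ideal_eq {p q : Fin (n + 1) → ℝ} (hp : 0 < p 0) (hq : q 0 = 1)
    (h : (fun i : Fin n => (((p 0)⁻¹ • p) i.succ)) = fun i => q i.succ) : p = p 0 • q := by
  ext i
  refine Fin.cases ?_ (fun j => ?_) i
  · simp [hq]
  · have := congrFun h j
    simp only [Pi.smul_apply, smul_eq_mul] at this ⊢
    rw [← this]
    field_simp

/-- The geodesic joining two ideal points. -/
theorem exists_of_futureNull {p q : Fin (n + 1) → ℝ} (hp : FutureNull p) (hq : FutureNull q)
    (hpq : mink p q < 0) : ∃ (m : GeodesicLine n) (a : ℝ), 0 < a ∧ m.head = a • p ∧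
      m.tail = a • q := by
  obtain ⟨a, ha⟩ : ∃ a, a = Real.sqrt (-2 / mink p q) := ⟨_, rfl⟩
  have h1 : 0 < -2 / mink p q := div_pos_of_neg_of_neg (by norm_num) hpq
  have ha0 : 0 < a := ha ▸ Real.sqrt_pos.2 h1
  have ha2 : a ^ 2 * mink p q = -2 := by
    rw [ha, Real.sq_sqrt h1.le, div_mul_cancel₀ _ hpq.ne]
  refine ⟨⟨⟨(a / 2) • p + (a / 2) • q, ?_, ?_⟩, (a / 2) • p + (-(a / 2)) • q, ?_, ?_⟩, a, ha0,
    ?_, ?_⟩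
  · rw [mink_comb, mink_comb_left, mink_comb_left, hp.1, hq.1, mink_comm q p]; linarith
  · simp only [Pi.add_apply, Pi.smul_apply, smul_eq_mul]
    have := mul_pos ha0 hp.2
    have := mul_pos ha0 hq.2
    linarith
  · rw [mink_comb, mink_comb_left, mink_comb_left, hp.1, hq.1, mink_comm q p]; linarith
  · simp only
    rw [mink_comb, mink_comb_left, mink_comb_left, hp.1, hq.1, mink_comm q p]; ring
  · simp only [head]; module
  · simp only [tail]; module

/-- The parameter of the nearest point projection. -/
noncomputable def foot (m : GeodesicLine n) (p : Hyp n) : ℝ :=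
  (Real.log (-mink p.1 m.tail) - Real.log (-mink p.1 m.head)) / 2

/-- The hyperbolic cosine of the distance to the geodesic. -/
noncomputable def cdist (m : GeodesicLine n) (p : Hyp n) : ℝ :=
  Real.exp ((Real.log (-mink p.1 m.tail) + Real.log (-mink p.1 m.head)) / 2)

theorem mink_head_pos (p : Hyp n) : 0 < -mink p.1 m.head := by
  have := OnSheet.mink_neg (p := p.1) p.2 m.futureNull_head
  linarith

theorem mink_tail_pos (p : Hyp n) : 0 < -mink p.1 m.tail := by
  have := OnSheet.mink_neg (p := p.1) p.2 m.futureNull_tail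
  linarith

theorem cdist_sq (p : Hyp n) : m.cdist p ^ 2 = -mink p.1 m.tail * -mink p.1 m.head := by
  rw [cdist, ← Real.exp_nat_mul]
  have : ((2 : ℕ) : ℝ) * ((Real.log (-mink p.1 m.tail) + Real.log (-mink p.1 m.head)) / 2) =
      Real.log (-mink p.1 m.tail) + Real.log (-mink p.1 m.head) := by push_cast; ring
  rw [this, Real.exp_add, Real.exp_log (m.mink_tail_pos p), Real.exp_log (m.mink_head_pos p)]

theorem exp_foot (p : Hyp n) : Real.exp (m.foot p) * -mink p.1 m.head = m.cdist p := by
  rw [foot, cdist]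
  nth_rewrite 2 [← Real.exp_log (m.mink_head_pos p)]
  rw [← Real.exp_add]
  congr 1
  ring

theorem exp_neg_foot (p : Hyp n) : Real.exp (-m.foot p) * -mink p.1 m.tail = m.cdist p := by
  rw [foot, cdist]
  nth_rewrite 2 [← Real.exp_log (m.mink_tail_pos p)]
  rw [← Real.exp_add]
  congr 1
  ring

/-- The hyperbolic theorem of Pythagoras. It shows that `foot` minimizes the distance and that
`cdist` is the hyperbolic cosine of the minimum. -/
theorem neg_mink_pt (p : Hyp n) (r : ℝ) :
    -mink p.1 (m.pt r).1 = m.cdist p * Real.cosh (r - m.foot p) := by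
  have h1 := m.exp_foot p
  have h2 := m.exp_neg_foot p
  have e1 : Real.exp r = Real.exp (r - m.foot p) * Real.exp (m.foot p) := by
    rw [← Real.exp_add]; congr 1; ring
  have e2 : Real.exp (-r) = Real.exp (-(r - m.foot p)) * Real.exp (-m.foot p) := by
    rw [← Real.exp_add]; congr 1; ring
  rw [pt_eq_head_tail, mink_comb, Real.cosh_eq, e1, e2]
  linear_combination (Real.exp (r - m.foot p) / 2) * h1 +
    (Real.exp (-(r - m.foot p)) / 2) * h2

theorem cdist_pos (p : Hyp n) : 0 < m.cdist p := Real.exp_pos _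

theorem neg_mink_pt_foot (p : Hyp n) : -mink p.1 (m.pt (m.foot p)).1 = m.cdist p := by
  rw [neg_mink_pt, sub_self, Real.cosh_zero, mul_one]

theorem one_le_cdist (p : Hyp n) : 1 ≤ m.cdist p := by
  rw [← m.neg_mink_pt_foot p]
  have := OnSheet.mink_le_neg_one (p := p.1) (q := (m.pt (m.foot p)).1) p.2 (m.pt _).2
  linarith

theorem proj_eq (p : Hyp n) : m.proj p = m.pt (m.foot p) := by
  have h := Classical.choose_spec (m.exists_foot p) (m.foot p)
  rw [proj]
  congr 1
  obtain ⟨s, hs⟩ : ∃ s, s = Classical.choose (m.exists_foot p) := ⟨_, rfl⟩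
  rw [← hs] at h ⊢
  have hc := m.cdist_pos p
  rw [hdist, hdist, m.neg_mink_pt_foot, m.neg_mink_pt,
    Real.arcosh_le_arcosh (mul_pos hc (Real.cosh_pos _)) hc] at h
  by_contra hne
  have := Real.one_lt_cosh.2 (sub_ne_zero.2 hne)
  nlinarith

theorem hdist_foot_lt {p : Hyp n} {δ : ℝ} (hδ : 0 < δ) (h : m.cdist p < Real.cosh δ) :
    hdist p (m.pt (m.foot p)) < δ := by
  rw [hdist, neg_mink_pt_foot, ← Real.arcosh_cosh hδ.le,
    Real.arcosh_lt_arcosh (m.cdist_pos p) (Real.cosh_pos _)]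
  exact h

theorem mink_vel_foot (p : Hyp n) : mink p.1 (m.vel (m.foot p)) = 0 := by
  rw [vel_eq_head_tail, mink_comb]
  linarith [m.exp_foot p, m.exp_neg_foot p]

end GeodesicLine

end IdealPoints

/-! ### Endpoints and metric estimates for cone-expanding curves -/

/-- A curve in hyperbolic space with a direction field that expands cones. -/
structure BentCurve (κ : ℝ) (c : ℝ → Hyp 3) (U : ℝ → Fin 4 → ℝ) : Prop where
  tangent : ∀ t, mink (c t).1 (U t) = 0
  one_le : ∀ t, 1 ≤ mink (U t) (U t)
  le_one_add : ∀ t, mink (U t) (U t) ≤ 1 + κ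
  related : ∀ s t, s ≤ t → ConeRelated κ (t - s) (c s).1 (U s) (c t).1 (U t)

/-- The direction at the point `X` lies in the cone around the direction away from `q`. -/
def PointsAway (κ : ℝ) (q X Y : Fin 4 → ℝ) : Prop := (1 - κ) * -mink X q ≤ -mink Y q

theorem coneDefect_eq_zero_iff {κ : ℝ} {q X Y : Fin 4 → ℝ} :
    coneDefect κ q X Y = 0 ↔ PointsAway κ q X Y := by
  rw [coneDefect, min_eq_right_iff, sub_nonneg, PointsAway]

theorem PointsAway.smul {κ a : ℝ} {q X Y : Fin 4 → ℝ} (ha : 0 ≤ a) (h : PointsAway κ q X Y) :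
    PointsAway κ (a • q) X Y := by
  unfold PointsAway at *
  rw [mink_smul_right, mink_smul_right]
  have := mul_le_mul_of_nonneg_left h ha
  linarith

theorem ConeExpanding.pointsAway {κ h : ℝ} {X Y X' Y' q : Fin 4 → ℝ}
    (H : ConeExpanding κ h X Y X' Y') (hq : FutureNull q) (ha : PointsAway κ q X Y) :
    PointsAway κ q X' Y' := by
  have h1 := H.cone q hq
  rw [coneDefect_eq_zero_iff.2 ha, mul_zero] at h1
  exact coneDefect_eq_zero_iff.1 (le_antisymm (coneDefect_nonpos _ _ _ _) h1)

theorem ConeExpanding.growth_of_pointsAway {κ h : ℝ} {X Y X' Y' q : Fin 4 → ℝ}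
    (H : ConeExpanding κ h X Y X' Y') (hq : FutureNull q) (ha : PointsAway κ q X Y) :
    Real.exp ((1 - 2 * κ) * h) * -mink X q ≤ -mink X' q := by
  have h1 := H.growth q hq
  rw [coneDefect_eq_zero_iff.2 ha, mul_zero, add_zero] at h1
  exact h1

/-- Two ideal points in nearly opposite directions. -/
theorem mink_le_of_pointsAway {κ : ℝ} {p q X Y : Fin 4 → ℝ} (hX : OnSheet X)
    (hXY : mink X Y = 0) (hY : mink Y Y ≤ 1 + κ) (hp : FutureNull p) (hq : FutureNull q)
    (hpa : PointsAway κ p X (-Y)) (hqa : PointsAway κ q X Y) :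
    (2 - 6 * κ) * (-mink X q * -mink X p) ≤ -mink p q := by
  obtain ⟨a, ha⟩ : ∃ a, a = -mink X p := ⟨_, rfl⟩
  obtain ⟨b, hb⟩ : ∃ b, b = -mink X q := ⟨_, rfl⟩
  have ha0 : 0 < a := by rw [ha]; linarith [hX.mink_neg hp]
  have hb0 : 0 < b := by rw [hb]; linarith [hX.mink_neg hq]
  have hpX : mink X p = -a := by rw [ha]; ring
  have hqX : mink X q = -b := by rw [hb]; ring
  unfold PointsAway at hpa hqa
  rw [mink_neg_left, hpX] at hpa
  rw [hqX] at hqa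
  -- the vector `b (p - a X) + a (q - b X)` is short
  have h1 : 0 ≤ mink ((b • (p - a • X) - (a * b) • Y) - (a • (q - b • X) + (a * b) • Y))
      ((b • (p - a • X) - (a * b) • Y) - (a • (q - b • X) + (a * b) • Y)) := by
    refine hX.tangent_nonneg ?_
    simp only [mink_sub_right, mink_add_right, mink_smul_right, hX.1, hXY, hpX, hqX]
    ring
  simp only [mink_sub_right, mink_add_right, mink_smul_right, mink_sub_left, mink_add_left,
    mink_smul_left, mink_comm _ X, hX.1, hXY, hpX, hqX, mink_comm q p, mink_comm p Y,
    mink_comm q Y, hp.1, hq.1] at h1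
  obtain ⟨D, hD⟩ : ∃ D, D = mink p q := ⟨_, rfl⟩
  obtain ⟨y, hy⟩ : ∃ y, y = mink Y Y := ⟨_, rfl⟩
  rw [← hD, ← hy] at h1
  rw [← hD, ← hb, ← ha]
  rw [← hy] at hY
  have hab : 0 < a * b := mul_pos ha0 hb0
  have e1 : mink Y p * (a * b * b) ≥ (1 - κ) * a * (a * b * b) := by
    have := mul_le_mul_of_nonneg_right hpa (mul_pos hab hb0).le
    nlinarith
  have e2 : mink Y q * (a * b * a) ≤ -((1 - κ) * b) * (a * b * a) := by
    have := mul_le_mul_of_nonneg_right hqa (mul_pos hab ha0).le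
    nlinarith
  have e3 : y * (a * b) ^ 2 ≤ (1 + κ) * (a * b) ^ 2 :=
    mul_le_mul_of_nonneg_right hY (sq_nonneg _)
  -- Expanding the square, with its mixed terms bounded by `e1`, `e2` and `⟨Y, Y⟩` by `e3`, leaves a
  -- lower bound for `-⟨p, q⟩` times `a * b`.
  have e4 : (a * b) * ((2 - 6 * κ) * (b * a)) ≤ (a * b) * -D := by nlinarith
  exact le_of_mul_le_mul_left e4 hab

namespace BentCurve

variable {κ : ℝ} {c : ℝ → Hyp 3} {U : ℝ → Fin 4 → ℝ}

theorem reverse (h : BentCurve κ c U) : BentCurve κ (fun t => c (-t)) fun t => -U (-t) := by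
  refine ⟨fun t => by rw [mink_neg_right, h.tangent, neg_zero], fun t => ?_, fun t => ?_,
    fun s t hst => ?_⟩
  · simpa [mink_neg_left, mink_neg_right] using h.one_le (-t)
  · simpa [mink_neg_left, mink_neg_right] using h.le_one_add (-t)
  · have := h.related (-t) (-s) (by linarith)
    rw [show -s - -t = t - s by ring] at this
    exact ⟨this.bwd, by simpa using this.fwd, by rw [mink_comm]; exact this.dist⟩

/-- The witness is the endpoint of the geodesic ray from `c t` in the direction `U t`, normalized to
time coordinate `1` to allow a compactness argument. -/
theorem exists_futureNull_at (h : BentCurve κ c U) (hκ : 0 ≤ κ) (t : ℝ) :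
    ∃ q, FutureNull q ∧ q 0 = 1 ∧ PointsAway κ q (c t).1 (-U t) := by
  obtain ⟨r, hr⟩ : ∃ r, r = Real.sqrt (mink (U t) (U t)) := ⟨_, rfl⟩
  have h1 := h.one_le t
  have hr2 : r ^ 2 = mink (U t) (U t) := by rw [hr]; exact Real.sq_sqrt (by linarith)
  have hr1 : 1 ≤ r := by rw [hr]; exact Real.one_le_sqrt.2 h1
  have hc := (c t).2.1
  have hq : FutureNull (r • (c t).1 + (1 : ℝ) • U t) := by
    refine ⟨?_, ?_⟩
    · rw [mink_comb, mink_comb_left, mink_comb_left, mink_comm (U t), h.tangent, hc, ← hr2]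
      ring
    · have h2 := (tangent_bound (c t) (U t) (h.tangent t)).2
      rw [← hr2] at h2
      have h3 : |U t 0| < r * (c t).1 0 :=
        abs_lt_of_sq_lt_sq (by nlinarith) (mul_nonneg (by linarith) (c t).2.2.le)
      have := (abs_lt.1 h3).1
      simp only [Pi.add_apply, Pi.smul_apply, smul_eq_mul, one_mul]
      linarith
  refine ⟨_, hq.smul (inv_pos.2 hq.2), inv_mul_cancel₀ hq.2.ne', PointsAway.smul (inv_pos.2 hq.2).le ?_⟩
  unfold PointsAway
  rw [mink_neg_left, mink_comb, mink_comb, mink_comm (U t), h.tangent, hc, ← hr2]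
  nlinarith

/-- The forward ideal endpoint. -/
theorem exists_forward (h : BentCurve κ c U) (hκ : 0 ≤ κ) :
    ∃ q, FutureNull q ∧ q 0 = 1 ∧ ∀ t, PointsAway κ q (c t).1 (-U t) := by
  choose q hq hq0 hqa using fun n : ℕ => h.exists_futureNull_at hκ n
  have hq1 : ∀ n, q n ∈ Metric.closedBall (0 : Fin 4 → ℝ) 1 := fun n => by
    rw [mem_closedBall_zero_iff]
    have := norm_le_of_causal (hq n).1.le
    rwa [hq0, abs_one] at this
  obtain ⟨p, -, φ, hφ, hlim⟩ := (isCompact_closedBall (0 : Fin 4 → ℝ) 1).tendsto_subseq hq1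
  have hp0 : p 0 = 1 := by
    have h1 := (tendsto_pi_nhds.1 hlim) 0
    simp only [Function.comp_apply, hq0] at h1
    exact tendsto_nhds_unique h1 tendsto_const_nhds
  have hpn : mink p p = 0 := by
    have h1 := tendsto_mink hlim hlim
    simp only [Function.comp_apply, (hq _).1] at h1
    exact tendsto_nhds_unique h1 tendsto_const_nhds
  refine ⟨p, ⟨hpn, by rw [hp0]; exact one_pos⟩, hp0, fun t => ?_⟩
  have hX := (tendsto_mink (tendsto_const_nhds (x := (c t).1)) hlim).neg.const_mul (1 - κ)
  have hY := (tendsto_mink (tendsto_const_nhds (x := -U t)) hlim).neg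
  refine le_of_tendsto_of_tendsto hX hY ?_
  obtain ⟨N, hN⟩ := exists_nat_ge t
  filter_upwards [eventually_ge_atTop N] with n hn
  have h1 : t ≤ (φ n : ℕ) := hN.trans (by exact_mod_cast hn.trans (hφ.id_le n))
  -- The endpoint chosen at a late time lies ahead at every earlier time, because cones are
  -- invariant backwards; this closed condition passes to the limit.
  exact (h.related t _ h1).bwd.pointsAway (hq _) (hqa _)

/-- The backward ideal endpoint. -/
theorem exists_backward (h : BentCurve κ c U) (hκ : 0 ≤ κ) :
    ∃ q, FutureNull q ∧ q 0 = 1 ∧ ∀ t, PointsAway κ q (c t).1 (U t) := by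
  obtain ⟨q, h1, h2, h3⟩ := h.reverse.exists_forward hκ
  exact ⟨q, h1, h2, fun t => by simpa using h3 (-t)⟩

theorem hasIdealLimit_atTop (h : BentCurve κ c U) (hκ1 : κ < 1 / 2) {q : Fin 4 → ℝ}
    (hq : FutureNull q) (hq0 : q 0 = 1) (hqa : ∀ t, PointsAway κ q (c t).1 (-U t)) :
    HasIdealLimit c atTop fun i => q i.succ := by
  refine hasIdealLimit_of_tendsto hq hq0 ?_
  have h1 : Tendsto (fun t => Real.exp (-((1 - 2 * κ) * t)) * -mink (c 0).1 q) atTop (𝓝 0) := by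
    have : Tendsto (fun t : ℝ => (1 - 2 * κ) * t) atTop atTop :=
      tendsto_id.const_mul_atTop (by linarith)
    simpa using (Real.tendsto_exp_neg_atTop_nhds_zero.comp this).mul_const (-mink (c 0).1 q)
  refine squeeze_zero' (Eventually.of_forall fun t => ?_) ?_ h1
  · have := OnSheet.mink_neg (p := (c t).1) (c t).2 hq
    linarith
  · filter_upwards [eventually_ge_atTop 0] with t ht
    have := (h.related 0 t ht).bwd.growth_of_pointsAway hq (hqa t)
    rw [sub_zero] at this
    rw [Real.exp_neg, ← div_eq_inv_mul, le_div_iff₀ (Real.exp_pos _)]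
    linarith

theorem hasIdealLimit_atBot (h : BentCurve κ c U) (hκ1 : κ < 1 / 2) {q : Fin 4 → ℝ}
    (hq : FutureNull q) (hq0 : q 0 = 1) (hqa : ∀ t, PointsAway κ q (c t).1 (U t)) :
    HasIdealLimit c atBot fun i => q i.succ := by
  obtain ⟨h1, h2⟩ := h.reverse.hasIdealLimit_atTop hκ1 hq hq0 fun t => by simpa using hqa (-t)
  refine ⟨h1, ?_⟩
  simpa [Function.comp_def] using h2.comp tendsto_neg_atBot_atTop

/-- The two ideal points are distinct because they are seen from `c 0` in nearly opposite
directions: `2 - 6κ > 0`. -/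
theorem exists_joins (h : BentCurve κ c U) (hκ : 0 ≤ κ) (hκ1 : κ < 1 / 4) :
    ∃ m : GeodesicLine 3, m.JoinsEndpointsOf c := by
  obtain ⟨p, hp, hp0, hpa⟩ := h.exists_forward hκ
  obtain ⟨q, hq, hq0, hqa⟩ := h.exists_backward hκ
  have hc : OnSheet (c 0).1 := (c 0).2
  have hpq : mink p q < 0 := by
    have h1 := mink_le_of_pointsAway hc (h.tangent 0) (h.le_one_add 0) hp hq (hpa 0) (hqa 0)
    have h2 := mul_pos (neg_pos.2 (hc.mink_neg hq)) (neg_pos.2 (hc.mink_neg hp))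
    nlinarith
  obtain ⟨m, a, ha, hm, hm'⟩ := GeodesicLine.exists_of_futureNull hp hq hpq
  have e1 : (m.head 0)⁻¹ • m.head = p := by
    rw [hm]
    ext i
    simp only [Pi.smul_apply, smul_eq_mul, hp0]
    field_simp
  have e2 : (m.tail 0)⁻¹ • m.tail = q := by
    rw [hm']
    ext i
    simp only [Pi.smul_apply, smul_eq_mul, hq0]
    field_simp
  have l1 := m.hasIdealLimit_atTop
  have l2 := m.hasIdealLimit_atBot
  rw [e1] at l1
  rw [e2] at l2
  exact ⟨m, ⟨_, h.hasIdealLimit_atBot (by linarith) hq hq0 hqa, l2⟩,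
    ⟨_, h.hasIdealLimit_atTop (by linarith) hp hp0 hpa, l1⟩⟩

section Joined

variable {m : GeodesicLine 3}

/-- By uniqueness of limits, any `m` with the endpoints of `c` has as its head a positive multiple
of the null vector already constructed, and cones do not depend on the scaling. -/
theorem pointsAway_head (h : BentCurve κ c U) (hκ : 0 ≤ κ) (hκ1 : κ < 1 / 4)
    (hm : m.JoinsEndpointsOf c) (t : ℝ) : PointsAway κ m.head (c t).1 (-U t) := by
  obtain ⟨p, hp, hp0, hpa⟩ := h.exists_forward hκ
  obtain ⟨-, ξ, h1, h2⟩ := hm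
  have e1 := tendsto_nhds_unique h2.2 m.hasIdealLimit_atTop.2
  have e2 := tendsto_nhds_unique h1.2 (h.hasIdealLimit_atTop (by linarith) hp hp0 hpa).2
  rw [GeodesicLine.eq_smul_of_ideal_eq m.futureNull_head.2 hp0 (e1.symm.trans e2)]
  exact (hpa t).smul m.futureNull_head.2.le

theorem pointsAway_tail (h : BentCurve κ c U) (hκ : 0 ≤ κ) (hκ1 : κ < 1 / 4)
    (hm : m.JoinsEndpointsOf c) (t : ℝ) : PointsAway κ m.tail (c t).1 (U t) := by
  obtain ⟨p, hp, hp0, hpa⟩ := h.exists_backward hκ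
  obtain ⟨⟨ξ, h1, h2⟩, -⟩ := hm
  have e1 := tendsto_nhds_unique h2.2 m.hasIdealLimit_atBot.2
  have e2 := tendsto_nhds_unique h1.2 (h.hasIdealLimit_atBot (by linarith) hp hp0 hpa).2
  rw [GeodesicLine.eq_smul_of_ideal_eq m.futureNull_tail.2 hp0 (e1.symm.trans e2)]
  exact (hpa t).smul m.futureNull_tail.2.le

theorem cdist_sq_le (h : BentCurve κ c U) (hκ : 0 ≤ κ) (hκ1 : κ < 1 / 4)
    (hm : m.JoinsEndpointsOf c) (t : ℝ) : (1 - 3 * κ) * m.cdist (c t) ^ 2 ≤ 1 := by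
  have := mink_le_of_pointsAway (c t).2 (h.tangent t) (h.le_one_add t) m.futureNull_head
    m.futureNull_tail (h.pointsAway_head hκ hκ1 hm t) (h.pointsAway_tail hκ hκ1 hm t)
  rw [← m.cdist_sq, m.mink_head_tail] at this
  linarith

/-- Logarithms of the two null functionals change by at least `(1 - 2κ)(t - s)` by growth inside the
cones, and by at most `t - s` by the distance bound; the foot averages the two changes. -/
theorem foot_sub_mem (h : BentCurve κ c U) (hκ : 0 ≤ κ) (hκ1 : κ < 1 / 4)
    (hm : m.JoinsEndpointsOf c) {s t : ℝ} (hst : s ≤ t) :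
    (1 - 2 * κ) * (t - s) ≤ m.foot (c t) - m.foot (c s) ∧
      m.foot (c t) - m.foot (c s) ≤ t - s := by
  have R := h.related s t hst
  have hd : 0 ≤ t - s := by linarith
  have hs : OnSheet (c s).1 := (c s).2
  have ht : OnSheet (c t).1 := (c t).2
  have g1 := R.fwd.growth_of_pointsAway m.futureNull_tail (h.pointsAway_tail hκ hκ1 hm s)
  have g2 := R.bwd.growth_of_pointsAway m.futureNull_head (h.pointsAway_head hκ hκ1 hm t)
  have g3 := hs.neg_mink_le_exp_mul ht m.futureNull_tail hd R.dist
  have g4 := ht.neg_mink_le_exp_mul hs m.futureNull_head hd (by rw [mink_comm]; exact R.dist)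
  have key : ∀ {x y a : ℝ}, 0 < x → 0 < y → Real.exp a * x ≤ y →
      a + Real.log x ≤ Real.log y := fun {x y a} hx hy hxy => by
    have := Real.log_le_log (mul_pos (Real.exp_pos a) hx) hxy
    rwa [Real.log_mul (Real.exp_pos a).ne' hx.ne', Real.log_exp] at this
  have key' : ∀ {x y a : ℝ}, 0 < x → 0 < y → y ≤ Real.exp a * x →
      Real.log y ≤ a + Real.log x := fun {x y a} hx hy hxy => by
    have := Real.log_le_log hy hxy
    rwa [Real.log_mul (Real.exp_pos a).ne' hx.ne', Real.log_exp] at this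
  have k1 := key (m.mink_tail_pos (c s)) (m.mink_tail_pos (c t)) g1
  have k2 := key (m.mink_head_pos (c t)) (m.mink_head_pos (c s)) g2
  have k3 := key' (m.mink_tail_pos (c s)) (m.mink_tail_pos (c t)) g3
  have k4 := key' (m.mink_head_pos (c t)) (m.mink_head_pos (c s)) g4
  unfold GeodesicLine.foot
  constructor <;> linarith

theorem mul_abs_le_abs_foot_sub (h : BentCurve κ c U) (hκ : 0 ≤ κ) (hκ1 : κ < 1 / 4)
    (hm : m.JoinsEndpointsOf c) (s t : ℝ) :
    (1 - 2 * κ) * |s - t| ≤ |m.foot (c s) - m.foot (c t)| ∧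
      |m.foot (c s) - m.foot (c t)| ≤ |s - t| := by
  wlog hst : t ≤ s generalizing s t
  · rw [abs_sub_comm s, abs_sub_comm (m.foot _)]
    exact this t s (by linarith)
  have h1 := h.foot_sub_mem hκ hκ1 hm hst
  have h2 : 0 ≤ (1 - 2 * κ) * (s - t) := mul_nonneg (by linarith) (by linarith)
  rwa [abs_of_nonneg (by linarith : 0 ≤ s - t), abs_of_nonneg (by linarith)]

end Joined

/-- The lower bound holds because a Busemann function is `1`-Lipschitz and the one of the backward
endpoint grows at rate at least `1 - 2κ`. -/
theorem hdist_mem (h : BentCurve κ c U) (hκ : 0 ≤ κ) (s t : ℝ) :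
    (1 - 2 * κ) * |s - t| ≤ hdist (c s) (c t) ∧ hdist (c s) (c t) ≤ |s - t| := by
  wlog hst : s ≤ t generalizing s t
  · have := this t s (by linarith)
    rwa [abs_sub_comm s, hdist, mink_comm, ← hdist]
  have R := h.related s t hst
  have hs : OnSheet (c s).1 := (c s).2
  have ht : OnSheet (c t).1 := (c t).2
  have hd : 0 ≤ t - s := by linarith
  have h1 : 1 ≤ -mink (c s).1 (c t).1 := by linarith [hs.mink_le_neg_one ht]
  rw [abs_sub_comm, abs_of_nonneg hd]
  constructor
  · obtain ⟨q, hq, -, hqa⟩ := h.exists_backward hκ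
    have g1 := R.fwd.growth_of_pointsAway hq (hqa s)
    have g2 := hs.neg_mink_le_exp_mul ht hq (Real.arcosh_nonneg h1) (Real.cosh_arcosh h1).ge
    have g3 := le_of_mul_le_mul_right (g1.trans g2) (neg_pos.2 (hs.mink_neg hq))
    exact Real.exp_le_exp.1 g3
  · rw [hdist, ← Real.arcosh_cosh hd]
    exact (Real.arcosh_le_arcosh (by linarith) (Real.cosh_pos _)).2 R.dist

end BentCurve

/-! ### Tangent vectors of the bent curve -/

theorem hasDerivAt_mink {f : ℝ → Fin 4 → ℝ} {v : Fin 4 → ℝ} {t : ℝ} (h : HasDerivAt f v t)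
    (q : Fin 4 → ℝ) : HasDerivAt (fun s => mink (f s) q) (mink v q) t := by
  have h1 := hasDerivAt_pi.1 h
  exact (HasDerivAt.fun_sum fun i _ => (h1 (Fin.succ i)).mul_const (q (Fin.succ i))).sub
    ((h1 0).mul_const (q 0))

theorem two_mul_cosh_sub_two_le {h : ℝ} (hh : |h| ≤ 1) :
    2 * Real.cosh h - 2 ≤ h ^ 2 * (1 + h ^ 2) := by
  have h2 : h ^ 2 ≤ 1 := by rw [← sq_abs]; nlinarith [abs_nonneg h]
  have h0 : 0 ≤ h ^ 2 / 2 := by positivity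
  have h3 := Real.abs_exp_sub_one_sub_id_le (x := h ^ 2 / 2)
    (by rw [abs_of_nonneg h0]; linarith)
  have h4 := (abs_le.1 h3).2
  have h5 := Real.cosh_le_exp_half_sq h
  nlinarith [sq_nonneg (h ^ 2)]

namespace BentCurve

variable {κ : ℝ} {c : ℝ → Hyp 3} {U : ℝ → Fin 4 → ℝ}

/-- The curve does not increase distances: the square of a difference quotient is at most `(2 cosh
(s - t) - 2) / (s - t)²`, which tends to `1`. -/
theorem mink_deriv_le_one (h : BentCurve κ c U) {t : ℝ} {v : Fin 4 → ℝ}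
    (hv : HasDerivAt (fun s => (c s).1) v t) : mink v v ≤ 1 := by
  have h1 := hasDerivAt_iff_tendsto_slope.1 hv
  have h2 := tendsto_mink h1 h1
  have h3 : Tendsto (fun s : ℝ => 1 + (s - t) ^ 2) (𝓝[≠] t) (𝓝 1) := by
    have : Tendsto (fun s : ℝ => 1 + (s - t) ^ 2) (𝓝 t) (𝓝 (1 + (t - t) ^ 2)) :=
      (by fun_prop : Continuous fun s : ℝ => 1 + (s - t) ^ 2).tendsto t
    rw [sub_self, zero_pow two_ne_zero, add_zero] at this
    exact this.mono_left nhdsWithin_le_nhds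
  refine le_of_tendsto_of_tendsto h2 h3 ?_
  have h4 : ∀ᶠ s in 𝓝[≠] t, |s - t| ≤ 1 := by
    refine nhdsWithin_le_nhds ?_
    filter_upwards [Metric.closedBall_mem_nhds t one_pos] with s hs
    simpa [Real.dist_eq] using hs
  filter_upwards [h4, self_mem_nhdsWithin] with s hs hne
  have hst : s - t ≠ 0 := sub_ne_zero.2 hne
  have hR : -mink (c s).1 (c t).1 ≤ Real.cosh (s - t) := by
    rcases le_total s t with h5 | h5
    · have := (h.related s t h5).dist
      rwa [← neg_sub, Real.cosh_neg] at this
    · rw [mink_comm]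
      exact (h.related t s h5).dist
  have e : mink (slope (fun s => (c s).1) t s) (slope (fun s => (c s).1) t s) =
      (-2 - 2 * mink (c s).1 (c t).1) / (s - t) ^ 2 := by
    rw [slope_def_module]
    simp only [mink_smul_left, mink_smul_right, mink_sub_left, mink_sub_right, (c s).2.1,
      (c t).2.1, mink_comm (c t).1]
    field_simp
    ring
  rw [e, div_le_iff₀ (by positivity)]
  have := two_mul_cosh_sub_two_le hs
  linarith

/-- By the reversed Cauchy–Schwarz inequality, `⟨c s, c t⟩` is maximal at `s = t`. -/
theorem mink_deriv_eq_zero {t : ℝ} {v : Fin 4 → ℝ}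
    (hv : HasDerivAt (fun s => (c s).1) v t) : mink (c t).1 v = 0 := by
  rw [mink_comm]
  refine IsLocalMax.hasDerivAt_eq_zero (Eventually.of_forall fun s => ?_)
    (hasDerivAt_mink hv (c t).1)
  have := OnSheet.mink_le_neg_one (p := (c s).1) (q := (c t).1) (c s).2 (c t).2
  simp only [(c t).2.1]
  exact this

/-- The component of `v` along `m` is the derivative of the foot, at least `1 - 2κ` by monotonicity,
multiplied by `cdist`, which is at least `1`. -/
theorem le_mink_deriv_vel (h : BentCurve κ c U) (hκ : 0 ≤ κ) (hκ1 : κ < 1 / 4)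
    {m : GeodesicLine 3} (hm : m.JoinsEndpointsOf c) {t : ℝ} {v : Fin 4 → ℝ}
    (hv : HasDerivAt (fun s => (c s).1) v t) :
    1 - 2 * κ ≤ mink v (m.vel (m.foot (c t))) := by
  have d1 := (hasDerivAt_mink hv m.tail).neg.log (m.mink_tail_pos (c t)).ne'
  have d2 := (hasDerivAt_mink hv m.head).neg.log (m.mink_head_pos (c t)).ne'
  have d3 : HasDerivAt (fun s => m.foot (c s)) _ t := (d1.sub d2).div_const 2
  obtain ⟨d, hd⟩ : ∃ d, d = (-mink v m.tail / -mink (c t).1 m.tail -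
    -mink v m.head / -mink (c t).1 m.head) / 2 := ⟨_, rfl⟩
  have hmono : Monotone fun s => m.foot (c s) - (1 - 2 * κ) * s := fun a b hab => by
    have := (h.foot_sub_mem hκ hκ1 hm hab).1
    simp only
    linarith
  have d4 := (d3.sub ((hasDerivAt_id t).const_mul (1 - 2 * κ))).deriv
  have d5 := hmono.deriv_nonneg (x := t)
  have d6 : 1 - 2 * κ ≤ d := by
    rw [hd]
    have : deriv (fun s => m.foot (c s) - (1 - 2 * κ) * s) t =
        deriv ((fun s => m.foot (c s)) - fun s => (1 - 2 * κ) * id s) t := rfl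
    rw [this, d4] at d5
    simp only [Pi.neg_apply] at d5
    linarith
  have h1 := m.exp_foot (c t)
  have h2 := m.exp_neg_foot (c t)
  have p1 := m.mink_tail_pos (c t)
  have p2 := m.mink_head_pos (c t)
  have h3 : mink v (m.vel (m.foot (c t))) = m.cdist (c t) * d := by
    rw [GeodesicLine.vel_eq_head_tail, mink_comb, hd, mul_div_assoc', mul_sub]
    nth_rewrite 1 [← h2]
    rw [← h1]
    have := (neg_pos.1 p1).ne
    have := (neg_pos.1 p2).ne
    field_simp
    ring
  rw [h3]
  have := m.one_le_cdist (c t)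
  nlinarith

end BentCurve

/-! ### Existence of the bending map and conclusion -/

namespace MeasuredLamination

variable (L : MeasuredLamination)

theorem exists_bendLimit (x y : Hyp 2) : ∃ P, IsBendLimit L.measure (L.between x y) P :=
  (L.hasFinePartitions_between x y).exists_isBendLimit (fun _ ha => norm_le_of_between ha)
    (L.measure_between_ne_top x y)

theorem hypArea_univ_ne_zero : hypArea Set.univ ≠ 0 := by
  have himg : (fun x : Hyp 2 => fun i : Fin 2 => x.1 i.succ) '' Set.univ = Set.univ := by
    refine Set.eq_univ_of_forall fun u => ?_
    have h1 : 0 ≤ u 0 ^ 2 + u 1 ^ 2 := by positivity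
    refine ⟨⟨![Real.sqrt (1 + (u 0 ^ 2 + u 1 ^ 2)), u 0, u 1], ?_, ?_⟩, trivial, ?_⟩
    · have := Real.mul_self_sqrt (by linarith : 0 ≤ 1 + (u 0 ^ 2 + u 1 ^ 2))
      simp [mink_two]
      linarith
    · exact Real.sqrt_pos.2 (by linarith)
    · ext i
      fin_cases i <;> rfl
  have hpos : ∀ u : Fin 2 → ℝ, 0 < 1 + ∑ i, u i ^ 2 := fun u => by positivity
  have hm : Measurable fun u : Fin 2 → ℝ => ENNReal.ofReal (1 / Real.sqrt (1 + ∑ i, u i ^ 2)) := by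
    fun_prop
  intro h
  rw [hypArea, himg, Measure.restrict_univ, lintegral_eq_zero_iff hm] at h
  obtain ⟨u, hu⟩ := h.exists
  have h1 := Real.sqrt_pos.2 (hpos u)
  have h2 : (0 : ℝ) < 1 / Real.sqrt (1 + ∑ i, u i ^ 2) := by positivity
  exact (ENNReal.ofReal_pos.2 h2).ne' hu

theorem exists_isBendingMap (h : hypArea L.support = 0) : ∃ β, L.IsBendingMap β := by
  obtain ⟨x, hx⟩ : ∃ x, x ∉ L.support := by
    by_contra hc
    push Not at hc
    rw [Set.eq_univ_of_forall hc] at h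
    exact hypArea_univ_ne_zero h
  choose P hP using L.exists_bendLimit x
  have hiso : ∀ y, IsHypIsometry (P y) := fun y =>
    (hP y).isHypIsometry (L.hasFinePartitions_between x y)
  refine ⟨fun y => ⟨P y (planeIncl y.1), (hiso y).2 _ (onSheet_planeIncl y.2)⟩, x, ?_,
    LinearMap.id, fun _ _ => rfl, fun p => p.2.2, fun y e he => L.tendsto_finiteBending (hP y) he⟩
  have hsub : {e : OrientedGeodesic | x ∈ e.carrier} ⊆ L.leavesᶜ :=
    fun e he hel => hx (Set.mem_biUnion hel he)
  exact measure_mono_null hsub L.measure_compl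

/-- The image of a geodesic that crosses the lamination at small angles. -/
theorem exists_bentCurve {β : Hyp 2 → Hyp 3} (hβ : L.IsBendingMap β) {l : GeodesicLine 2}
    {κ : ℝ} (hκ1 : κ ≤ 1 / 2) (h : L.angle l < κ / 12) :
    ∃ U, BentCurve κ (fun t => β (l.pt t)) U := by
  obtain ⟨x, -, g, hg, hg0, hlim⟩ := hβ
  obtain ⟨u⟩ := exists_directionField (by linarith) h
  have hη : 0 ≤ 2 * (κ / 12) := (abs_nonneg _).trans (u.abs_slope_le 0)
  choose P hP using L.exists_bendLimit x
  obtain ⟨G, hG⟩ : ∃ G : (Fin 4 → ℝ) →L[ℝ] (Fin 4 → ℝ), G = LinearMap.toContinuousLinearMap g :=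
    ⟨_, rfl⟩
  have hGg : ∀ v, G v = g v := fun v => by rw [hG]; rfl
  have hGiso : IsHypIsometry G :=
    ⟨fun v w => by rw [hGg, hGg, hg], fun v hv => ⟨by rw [hGg, hg, hv.1],
      by rw [hGg]; exact hg0 ⟨v, hv⟩⟩⟩
  have hval : ∀ y, (β y).1 = (G * P y) (planeIncl y.1) := fun y => by
    obtain ⟨e, he⟩ := L.exists_isChoiceOfLeaves x y
    have h1 := hlim y e he
    have h2 := (G.continuous.tendsto _).comp (L.tendsto_finiteBending (hP y) he)
    simp only [← hGg] at h1
    exact tendsto_nhds_unique h1 h2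
  have hiso : ∀ y, IsHypIsometry ⇑(G * P y) := fun y =>
    hGiso.comp ((hP y).isHypIsometry (L.hasFinePartitions_between x y))
  refine ⟨fun t => u.heading (G * P (l.pt t)) t, fun t => ?_, fun t => ?_, fun t => ?_,
    fun s t hst => ?_⟩
  · rw [hval, DirectionField.heading, (hiso _).1, mink_planeIncl, u.mink_pt_dirAt]
  · rw [DirectionField.heading, (hiso _).1, mink_planeIncl, u.mink_dirAt_dirAt]
    linarith [sq_nonneg (u.slope t)]
  · rw [DirectionField.heading, (hiso _).1, mink_planeIncl, u.mink_dirAt_dirAt]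
    have := u.abs_slope_le t
    nlinarith [abs_nonneg (u.slope t), sq_abs (u.slope t)]
  · have := u.coneRelated (κ := κ) (by norm_num) (by linarith) hκ1 (by linarith) hst hGiso
      (hP (l.pt s)) (hP (l.pt t))
    simp only [hval]
    exact this

end MeasuredLamination

theorem exists_small_parameter {δ : ℝ} (hδ : 0 < δ) : ∃ κ, 0 < κ ∧ κ < 1 / 4 ∧
    (1 + δ)⁻¹ ≤ 1 - 2 * κ ∧ Real.pi / 2 - δ < Real.arcsin (1 - 2 * κ) ∧
    1 < (1 - 3 * κ) * Real.cosh δ ^ 2 := by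
  have t : ∀ {f : ℝ → ℝ}, Continuous f → Tendsto f (𝓝[>] 0) (𝓝 (f 0)) := fun hf =>
    (hf.tendsto 0).mono_left nhdsWithin_le_nhds
  have h1 : ∀ᶠ κ : ℝ in 𝓝[>] 0, (1 + δ)⁻¹ < 1 - 2 * κ :=
    (t (f := fun κ => 1 - 2 * κ) (by fun_prop)).eventually
      (lt_mem_nhds (by simpa using inv_lt_one_of_one_lt₀ (by linarith : 1 < 1 + δ)))
  have h2 : ∀ᶠ κ : ℝ in 𝓝[>] 0, Real.pi / 2 - δ < Real.arcsin (1 - 2 * κ) :=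
    (t (f := fun κ => Real.arcsin (1 - 2 * κ))
      (Real.continuous_arcsin.comp (by fun_prop))).eventually
      (lt_mem_nhds (by simp [hδ]))
  have h3 : ∀ᶠ κ : ℝ in 𝓝[>] 0, 1 < (1 - 3 * κ) * Real.cosh δ ^ 2 :=
    (t (f := fun κ => (1 - 3 * κ) * Real.cosh δ ^ 2) (by fun_prop)).eventually
      (lt_mem_nhds (by
        have := Real.one_lt_cosh.2 hδ.ne'
        simp only [mul_zero, sub_zero, one_mul]
        nlinarith))
  have h4 : ∀ᶠ κ : ℝ in 𝓝[>] 0, κ < 1 / 4 :=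
    nhdsWithin_le_nhds (gt_mem_nhds (by norm_num))
  obtain ⟨κ, ⟨⟨⟨k1, k2⟩, k3⟩, k4⟩, k5⟩ :=
    ((((h1.and h2).and h3).and h4).and self_mem_nhdsWithin).exists
  exact ⟨κ, k5, k4, k1.le, k2, k3⟩

theorem mainTheorem7 (δ : ℝ) (hδ : 0 < δ) :
    ∃ ε : ℝ, 0 < ε ∧ ∀ (L : MeasuredLamination) (l : GeodesicLine 2),
      hypArea L.support = 0 → L.angle l < ε →
        (∃ β : Hyp 2 → Hyp 3, L.IsBendingMap β) ∧
        ∀ β : Hyp 2 → Hyp 3, L.IsBendingMap β →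
          BilipschitzOn (1 + δ) β (Set.range l.pt) ∧
          (∃ m : GeodesicLine 3, m.JoinsEndpointsOf (fun t => β (l.pt t))) ∧
          ∀ m : GeodesicLine 3, m.JoinsEndpointsOf (fun t => β (l.pt t)) →
            (∀ t : ℝ, ∃ q ∈ Set.range m.pt, hdist (β (l.pt t)) q < δ) ∧
            (∀ (t : ℝ) (v : Fin 4 → ℝ),
              HasDerivAt (fun s => (β (l.pt s)).1) v t →
                AlmostParallel δ m (β (l.pt t)) v) ∧
            BilipschitzOn (1 + δ) (fun x => m.proj (β x)) (Set.range l.pt) := by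
  obtain ⟨κ, hκ0, hκ1, hκ2, hκ3, hκ4⟩ := exists_small_parameter hδ
  -- Slopes are at most `η = 2ε` with Lipschitz constant `3η`, and cone expansion requires `(3 + 3)η
  -- ≤ κ`; hence `12`.
  refine ⟨κ / 12, by positivity, fun L l hL hl => ⟨L.exists_isBendingMap hL, fun β hβ => ?_⟩⟩
  obtain ⟨U, hU⟩ := L.exists_bentCurve hβ (by linarith) hl
  have bounds : ∀ {a b : ℝ}, (1 - 2 * κ) * |a| ≤ b → b ≤ |a| →
      (1 + δ)⁻¹ * |a| ≤ b ∧ b ≤ (1 + δ) * |a| := fun {a b} h1 h2 =>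
    ⟨(mul_le_mul_of_nonneg_right hκ2 (abs_nonneg a)).trans h1,
      h2.trans (le_mul_of_one_le_left (abs_nonneg a) (by linarith))⟩
  refine ⟨?_, hU.exists_joins hκ0.le hκ1, fun m hm => ⟨fun t => ?_, fun t v hv => ?_, ?_⟩⟩
  · rintro _ ⟨s, rfl⟩ _ ⟨t, rfl⟩
    rw [l.hdist_pt]
    exact bounds (hU.hdist_mem hκ0.le s t).1 (hU.hdist_mem hκ0.le s t).2
  · refine ⟨_, ⟨m.foot (β (l.pt t)), rfl⟩, m.hdist_foot_lt hδ ?_⟩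
    have h1 := hU.cdist_sq_le hκ0.le hκ1 hm t
    have h2 : m.cdist (β (l.pt t)) ^ 2 < Real.cosh δ ^ 2 := by
      have h3 : 0 < 1 - 3 * κ := by linarith
      by_contra hc
      have := mul_le_mul_of_nonneg_left (not_lt.1 hc) h3.le
      linarith
    exact lt_of_pow_lt_pow_left₀ 2 (Real.cosh_pos δ).le h2
  · refine ⟨m.foot (β (l.pt t)), m.mink_vel_foot _, ?_⟩
    have h1 := hU.mink_deriv_le_one hv
    have h2 := hU.le_mink_deriv_vel hκ0.le hκ1 hm hv
    have h3 := BentCurve.mink_deriv_eq_zero hv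
    have h4 := OnSheet.tangent_sq_le (p := (β (l.pt t)).1) (β (l.pt t)).2 h3
      (m.mink_vel_foot (β (l.pt t)))
    rw [m.mink_vel_vel, mul_one] at h4
    obtain ⟨w, hw⟩ : ∃ w, w = mink v (m.vel (m.foot (β (l.pt t)))) := ⟨_, rfl⟩
    rw [← hw] at h2 h4
    have hw0 : 0 < w := by linarith
    have h5 : 0 < Real.sqrt (mink v v) := Real.sqrt_pos.2 (by nlinarith)
    have h6 : 1 - 2 * κ ≤ |w| / Real.sqrt (mink v v) := by
      rw [abs_of_pos hw0, le_div_iff₀ h5]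
      have : Real.sqrt (mink v v) ≤ 1 := Real.sqrt_le_one.2 h1
      nlinarith
    have h7 := Real.monotone_arcsin h6
    have h8 := Real.arcsin_le_pi_div_two (|w| / Real.sqrt (mink v v))
    rw [angleWithHyperplane, ← hw, abs_sub_lt_iff]
    constructor <;> linarith
  · rintro _ ⟨s, rfl⟩ _ ⟨t, rfl⟩
    have h1 := hU.mul_abs_le_abs_foot_sub hκ0.le hκ1 hm s t
    simp only [l.hdist_pt, m.proj_eq, m.hdist_pt]
    exact bounds h1.1 h1.2
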